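/- Let $\gamma_0>0$, let $T,D\in\mathbb N$, and let tasks $\mathcal T_1,\dots,\mathcal T_T$ be finite data sets of samples $(x_\mu,y_\mu)\in\mathbb R^D\times\mathbb R$, trained one after the other, task $j$ in the time window $(t_{j-1},t_j)$, where $0=t_0\le t_1\le\dots\le t_T<\infty$. Indices $\mu,\nu$ range over all samples of all tasks. Let $\phi:\mathbb R\to\mathbb R$ be differentiable, with $\phi'$ bounded and Lipschitz. Put $K^x_{\mu\nu}=\frac1D\langle x_\mu,x_\nu\rangle$ and $\tilde U_j(t)=\mathbf 1_{t>t_{j-1}}\mathbf 1_{t<t_j}$. For each width $N$ consider the network with one hidden layer, without skip connections, in $\mu$P, $$h(x)=\tfrac1{\sqrt D}Wx\in\mathbb R^N,\qquad h^{2}(x)=\tfrac1{\sqrt N}\,w\cdot\phi(h(x)),\qquad f^N(x)=\tfrac1{\gamma_0\sqrt N}\,h^{2}(x),$$ with all entries of $W,w$ initially independent $\mathcal N(0,1)$. While task $j$ is trained, all parameters $\theta=(W,w)$ follow the gradient flow $\dot\theta=-\gamma_0^2N\,\nabla\mathcal L_j(\theta)$ of $\mathcal L_j=\sum_{\alpha\in\mathcal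 T_j}\frac12(y_\alpha-f^N(x_\alpha))^2$, and $\theta$ is continuous on $[0,t_T]$. Let $z^N(t)=w(t)$ be the pre-gradients, $g^N_{\mu}=\sqrt N\,\partial h^{2}(x_\mu)/\partial h(x_\mu)\in\mathbb R^N$ the gradient neurons, and $$\Phi^N_{\mu\nu}(t)=\tfrac1N\langle\phi(h^N_\mu(t)),\phi(h^N_\nu(t))\rangle,\qquad G^N_{\mu\nu}(t)=\tfrac1N\langle g^N_\mu(t),g^N_\nu(t)\rangle .$$ Let $\chi=(\chi_\mu)_\mu\sim\mathcal N(0,K^x)$ and $\xi\sim\mathcal N(0,1)$ be independent. A solution of the single-site system consists of deterministic continuous functions $f_\mu:[0,t_T]\to\mathbb R$ and real-valued processes $h_\mu,z$ with continuous paths on $[0,t_T]$ such that, with $\Delta_\alpha=y_\alpha-f_\alpha$ and $g_\mu=\phi'(h_\mu)\,z$, almost surely for all $t\in[0,t_T]$ and all $\mu$ $$h_\mu(t)=\chi_\mu+\gamma_0\int_0^t\sum_{j=1}^T\tilde U_j(s)\sum_{\alpha\in\mathcal T_j}\Delta_\alpha(s)\,g_\alpha(s)\,K^x_{\mu\alpha}\,ds,$$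 $$z(t)=\xi+\gamma_0\int_0^t\sum_{j=1}^T\tilde U_j(s)\sum_{\alpha\in\mathcal T_j}\Delta_\alpha(s)\,\phi(h_\alpha(s))\,ds,$$ and, with the (finite) expectations $\Phi_{\mu\nu}(t)=\mathbb E[\phi(h_\mu(t))\phi(h_\nu(t))]$ and $G_{\mu\nu}(t)=\mathbb E[g_\mu(t)g_\nu(t)]$, $$f_\mu(t)=\int_0^t\sum_{j=1}^T\tilde U_j(s)\sum_{\alpha\in\mathcal T_j}\big(\Phi_{\mu\alpha}(s)+G_{\mu\alpha}(s)K^x_{\mu\alpha}\big)\Delta_\alpha(s)\,ds .$$ Then the single-site system has a solution, and for every solution the following hold as $N\to\infty$. 1. For every $k$ and every choice, for each $N\ge k$, of $k$ distinct neurons, the trajectories $\big((h^N_{\mu,i}(t))_\mu,z^N_i(t)\big)_{t\in[0,t_T]}$ of these $k$ neurons converge jointly in distribution, as random continuous functions on $[0,t_T]$, to $k$ independent copies of $\big((h_\mu(t))_\mu,z(t)\big)_{t\in[0,t_T]}$. 2. For all $\mu,\nu$, uniformly in $t\in[0,t_T]$ and in probability, $\Phi^N_{\mu\nu}(t)\to\mathbb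 E[\phi(h_\mu(t))\phi(h_\nu(t))]$ and $G^N_{\mu\nu}(t)\to\mathbb E[g_\mu(t)g_\nu(t)]$. 3. For every $\mu$, uniformly in $t\in[0,t_T]$ and in probability, $f^N(x_\mu)$ at time $t$ converges to $f_\mu(t)$, and $f_\mu(t)=\gamma_0^{-1}\,\mathbb E[z(t)\phi(h_\mu(t))]$, where the expectation is finite. -/

import Mathlib

open MeasureTheory ProbabilityTheory Filter Topology Set

noncomputable section

namespace ContinualMuP

/-- A sequence of `T` supervised tasks with inputs in `ℝ^D`. Task `j : Fin T` consists of the samples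
`⟨j, a⟩` with `a : Fin (size j)` and is trained on the time window from `time j.castSucc` to
`time j.succ`. -/
structure TaskSequence (T D : ℕ) where
  size : Fin T → ℕ
  input : (Σ j, Fin (size j)) → EuclideanSpace ℝ (Fin D)
  label : (Σ j, Fin (size j)) → ℝ
  time : Fin (T + 1) → ℝ
  time_zero : time 0 = 0
  time_mono : Monotone time

variable {T D : ℕ}

/-- The index type of all samples of all tasks. -/
abbrev TaskSequence.Sample (S : TaskSequence T D) : Type := Σ j, Fin (S.size j)

/-- The time at which training on the last task ends. -/
def TaskSequence.horizon (S : TaskSequence T D) : ℝ := S.time (Fin.last T)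

/-- The input covariance across tasks, `K^x_{μν} = ⟨x_μ, x_ν⟩ / D`. -/
def TaskSequence.inputKernel (S : TaskSequence T D) : Matrix S.Sample S.Sample ℝ :=
  fun μ ν => inner ℝ (S.input μ) (S.input ν) / D

/-- Heaviside step function `U(t) = 1_{t > 0}`. -/
def heaviside (t : ℝ) : ℝ := if 0 < t then 1 else 0

/-- The window of task `j`: `Ũ_j(t) = U(t - t_{j-1}) U(t_j - t)`. -/
def TaskSequence.window (S : TaskSequence T D) (j : Fin T) (t : ℝ) : ℝ :=
  heaviside (t - S.time j.castSucc) * heaviside (S.time j.succ - t)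

/-! ### The network of finite width -/

/-- Parameters of a one-hidden-layer network of width `N`: the hidden weights `W_{id}` (coordinates
`Sum.inl (i, d)`) and the output weights `w_i` (coordinates `Sum.inr i`). -/
abbrev Param (N D : ℕ) : Type := EuclideanSpace ℝ ((Fin N × Fin D) ⊕ Fin N)

/-- Hidden preactivations `h¹(x) = D^{-1/2} W x`. -/
def preact {N : ℕ} (θ : Param N D) (x : EuclideanSpace ℝ (Fin D)) (i : Fin N) : ℝ :=
  (1 / √(D : ℝ)) * ∑ d, θ (Sum.inl (i, d)) * x d

/-- The last preactivation `h² = N^{-1/2} w · φ(h)` as a function of the hidden preactivations. -/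
def readout (φ : ℝ → ℝ) {N : ℕ} (θ : Param N D) (h : Fin N → ℝ) : ℝ :=
  (1 / √(N : ℝ)) * ∑ i, θ (Sum.inr i) * φ (h i)

/-- The output `f(x) = h² / γ` in μP, with `γ = γ₀ N^{1/2}`. -/
def output (φ : ℝ → ℝ) (γ₀ : ℝ) {N : ℕ} (θ : Param N D) (x : EuclideanSpace ℝ (Fin D)) : ℝ :=
  readout φ θ (preact θ x) / (γ₀ * √(N : ℝ))

/-- Gradient neurons `g_i = N^{1/2} ∂h² / ∂h¹_i`. -/
def gradNeuron (φ : ℝ → ℝ) {N : ℕ} (θ : Param N D) (x : EuclideanSpace ℝ (Fin D))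
    (i : Fin N) : ℝ :=
  √(N : ℝ) * deriv (fun u => readout φ θ (Function.update (preact θ x) i u)) (preact θ x i)

/-- Pre-gradients: for a single hidden layer `z¹ = w`. -/
def preGrad {N : ℕ} (θ : Param N D) (i : Fin N) : ℝ := θ (Sum.inr i)

/-- The feature kernel `Φ¹ = N⁻¹ ⟨φ(h(x)), φ(h(x'))⟩`. -/
def featureKernel (φ : ℝ → ℝ) {N : ℕ} (θ : Param N D) (x x' : EuclideanSpace ℝ (Fin D)) : ℝ :=
  (1 / (N : ℝ)) * ∑ i, φ (preact θ x i) * φ (preact θ x' i)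

/-- The gradient kernel `G¹ = N⁻¹ ⟨g(x), g(x')⟩`. -/
def gradientKernel (φ : ℝ → ℝ) {N : ℕ} (θ : Param N D) (x x' : EuclideanSpace ℝ (Fin D)) : ℝ :=
  (1 / (N : ℝ)) * ∑ i, gradNeuron φ θ x i * gradNeuron φ θ x' i

/-- The mean squared error on task `j`. -/
def taskLoss (S : TaskSequence T D) (φ : ℝ → ℝ) (γ₀ : ℝ) {N : ℕ} (j : Fin T)
    (θ : Param N D) : ℝ :=
  ∑ a : Fin (S.size j), (1 / 2) * (S.label ⟨j, a⟩ - output φ γ₀ θ (S.input ⟨j, a⟩)) ^ 2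

/-- `θ` is a trajectory of sequential training: continuous on the whole training period, and
following gradient flow on the loss of task `j`, with the μP learning rate `η = γ₀² N`, in the
window of task `j`. -/
structure IsSequentialGradientFlow (S : TaskSequence T D) (φ : ℝ → ℝ) (γ₀ : ℝ) {N : ℕ}
    (θ : ℝ → Param N D) : Prop where
  continuousOn : ContinuousOn θ (Icc 0 S.horizon)
  hasDerivAt : ∀ j : Fin T, ∀ t ∈ Ioo (S.time j.castSucc) (S.time j.succ),
    HasDerivAt θ (-((γ₀ ^ 2 * N) • gradient (taskLoss S φ γ₀ j) (θ t))) t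

/-- All weights are independent standard Gaussians. -/
structure IsStandardInit {N : ℕ} {Ω : Type*} [MeasurableSpace Ω] (P : Measure Ω)
    (θ₀ : Ω → Param N D) : Prop where
  hasLaw : ∀ p, HasLaw (fun ω => θ₀ ω p) (gaussianReal 0 1) P
  indep : iIndepFun (fun p ω => θ₀ ω p) P

/-! ### The single-site process -/

/-- The initial fields: `χ ~ 𝒩(0, K^x)` and `ξ ~ 𝒩(0, 1)`, independent of each other. -/
structure IsInitialField (S : TaskSequence T D) {Ω : Type*} [MeasurableSpace Ω] (P : Measure Ω)
    (χ : Ω → EuclideanSpace ℝ S.Sample) (ξ : Ω → ℝ) : Prop where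
  law_χ : HasLaw χ (multivariateGaussian 0 S.inputKernel) P
  law_ξ : HasLaw ξ (gaussianReal 0 1) P
  indep : IndepFun χ ξ P

/-- The gradient variable `g = φ'(h) z` of the single-site process. -/
def siteGrad {ι Ω : Type*} (φ : ℝ → ℝ) (h : ι → ℝ → Ω → ℝ) (z : ℝ → Ω → ℝ)
    (μ : ι) (t : ℝ) (ω : Ω) : ℝ :=
  deriv φ (h μ t ω) * z t ω

/-- `𝔼[φ(h_μ(t)) φ(h_ν(t))]`. -/
def siteFeatureKernel {ι Ω : Type*} [MeasurableSpace Ω] (P : Measure Ω) (φ : ℝ → ℝ)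
    (h : ι → ℝ → Ω → ℝ) (μ ν : ι) (t : ℝ) : ℝ :=
  ∫ ω, φ (h μ t ω) * φ (h ν t ω) ∂P

/-- `𝔼[g_μ(t) g_ν(t)]`. -/
def siteGradientKernel {ι Ω : Type*} [MeasurableSpace Ω] (P : Measure Ω) (φ : ℝ → ℝ)
    (h : ι → ℝ → Ω → ℝ) (z : ℝ → Ω → ℝ) (μ ν : ι) (t : ℝ) : ℝ :=
  ∫ ω, siteGrad φ h z μ t ω * siteGrad φ h z ν t ω ∂P

/-- The closed self-consistent system of the infinite-width limit: a single-site process `(h, z)`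
driven by the initial fields `(χ, ξ)` and by the deterministic residuals `Δ_α = y_α - f_α`, and
deterministic outputs `f` that evolve with the tangent kernel `Φ + G K^x` formed from the moments
of `(h, z)`. -/
structure IsSingleSiteSolution (S : TaskSequence T D) (φ : ℝ → ℝ) (γ₀ : ℝ)
    {Ω : Type*} [MeasurableSpace Ω] (P : Measure Ω)
    (χ : Ω → EuclideanSpace ℝ S.Sample) (ξ : Ω → ℝ)
    (f : S.Sample → ℝ → ℝ) (h : S.Sample → ℝ → Ω → ℝ) (z : ℝ → Ω → ℝ) : Prop where
  continuousOn_f : ∀ μ, ContinuousOn (f μ) (Icc 0 S.horizon)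
  aemeasurable_h : ∀ μ, ∀ t ∈ Icc 0 S.horizon, AEMeasurable (h μ t) P
  aemeasurable_z : ∀ t ∈ Icc 0 S.horizon, AEMeasurable (z t) P
  continuousOn_h : ∀ᵐ ω ∂P, ∀ μ, ContinuousOn (fun t => h μ t ω) (Icc 0 S.horizon)
  continuousOn_z : ∀ᵐ ω ∂P, ContinuousOn (fun t => z t ω) (Icc 0 S.horizon)
  integrable_feature : ∀ μ ν, ∀ t ∈ Icc 0 S.horizon,
    Integrable (fun ω => φ (h μ t ω) * φ (h ν t ω)) P
  integrable_gradient : ∀ μ ν, ∀ t ∈ Icc 0 S.horizon,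
    Integrable (fun ω => siteGrad φ h z μ t ω * siteGrad φ h z ν t ω) P
  h_eq : ∀ᵐ ω ∂P, ∀ μ, ∀ t ∈ Icc 0 S.horizon,
    h μ t ω = χ ω μ + γ₀ * ∫ s in (0 : ℝ)..t, ∑ j, S.window j s *
      ∑ a : Fin (S.size j), (S.label ⟨j, a⟩ - f ⟨j, a⟩ s) * siteGrad φ h z ⟨j, a⟩ s ω *
        S.inputKernel μ ⟨j, a⟩
  z_eq : ∀ᵐ ω ∂P, ∀ t ∈ Icc 0 S.horizon,
    z t ω = ξ ω + γ₀ * ∫ s in (0 : ℝ)..t, ∑ j, S.window j s *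
      ∑ a : Fin (S.size j), (S.label ⟨j, a⟩ - f ⟨j, a⟩ s) * φ (h ⟨j, a⟩ s ω)
  f_eq : ∀ μ, ∀ t ∈ Icc 0 S.horizon,
    f μ t = ∫ s in (0 : ℝ)..t, ∑ j, S.window j s *
      ∑ a : Fin (S.size j),
        (siteFeatureKernel P φ h μ ⟨j, a⟩ s +
          siteGradientKernel P φ h z μ ⟨j, a⟩ s * S.inputKernel μ ⟨j, a⟩) *
        (S.label ⟨j, a⟩ - f ⟨j, a⟩ s)

/-! ### Modes of convergence -/

/-- The random functions `X N` converge in probability, uniformly on `[0, b]`, to the deterministic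
function `x`. -/
def ConcentratesOn {Ω : ℕ → Type*} [∀ N, MeasurableSpace (Ω N)] (P : ∀ N, Measure (Ω N))
    (b : ℝ) (X : ∀ N, Ω N → ℝ → ℝ) (x : ℝ → ℝ) : Prop :=
  ∀ ε > 0, Tendsto (fun N => P N {ω | ∃ t ∈ Icc 0 b, ε ≤ |X N ω t - x t|}) atTop (𝓝 0)

instance pathMeasurableSpace {b : ℝ} {E : Type*} [TopologicalSpace E] :
    MeasurableSpace C(Icc (0 : ℝ) b, E) := borel _

instance pathBorelSpace {b : ℝ} {E : Type*} [TopologicalSpace E] :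
    BorelSpace C(Icc (0 : ℝ) b, E) := ⟨rfl⟩

/-- The restriction of `u` to `[0, b]` as an element of the path space `C([0, b], E)` (the zero
path if `u` is not continuous there). -/
def pathOn (b : ℝ) {E : Type*} [TopologicalSpace E] [Zero E] (u : ℝ → E) :
    C(Icc (0 : ℝ) b, E) :=
  ContinuousMap.mkD (fun t : Icc (0 : ℝ) b => u t) 0

end ContinualMuP

end

open ContinualMuP

/-!
The neurons of a network in training interact only through its outputs. Differentiating the loss
shows that the state `(h_i, w_i)` of every neuron follows one and the same vector field `siteField`,
driven by the residuals `y_α - f^N(x_α)`, and the output `f^N(x_μ)` is `γ₀⁻¹` times the empirical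
mean of `w_i φ(h_{μ,i})` over the neurons (`IsSequentialGradientFlow.isPath_neuronState`,
`output_eq_average`). At initialization the states are independent with the law of `(χ, ξ)`. So the
network is a system of particles with a mean-field interaction, and the single-site system is its
McKean-Vlasov limit.

*The limit.* A flow of the vector field whose driving outputs are its own means `γ₀⁻¹ 𝔼[z φ(h_μ)]`
solves the single-site system, because these means evolve with the tangent kernel `Φ + G K` and
vanish initially (`IsSiteFlow.integral_output`). For the same reason, every solution of the
single-site system moves along such a self-consistent flow (`IsSingleSiteSolution.exists_flow`).
Self-consistent flows with truncated residuals come from a contraction argument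
(`IsControlledField.exists_selfConsistent_flow`). The truncation is removed by an energy estimate:
the time derivative of `𝔼[z²]` is `2 γ₀² ∑ clip(Δ) (y - Δ) ≤ γ₀² ∑ y² / 2`, and with `𝔼[z²]` the
second moments of `h` and the outputs are bounded, independently of the level of truncation
(`exists_bound_selfConsistent`).

*Convergence.* Neuron `i` is coupled with the flow line that starts at its own initial state
(`IsControlledField.coupling`). The vector field is not globally Lipschitz: `φ'(h) z` has linear
growth, and its Lipschitz constant in `h` is proportional to `|z|`. The distance between the neuron
and its flow line is therefore only bounded by `exp (a (1 + ‖x_i‖))` times the integrated error of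
the outputs, where `x_i` is the initial state. Since Gaussian variables have all exponential
moments, the empirical means of these random constants are bounded with high probability, and
Grönwall's inequality applies to the error of the outputs as long as this error is at most `1`. By
the law of large numbers along the flow it starts with a small forcing, so that it stays small. This
gives the concentration of all empirical means (`IsMeanFieldSystem.average_observable`), and the
distance of each trajectory to its flow line tends to zero in probability
(`IsMeanFieldSystem.eventually_particle`). The flow lines of distinct neurons are independent
copies of the single-site process, which yields the convergence in distribution
(`IsMeanFieldSystem.tendstoInDistribution`).
-/

set_option linter.unusedSectionVars false

namespace ContinualMuP

/-! ### Integral inequalities and controlled differential equations -/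

/-- Grönwall's inequality in integral form. -/
theorem le_mul_exp_of_le_integral {u : ℝ → ℝ} {a k τ : ℝ} (hk : 0 ≤ k)
    (hu : ContinuousOn u (Icc 0 τ))
    (h : ∀ t ∈ Icc 0 τ, u t ≤ a + k * ∫ s in (0 : ℝ)..t, u s) :
    ∀ t ∈ Icc 0 τ, u t ≤ a * Real.exp (k * t) := by
  intro t ht
  have hτ : 0 ≤ τ := ht.1.trans ht.2
  let v : ℝ → ℝ := IccExtend hτ ((Icc 0 τ).domRestrict u)
  have hv : Continuous v := (continuousOn_iff_continuous_domRestrict.1 hu).Icc_extend'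
  have hvu : ∀ s ∈ Icc 0 τ, v s = u s := fun s hs => by
    simp [v, IccExtend_of_mem hτ _ hs, domRestrict]
  have hint : ∀ s ∈ Icc 0 τ, ∫ r in (0 : ℝ)..s, u r = ∫ r in (0 : ℝ)..s, v r := by
    intro s hs
    refine intervalIntegral.integral_congr fun r hr => ?_
    rw [uIcc_of_le hs.1] at hr
    exact (hvu r ⟨hr.1, hr.2.trans hs.2⟩).symm
  have hder : ∀ s, HasDerivAt (fun s => (a + k * ∫ r in (0 : ℝ)..s, v r) * Real.exp (-(k * s)))
      ((k * v s) * Real.exp (-(k * s))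
        + (a + k * ∫ r in (0 : ℝ)..s, v r) * (Real.exp (-(k * s)) * -(k * 1))) s := by
    intro s
    refine HasDerivAt.mul ?_ ?_
    · exact ((hv.integral_hasStrictDerivAt 0 s).hasDerivAt.const_mul k).const_add a
    · exact (((hasDerivAt_id s).const_mul k).neg).exp
  have hanti : AntitoneOn (fun s => (a + k * ∫ r in (0 : ℝ)..s, v r) * Real.exp (-(k * s)))
      (Icc 0 τ) := by
    refine antitoneOn_of_deriv_nonpos (convex_Icc _ _)
      (fun s _ => (hder s).continuousAt.continuousWithinAt)
      (fun s _ => (hder s).differentiableAt.differentiableWithinAt) fun s hs => ?_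
    rw [interior_Icc] at hs
    have hs' : s ∈ Icc 0 τ := Ioo_subset_Icc_self hs
    have h1 := h s hs'
    rw [hint s hs', ← hvu s hs'] at h1
    rw [(hder s).deriv]
    nlinarith [mul_nonneg (mul_nonneg hk (sub_nonneg.2 h1)) (Real.exp_pos (-(k * s))).le]
  have h2 := hanti ⟨le_rfl, hτ⟩ ht ht.1
  have h3 := h t ht
  rw [hint t ht] at h3
  simp only [intervalIntegral.integral_same, mul_zero, add_zero, neg_zero, Real.exp_zero,
    mul_one, Real.exp_neg] at h2
  rw [← div_eq_mul_inv, div_le_iff₀ (Real.exp_pos _)] at h2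
  exact h3.trans h2

variable {V E W : Type*} [NormedAddCommGroup V] [NormedAddCommGroup E]
  [NormedSpace ℝ E] [NormedAddCommGroup W]

/-- A vector field `F c X` on `E` with control `c`: Lipschitz in the control with a constant that
grows linearly with the state, of at most linear growth in the state, and Lipschitz in the state with
a constant that grows at most linearly with the second of the two states compared. -/
structure IsControlledField (F : V → E → E) (A : ℝ) : Prop where
  nonneg : 0 ≤ A
  growth : ∀ c X, ‖F c X‖ ≤ A * ‖c‖ * (1 + ‖X‖)
  lip : ∀ c c' X Y, ‖F c X - F c' Y‖ ≤
    A * ‖c - c'‖ * (1 + ‖Y‖) + A * ‖c‖ * (1 + ‖Y‖) * ‖X - Y‖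

/-- `X` solves `X' = F (c t) X`, `X 0 = x` on `[0, τ]` in integral form. -/
structure IsPath (F : V → E → E) (c : ℝ → V) (x : E) (τ : ℝ) (X : ℝ → E) : Prop where
  continuousOn : ContinuousOn X (Icc 0 τ)
  eq : ∀ t ∈ Icc 0 τ, X t = x + ∫ s in (0 : ℝ)..t, F (c s) (X s)

theorem IsControlledField.continuous {F : V → E → E} {A : ℝ} (hF : IsControlledField F A) :
    Continuous fun p : V × E => F p.1 p.2 := by
  refine continuous_iff_continuousAt.2 fun p => ?_
  refine tendsto_iff_norm_sub_tendsto_zero.2 ?_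
  refine squeeze_zero (fun _ => norm_nonneg _) (fun q => hF.lip q.1 p.1 q.2 p.2) ?_
  have : Continuous fun q : V × E => A * ‖q.1 - p.1‖ * (1 + ‖p.2‖)
      + A * ‖q.1‖ * (1 + ‖p.2‖) * ‖q.2 - p.2‖ := by fun_prop
  simpa using this.tendsto p

theorem IsPath.mono {F : V → E → E} {c : ℝ → V} {x : E} {τ σ : ℝ} {X : ℝ → E}
    (h : IsPath F c x τ X) (hσ : σ ≤ τ) : IsPath F c x σ X :=
  ⟨h.continuousOn.mono (Icc_subset_Icc_right hσ), fun t ht => h.eq t ⟨ht.1, ht.2.trans hσ⟩⟩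

/-- Paths depend on the control and on the solution only through their values on `[0, τ]`. -/
theorem IsPath.congr {F : V → E → E} {c c' : ℝ → V} {x : E} {τ : ℝ} {X X' : ℝ → E}
    (h : IsPath F c x τ X) (hc : ∀ t ∈ Icc 0 τ, c t = c' t) (hX : ∀ t ∈ Icc 0 τ, X t = X' t) :
    IsPath F c' x τ X' := by
  refine ⟨h.continuousOn.congr fun t ht => (hX t ht).symm, fun t ht => ?_⟩
  rw [← hX t ht, h.eq t ht]
  congr 1
  refine intervalIntegral.integral_congr fun s hs => ?_
  rw [uIcc_of_le ht.1] at hs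
  have hs' : s ∈ Icc 0 τ := ⟨hs.1, hs.2.trans ht.2⟩
  simp only [hc s hs', hX s hs']

theorem IsControlledField.intervalIntegrable {F : V → E → E} {A : ℝ} (hF : IsControlledField F A)
    {c : ℝ → V} {M τ : ℝ} (hc : AEStronglyMeasurable c) (hM : ∀ s ∈ Icc 0 τ, ‖c s‖ ≤ M)
    {X : ℝ → E} (hX : ContinuousOn X (Icc 0 τ)) {s t : ℝ} (hs : s ∈ Icc 0 τ) (ht : t ∈ Icc 0 τ) :
    IntervalIntegrable (fun r => F (c r) (X r)) volume s t := by
  have hsub : uIcc s t ⊆ Icc 0 τ := uIcc_subset_Icc hs ht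
  have hτ : (0 : ℝ) ∈ Icc 0 τ := ⟨le_rfl, hs.1.trans hs.2⟩
  have hM0 : 0 ≤ M := (norm_nonneg _).trans (hM 0 hτ)
  obtain ⟨R, hR⟩ := isCompact_Icc.exists_bound_of_continuousOn hX
  rw [intervalIntegrable_iff]
  refine IntegrableOn.mono_set ?_ (uIoc_subset_uIcc.trans hsub)
  refine Integrable.of_bound (C := A * M * (1 + R)) ?_ ?_
  · exact hF.continuous.comp_aestronglyMeasurable
      (hc.restrict.prodMk (hX.aestronglyMeasurable measurableSet_Icc))
  · refine (ae_restrict_iff' measurableSet_Icc).2 (ae_of_all _ fun r hr => ?_)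
    refine (hF.growth _ _).trans ?_
    have := hF.nonneg
    gcongr
    · exact hM r hr
    · exact hR r hr

/-- A priori bound: a path grows at most exponentially. -/
theorem IsPath.one_add_norm_le {F : V → E → E} {A : ℝ} (hF : IsControlledField F A)
    {c : ℝ → V} {M τ : ℝ} (hM : ∀ s ∈ Icc 0 τ, ‖c s‖ ≤ M) {x : E} {X : ℝ → E}
    (h : IsPath F c x τ X) {t : ℝ} (ht : t ∈ Icc 0 τ) :
    1 + ‖X t‖ ≤ (1 + ‖x‖) * Real.exp (A * M * t) := by
  have hτ : (0 : ℝ) ∈ Icc 0 τ := ⟨le_rfl, ht.1.trans ht.2⟩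
  have hM0 : 0 ≤ M := (norm_nonneg _).trans (hM 0 hτ)
  have hcont : ContinuousOn (fun t => 1 + ‖X t‖) (Icc 0 τ) := h.continuousOn.norm.const_add 1
  refine le_mul_exp_of_le_integral (mul_nonneg hF.nonneg hM0) hcont (fun t ht => ?_) t ht
  rw [h.eq t ht, ← intervalIntegral.integral_const_mul, add_assoc]
  refine add_le_add_right ((norm_add_le _ _).trans (add_le_add_right ?_ _)) _
  refine intervalIntegral.norm_integral_le_of_norm_le ht.1 (ae_of_all _ fun s hs => ?_) ?_
  · refine (hF.growth _ _).trans ?_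
    have := hF.nonneg
    gcongr
    exact hM s ⟨hs.1.le, hs.2.trans ht.2⟩
  · refine ContinuousOn.intervalIntegrable ?_
    rw [uIcc_of_le ht.1]
    exact (hcont.mono (Icc_subset_Icc_right ht.2)).const_mul _

theorem IsPath.one_add_norm_le' {F : V → E → E} {A : ℝ} (hF : IsControlledField F A)
    {c : ℝ → V} {M τ b : ℝ} (hM : ∀ s ∈ Icc 0 τ, ‖c s‖ ≤ M) {x : E} {X : ℝ → E}
    (h : IsPath F c x τ X) {t : ℝ} (ht : t ∈ Icc 0 τ) (hb : t ≤ b) :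
    1 + ‖X t‖ ≤ (1 + ‖x‖) * Real.exp (A * M * b) := by
  have hτ : (0 : ℝ) ∈ Icc 0 τ := ⟨le_rfl, ht.1.trans ht.2⟩
  have hM0 : 0 ≤ M := (norm_nonneg _).trans (hM 0 hτ)
  refine (h.one_add_norm_le hF hM ht).trans ?_
  have := mul_nonneg hF.nonneg hM0
  gcongr

/-- Stability of paths under changes of the initial value and of the control, by Grönwall's
inequality. The a priori bound `R` is needed for one of the two paths only. -/
theorem IsPath.norm_sub_le {F : V → E → E} {A : ℝ} (hF : IsControlledField F A)
    {c c' : ℝ → V} (hcm : AEStronglyMeasurable c) (hcm' : AEStronglyMeasurable c')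
    {M M' R τ : ℝ} (hM : ∀ s ∈ Icc 0 τ, ‖c s‖ ≤ M) (hM' : ∀ s ∈ Icc 0 τ, ‖c' s‖ ≤ M')
    {x y : E} {X Y : ℝ → E} (hX : IsPath F c x τ X) (hY : IsPath F c' y τ Y)
    (hR : ∀ s ∈ Icc 0 τ, 1 + ‖Y s‖ ≤ R) {t : ℝ} (ht : t ∈ Icc 0 τ) :
    ‖X t - Y t‖ ≤ (‖x - y‖ + A * R * ∫ s in (0 : ℝ)..t, ‖c s - c' s‖)
      * Real.exp (A * M * R * t) := by
  have hA := hF.nonneg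
  have hτ : (0 : ℝ) ∈ Icc 0 τ := ⟨le_rfl, ht.1.trans ht.2⟩
  have hM0 : 0 ≤ M := (norm_nonneg _).trans (hM 0 hτ)
  have hR0 : 0 ≤ R := by linarith [hR 0 hτ, norm_nonneg (Y 0)]
  have hcint : ∀ s ∈ Icc 0 τ, IntervalIntegrable (fun r => ‖c r - c' r‖) volume 0 s := by
    intro s hs
    rw [intervalIntegrable_iff]
    refine IntegrableOn.mono_set (t := Icc 0 τ) ?_ (uIoc_subset_uIcc.trans (uIcc_subset_Icc hτ hs))
    refine Integrable.of_bound (C := M + M') (hcm.sub hcm').norm.restrict ?_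
    refine (ae_restrict_iff' measurableSet_Icc).2 (ae_of_all _ fun r hr' => ?_)
    rw [norm_norm]
    exact (_root_.norm_sub_le _ _).trans (add_le_add (hM r hr') (hM' r hr'))
  have hcont : ContinuousOn (fun s => ‖X s - Y s‖) (Icc 0 t) :=
    (hX.continuousOn.sub hY.continuousOn).norm.mono (Icc_subset_Icc_right ht.2)
  refine le_mul_exp_of_le_integral (τ := t) (by positivity) hcont (fun s hs => ?_) t ⟨ht.1, le_rfl⟩
  have hs' : s ∈ Icc 0 τ := ⟨hs.1, hs.2.trans ht.2⟩
  have hi : IntervalIntegrable (fun s => ‖X s - Y s‖) volume 0 s := by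
    refine ContinuousOn.intervalIntegrable ?_
    rw [uIcc_of_le hs.1]
    exact hcont.mono (Icc_subset_Icc_right hs.2)
  have key : ‖(∫ r in (0 : ℝ)..s, F (c r) (X r)) - ∫ r in (0 : ℝ)..s, F (c' r) (Y r)‖ ≤
      ∫ r in (0 : ℝ)..s, (A * R * ‖c r - c' r‖ + A * M * R * ‖X r - Y r‖) := by
    rw [← intervalIntegral.integral_sub
      (hF.intervalIntegrable hcm hM hX.continuousOn hτ hs')
      (hF.intervalIntegrable hcm' hM' hY.continuousOn hτ hs')]
    refine intervalIntegral.norm_integral_le_of_norm_le hs.1 (ae_of_all _ fun r hr => ?_)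
      (((hcint s hs').const_mul _).add (hi.const_mul _))
    have hr' : r ∈ Icc 0 τ := ⟨hr.1.le, hr.2.trans hs'.2⟩
    refine (hF.lip _ _ _ _).trans ?_
    have h1 := hR r hr'
    have h2 := hM r hr'
    calc _ ≤ A * ‖c r - c' r‖ * R + A * M * R * ‖X r - Y r‖ := by gcongr
      _ = _ := by ring
  have hmono : ∫ r in (0 : ℝ)..s, ‖c r - c' r‖ ≤ ∫ r in (0 : ℝ)..t, ‖c r - c' r‖ :=
    intervalIntegral.integral_mono_interval le_rfl hs.1 hs.2
      (ae_of_all _ fun _ => norm_nonneg _) (hcint t ht)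
  rw [intervalIntegral.integral_add ((hcint s hs').const_mul _) (hi.const_mul _),
    intervalIntegral.integral_const_mul, intervalIntegral.integral_const_mul] at key
  rw [hX.eq s hs', hY.eq s hs', add_sub_add_comm]
  refine (norm_add_le _ _).trans ?_
  have : A * R * ∫ r in (0 : ℝ)..s, ‖c r - c' r‖ ≤ A * R * ∫ r in (0 : ℝ)..t, ‖c r - c' r‖ := by
    gcongr
  linarith

/-- A path is Lipschitz in time. -/
theorem IsPath.norm_sub_le_time {F : V → E → E} {A : ℝ} (hF : IsControlledField F A)
    {c : ℝ → V} (hcm : AEStronglyMeasurable c)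
    {M R τ : ℝ} (hM : ∀ s ∈ Icc 0 τ, ‖c s‖ ≤ M)
    {x : E} {X : ℝ → E} (hX : IsPath F c x τ X)
    (hR : ∀ s ∈ Icc 0 τ, 1 + ‖X s‖ ≤ R) {s t : ℝ} (hs : s ∈ Icc 0 τ) (ht : t ∈ Icc 0 τ) :
    ‖X t - X s‖ ≤ A * M * R * |t - s| := by
  have hτ : (0 : ℝ) ∈ Icc 0 τ := ⟨le_rfl, ht.1.trans ht.2⟩
  have hM0 : 0 ≤ M := (norm_nonneg _).trans (hM 0 hτ)
  rw [hX.eq s hs, hX.eq t ht, add_sub_add_left_eq_sub,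
    intervalIntegral.integral_interval_sub_left
      (hF.intervalIntegrable hcm hM hX.continuousOn hτ ht)
      (hF.intervalIntegrable hcm hM hX.continuousOn hτ hs)]
  refine intervalIntegral.norm_integral_le_of_norm_le_const fun r hr => ?_
  have hr' : r ∈ Icc 0 τ := uIcc_subset_Icc hs ht (uIoc_subset_uIcc hr)
  refine (hF.growth _ _).trans ?_
  have := hF.nonneg
  have h1 := hR r hr'
  have h2 := hM r hr'
  gcongr

/-- A fixed point theorem for causal maps on path space. The hypothesis says that `Γ` contracts by
the factor `1 / 2` for the weighted distance `sup_t exp (-λ t) dist (u t) (v t)`. -/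
theorem exists_fixedPoint_of_weighted_contraction {b : ℝ} {Z : Type*} [MetricSpace Z]
    [CompleteSpace Z] (s : Set C(Icc (0 : ℝ) b, Z)) (hs : IsClosed s) (hne : s.Nonempty)
    (Γ : C(Icc (0 : ℝ) b, Z) → C(Icc (0 : ℝ) b, Z)) (hΓ : MapsTo Γ s s) {l : ℝ} (hl : 0 ≤ l)
    (hc : ∀ u ∈ s, ∀ v ∈ s, ∀ D, 0 ≤ D → (∀ t, dist (u t) (v t) ≤ D * Real.exp (l * t)) →
      ∀ t, dist (Γ u t) (Γ v t) ≤ D / 2 * Real.exp (l * t)) :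
    ∃ u ∈ s, Γ u = u := by
  obtain ⟨u₀, hu₀⟩ := hne
  have hmem : ∀ n, Γ^[n] u₀ ∈ s := fun n => hΓ.iterate n hu₀
  have hD : ∀ n t, dist (Γ^[n] u₀ t) (Γ^[n + 1] u₀ t)
      ≤ dist u₀ (Γ u₀) / 2 ^ n * Real.exp (l * t) := by
    intro n
    induction n with
    | zero =>
      intro t
      have h1 : (1 : ℝ) ≤ Real.exp (l * t) := Real.one_le_exp (mul_nonneg hl t.2.1)
      simpa using (ContinuousMap.dist_apply_le_dist t).trans
        (le_mul_of_one_le_right dist_nonneg h1)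
    | succ n ih =>
      intro t
      rw [Function.iterate_succ_apply', Function.iterate_succ_apply' Γ (n + 1)]
      refine (hc _ (hmem n) _ (hmem (n + 1)) _ (by positivity) ih t).trans_eq ?_
      rw [pow_succ, div_div]
  have hcau : CauchySeq fun n => Γ^[n] u₀ := by
    refine cauchySeq_of_le_geometric (1 / 2) (dist u₀ (Γ u₀) * Real.exp (l * b)) (by norm_num)
      fun n => ?_
    rw [ContinuousMap.dist_le (by positivity)]
    intro t
    refine (hD n t).trans ?_
    have : Real.exp (l * t) ≤ Real.exp (l * b) :=
      Real.exp_le_exp.2 (mul_le_mul_of_nonneg_left t.2.2 hl)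
    calc _ ≤ dist u₀ (Γ u₀) / 2 ^ n * Real.exp (l * b) := by gcongr
      _ = _ := by rw [div_pow, one_pow]; ring
  obtain ⟨u, hu⟩ := cauchySeq_tendsto_of_complete hcau
  have hus : u ∈ s := hs.mem_of_tendsto hu (Eventually.of_forall hmem)
  refine ⟨u, hus, ?_⟩
  have hu' : Tendsto (fun n => Γ (Γ^[n] u₀)) atTop (𝓝 u) := by
    simpa only [← Function.iterate_succ_apply' Γ] using (tendsto_add_atTop_iff_nat 1).2 hu
  refine tendsto_nhds_unique ?_ hu'
  rw [tendsto_iff_dist_tendsto_zero] at hu ⊢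
  have h0 : Tendsto (fun n => dist (Γ^[n] u₀) u / 2 * Real.exp (l * b)) atTop (𝓝 0) := by
    simpa using (hu.div_const 2).mul_const (Real.exp (l * b))
  refine squeeze_zero (fun _ => dist_nonneg) (fun n => ?_) h0
  rw [ContinuousMap.dist_le (by positivity)]
  intro t
  have h1 : (1 : ℝ) ≤ Real.exp (l * t) := Real.one_le_exp (mul_nonneg hl t.2.1)
  have h2 : Real.exp (l * t) ≤ Real.exp (l * b) :=
    Real.exp_le_exp.2 (mul_le_mul_of_nonneg_left t.2.2 hl)
  refine (hc _ (hmem n) _ hus _ dist_nonneg (fun r => ?_) t).trans (by gcongr)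
  have h1 : (1 : ℝ) ≤ Real.exp (l * r) := Real.one_le_exp (mul_nonneg hl r.2.1)
  exact (ContinuousMap.dist_apply_le_dist r).trans (le_mul_of_one_le_right dist_nonneg h1)

/-- The integral that appears in the contraction estimates. -/
theorem integral_exp_le {k t : ℝ} (hk : 0 < k) :
    ∫ s in (0 : ℝ)..t, Real.exp (k * s) ≤ Real.exp (k * t) / k := by
  rw [intervalIntegral.integral_comp_mul_left _ hk.ne']
  simp only [mul_zero, integral_exp, Real.exp_zero, smul_eq_mul]
  rw [div_eq_inv_mul]
  have := inv_pos.2 hk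
  nlinarith

variable {V E W : Type*} [NormedAddCommGroup V] [NormedAddCommGroup E]
  [NormedSpace ℝ E] [NormedAddCommGroup W]

/-! ### Exponential bounds -/

/-- The functions `exp (a (1 + ‖x‖))` of the initial value `x` dominate every quantity attached to a
path that starts in `x`, and they are closed under products. -/
noncomputable def expBound (a : ℝ) (x : E) : ℝ := Real.exp (a * (1 + ‖x‖))

theorem expBound_pos (a : ℝ) (x : E) : 0 < expBound a x := Real.exp_pos _

theorem expBound_mul (a a' : ℝ) (x : E) : expBound a x * expBound a' x = expBound (a + a') x := by
  rw [expBound, expBound, expBound, ← Real.exp_add, add_mul]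

theorem expBound_pow (a : ℝ) (n : ℕ) (x : E) : expBound a x ^ n = expBound (n * a) x := by
  rw [expBound, expBound, ← Real.exp_nat_mul, mul_assoc]

theorem expBound_mono {a a' : ℝ} (h : a ≤ a') (x : E) : expBound a x ≤ expBound a' x :=
  Real.exp_le_exp.2 (mul_le_mul_of_nonneg_right h (by positivity))

theorem one_le_expBound {a : ℝ} (h : 0 ≤ a) (x : E) : 1 ≤ expBound a x :=
  Real.one_le_exp (by positivity)

theorem le_expBound {a : ℝ} (h : 0 ≤ a) (x : E) : a ≤ expBound a x := by
  have h1 := Real.add_one_le_exp (a * (1 + ‖x‖))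
  have h2 := mul_nonneg h (norm_nonneg x)
  rw [expBound]
  nlinarith

theorem continuous_expBound (a : ℝ) : Continuous (expBound a : E → ℝ) := by
  unfold expBound; fun_prop

/-- All exponential moments of the norm are finite. -/
def HasExpMoments [MeasurableSpace E] (ν : Measure E) : Prop :=
  ∀ a : ℝ, Integrable (expBound a) ν

/-- An exponent such that `expBound` with this exponent controls the paths whose control is bounded
by `M` on an interval of length at most `b`. -/
noncomputable def pathRate (A M b : ℝ) : ℝ :=
  (1 + A + A * M + A * M * b) * Real.exp (A * M * b)

theorem pathRate_nonneg {A M b : ℝ} (hA : 0 ≤ A) (hM : 0 ≤ M) (hb : 0 ≤ b) :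
    0 ≤ pathRate A M b := by
  unfold pathRate; positivity

theorem IsPath.one_add_norm_le_expBound {F : V → E → E} {A : ℝ} (hF : IsControlledField F A)
    {c : ℝ → V} {M τ b : ℝ} (hM : ∀ s ∈ Icc 0 τ, ‖c s‖ ≤ M) (hb : τ ≤ b) {x : E} {X : ℝ → E}
    (h : IsPath F c x τ X) {t : ℝ} (ht : t ∈ Icc 0 τ) :
    1 + ‖X t‖ ≤ expBound (pathRate A M b) x := by
  have hτ : (0 : ℝ) ∈ Icc 0 τ := ⟨le_rfl, ht.1.trans ht.2⟩
  have hM0 : 0 ≤ M := (norm_nonneg _).trans (hM 0 hτ)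
  have hb0 : 0 ≤ b := hτ.2.trans hb
  have hA := hF.nonneg
  refine (h.one_add_norm_le' hF hM ht (ht.2.trans hb)).trans ?_
  have h1 := Real.add_one_le_exp (Real.exp (A * M * b) * (1 + ‖x‖))
  refine le_trans (by linarith) (h1.trans (Real.exp_le_exp.2 ?_))
  refine mul_le_mul_of_nonneg_right ?_ (by positivity)
  refine le_mul_of_one_le_left (Real.exp_pos _).le ?_
  have : 0 ≤ A + A * M + A * M * b := by positivity
  linarith

theorem IsPath.norm_sub_le_expBound {F : V → E → E} {A : ℝ} (hF : IsControlledField F A)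
    {c c' : ℝ → V} (hcm : AEStronglyMeasurable c) (hcm' : AEStronglyMeasurable c')
    {M τ b : ℝ} (hM : ∀ s ∈ Icc 0 τ, ‖c s‖ ≤ M) (hM' : ∀ s ∈ Icc 0 τ, ‖c' s‖ ≤ M) (hb : τ ≤ b)
    {x : E} {X Y : ℝ → E} (hX : IsPath F c x τ X) (hY : IsPath F c' x τ Y)
    {t : ℝ} (ht : t ∈ Icc 0 τ) :
    ‖X t - Y t‖ ≤ expBound (pathRate A M b) x * ∫ s in (0 : ℝ)..t, ‖c s - c' s‖ := by
  have hτ : (0 : ℝ) ∈ Icc 0 τ := ⟨le_rfl, ht.1.trans ht.2⟩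
  have hM0 : 0 ≤ M := (norm_nonneg _).trans (hM 0 hτ)
  have hb0 : 0 ≤ b := hτ.2.trans hb
  have hA := hF.nonneg
  have hR : ∀ s ∈ Icc 0 τ, 1 + ‖Y s‖ ≤ (1 + ‖x‖) * Real.exp (A * M * b) :=
    fun s hs => hY.one_add_norm_le' hF hM' hs (hs.2.trans hb)
  refine (hX.norm_sub_le hF hcm hcm' hM hM' hY hR ht).trans ?_
  rw [sub_self, norm_zero, zero_add, mul_right_comm]
  have hI : 0 ≤ ∫ s in (0 : ℝ)..t, ‖c s - c' s‖ :=
    intervalIntegral.integral_nonneg ht.1 fun _ _ => norm_nonneg _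
  refine mul_le_mul_of_nonneg_right ?_ hI
  set R := (1 + ‖x‖) * Real.exp (A * M * b) with hRdef
  have hR0 : 0 ≤ R := by positivity
  have h1 : A * R ≤ Real.exp (A * R) := by linarith [Real.add_one_le_exp (A * R)]
  refine (mul_le_mul_of_nonneg_right h1 (Real.exp_pos _).le).trans ?_
  rw [← Real.exp_add]
  refine Real.exp_le_exp.2 ?_
  have h2 : A * M * R * t ≤ A * M * R * b := by
    have := ht.2.trans hb
    gcongr
  have h3 : 0 ≤ (1 + A * M) * R := by positivity
  have : pathRate A M b * (1 + ‖x‖) = (1 + A + A * M + A * M * b) * R := by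
    rw [pathRate, hRdef]; ring
  rw [this]
  nlinarith

theorem IsPath.norm_sub_time_le_expBound {F : V → E → E} {A : ℝ} (hF : IsControlledField F A)
    {c : ℝ → V} (hcm : AEStronglyMeasurable c) {M b : ℝ} (hM : ∀ s ∈ Icc 0 b, ‖c s‖ ≤ M)
    {x : E} {X : ℝ → E} (hX : IsPath F c x b X) {s t : ℝ} (hs : s ∈ Icc 0 b) (ht : t ∈ Icc 0 b) :
    ‖X t - X s‖ ≤ expBound (pathRate A M b) x * |t - s| := by
  have hb0 : 0 ≤ b := hs.1.trans hs.2
  have hM0 : 0 ≤ M := (norm_nonneg _).trans (hM s hs)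
  have hA := hF.nonneg
  have hR : ∀ s ∈ Icc 0 b, 1 + ‖X s‖ ≤ (1 + ‖x‖) * Real.exp (A * M * b) :=
    fun s hs => hX.one_add_norm_le' hF hM hs hs.2
  refine (hX.norm_sub_le_time hF hcm hM hR hs ht).trans ?_
  refine mul_le_mul_of_nonneg_right ?_ (abs_nonneg _)
  set R := (1 + ‖x‖) * Real.exp (A * M * b) with hRdef
  have hR0 : 0 ≤ R := by positivity
  have h1 : A * M * R ≤ Real.exp (A * M * R) := by linarith [Real.add_one_le_exp (A * M * R)]
  refine h1.trans (Real.exp_le_exp.2 ?_)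
  have : pathRate A M b * (1 + ‖x‖) = (1 + A + A * M + A * M * b) * R := by
    rw [pathRate, hRdef]; ring
  rw [this]
  have h3 : 0 ≤ (1 + A + A * M * b) * R := by positivity
  nlinarith

/-! ### The flow of a controlled field -/

/-- Global existence of paths, by Picard iteration in a weighted norm. The Lipschitz
constant of the field in the state grows with the norm of the state, so the iteration takes place
among the paths that satisfy the a priori growth bound. The solution is constant outside of
`[0, b]`. -/
theorem IsControlledField.exists_isPath [CompleteSpace E] {F : V → E → E} {A : ℝ}
    (hF : IsControlledField F A)
    {c : ℝ → V} (hcm : AEStronglyMeasurable c) {M b : ℝ} (hM : ∀ s ∈ Icc 0 b, ‖c s‖ ≤ M)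
    (hb : 0 ≤ b) (x : E) :
    ∃ X : ℝ → E, IsPath F c x b X ∧ ∀ t, X t = X (projIcc 0 b hb t) := by
  have hA := hF.nonneg
  have hM0 : 0 ≤ M := (norm_nonneg _).trans (hM 0 ⟨le_rfl, hb⟩)
  have hAM : 0 ≤ A * M := mul_nonneg hA hM0
  have h0 : (0 : ℝ) ∈ Icc 0 b := ⟨le_rfl, hb⟩
  have hcont : ∀ u : C(Icc (0 : ℝ) b, E), Continuous (IccExtend hb u) :=
    fun u => u.continuous.Icc_extend'
  have hint : ∀ (u : C(Icc (0 : ℝ) b, E)), ∀ t ∈ Icc (0 : ℝ) b,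
      IntervalIntegrable (fun r => F (c r) (IccExtend hb u r)) volume 0 t :=
    fun u t ht => hF.intervalIntegrable hcm hM (hcont u).continuousOn h0 ht
  have hprim : ∀ u : C(Icc (0 : ℝ) b, E),
      ContinuousOn (fun t => x + ∫ r in (0 : ℝ)..t, F (c r) (IccExtend hb u r)) (Icc 0 b) := by
    intro u
    have := intervalIntegral.continuousOn_primitive_interval
      ((intervalIntegrable_iff_integrableOn_Icc_of_le hb).1 (hint u b ⟨hb, le_rfl⟩) |>.mono_set
        (uIcc_of_le hb).le)
    rw [uIcc_of_le hb] at this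
    exact this.const_add x
  let Γ : C(Icc (0 : ℝ) b, E) → C(Icc (0 : ℝ) b, E) := fun u =>
    ⟨fun t => x + ∫ r in (0 : ℝ)..t, F (c r) (IccExtend hb u r),
      continuousOn_iff_continuous_domRestrict.1 (hprim u)⟩
  -- the set of paths that Picard iterates do not leave
  let s : Set C(Icc (0 : ℝ) b, E) :=
    {u | ∀ t, 1 + ‖u t‖ ≤ (1 + ‖x‖) * Real.exp (A * M * t)}
  have hs : IsClosed s := by
    have : s = ⋂ t : Icc (0 : ℝ) b, {u : C(Icc (0 : ℝ) b, E) |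
        1 + ‖u t‖ ≤ (1 + ‖x‖) * Real.exp (A * M * t)} := by
      ext u; simp [s]
    rw [this]
    refine isClosed_iInter fun t => isClosed_le ?_ continuous_const
    exact continuous_const.add (continuous_eval_const t).norm
  have hne : s.Nonempty := by
    refine ⟨ContinuousMap.const _ x, fun t => ?_⟩
    exact le_mul_of_one_le_right (by positivity) (Real.one_le_exp (mul_nonneg hAM t.2.1))
  have hext : ∀ (u : C(Icc (0 : ℝ) b, E)) (r : ℝ) (hr : r ∈ Icc (0 : ℝ) b),
      IccExtend hb u r = u ⟨r, hr⟩ := fun u r hr => IccExtend_of_mem hb _ hr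
  have hΓs : MapsTo Γ s s := by
    intro u hu t
    have h1 : ‖∫ r in (0 : ℝ)..t, F (c r) (IccExtend hb u r)‖ ≤
        ∫ r in (0 : ℝ)..t, (1 + ‖x‖) * (Real.exp (A * M * r) * (A * M)) := by
      refine intervalIntegral.norm_integral_le_of_norm_le t.2.1 (ae_of_all _ fun r hr => ?_)
        (Continuous.intervalIntegrable (by fun_prop) _ _)
      have hr' : r ∈ Icc 0 b := ⟨hr.1.le, hr.2.trans t.2.2⟩
      refine (hF.growth _ _).trans ?_
      rw [hext u r hr']
      have h2 := hu ⟨r, hr'⟩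
      have h3 := hM r hr'
      calc _ ≤ A * M * ((1 + ‖x‖) * Real.exp (A * M * r)) := by gcongr
        _ = _ := by ring
    rw [intervalIntegral.integral_const_mul,
      intervalIntegral.integral_eq_sub_of_hasDerivAt (f := fun r => Real.exp (A * M * r))
      (fun r _ => by simpa using ((hasDerivAt_id r).const_mul (A * M)).exp)
      (Continuous.intervalIntegrable (by fun_prop) _ _), mul_zero, Real.exp_zero] at h1
    have h2 : ‖Γ u t‖ ≤ ‖x‖ + ‖∫ r in (0 : ℝ)..t, F (c r) (IccExtend hb u r)‖ := norm_add_le _ _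
    nlinarith
  -- a Lipschitz constant of `F (c r)`; the weight `exp (2 K t)` turns it into the factor `1 / 2`
  let K : ℝ := A * M * ((1 + ‖x‖) * Real.exp (A * M * b)) + 1
  have hK : 0 < K := by positivity
  have hcontr : ∀ u ∈ s, ∀ v ∈ s, ∀ D, 0 ≤ D →
      (∀ t, dist (u t) (v t) ≤ D * Real.exp (2 * K * t)) →
      ∀ t, dist (Γ u t) (Γ v t) ≤ D / 2 * Real.exp (2 * K * t) := by
    intro u hu v hv D hD huv t
    have hi := hint u t t.2
    have hi' := hint v t t.2
    rw [dist_eq_norm]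
    have h1 : Γ u t - Γ v t = ∫ r in (0 : ℝ)..t,
        (F (c r) (IccExtend hb u r) - F (c r) (IccExtend hb v r)) := by
      rw [intervalIntegral.integral_sub hi hi']
      exact add_sub_add_left_eq_sub _ _ _
    rw [h1]
    have h2 : ‖∫ r in (0 : ℝ)..t, (F (c r) (IccExtend hb u r) - F (c r) (IccExtend hb v r))‖ ≤
        ∫ r in (0 : ℝ)..t, K * D * Real.exp (2 * K * r) := by
      refine intervalIntegral.norm_integral_le_of_norm_le t.2.1 (ae_of_all _ fun r hr => ?_)
        (Continuous.intervalIntegrable (by fun_prop) _ _)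
      have hr' : r ∈ Icc 0 b := ⟨hr.1.le, hr.2.trans t.2.2⟩
      refine (hF.lip _ _ _ _).trans ?_
      rw [hext u r hr', hext v r hr', sub_self, norm_zero, mul_zero, zero_mul, zero_add]
      have h3 : 1 + ‖v ⟨r, hr'⟩‖ ≤ (1 + ‖x‖) * Real.exp (A * M * b) := by
        refine (hv ⟨r, hr'⟩).trans ?_
        have := hr'.2
        gcongr
      have h4 := hM r hr'
      have h5 := huv ⟨r, hr'⟩
      rw [dist_eq_norm] at h5
      calc _ ≤ A * M * ((1 + ‖x‖) * Real.exp (A * M * b)) * (D * Real.exp (2 * K * r)) := by gcongr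
        _ ≤ K * (D * Real.exp (2 * K * r)) := by
          refine mul_le_mul_of_nonneg_right ?_ (by positivity)
          simp [K]
        _ = _ := by ring
    refine h2.trans ?_
    rw [intervalIntegral.integral_const_mul]
    refine (mul_le_mul_of_nonneg_left (integral_exp_le (by positivity : 0 < 2 * K))
      (by positivity)).trans_eq ?_
    field_simp
  obtain ⟨u, -, hu⟩ := exists_fixedPoint_of_weighted_contraction s hs hne Γ hΓs
    (l := 2 * K) (by positivity) hcontr
  refine ⟨IccExtend hb u, ⟨(hcont u).continuousOn, fun t ht => ?_⟩, fun t => ?_⟩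
  · have := congrArg (fun w : C(Icc (0 : ℝ) b, E) => w ⟨t, ht⟩) hu
    rw [hext u t ht]
    exact this.symm
  · rw [hext u _ (projIcc 0 b hb t).2]
    rfl

/-- The solutions of a controlled equation, for all initial values simultaneously, form a jointly
continuous flow. -/
theorem IsControlledField.exists_flow [CompleteSpace E] {F : V → E → E} {A : ℝ}
    (hF : IsControlledField F A)
    {c : ℝ → V} (hcm : AEStronglyMeasurable c) {M b : ℝ} (hM : ∀ s ∈ Icc 0 b, ‖c s‖ ≤ M)
    (hb : 0 ≤ b) :
    ∃ X : E → ℝ → E, Continuous (Function.uncurry X) ∧ ∀ x, IsPath F c x b (X x) := by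
  have hM0 : 0 ≤ M := (norm_nonneg _).trans (hM 0 ⟨le_rfl, hb⟩)
  have hA := hF.nonneg
  choose X hX hproj using fun x => hF.exists_isPath hcm hM hb x
  refine ⟨X, ?_, hX⟩
  refine continuous_iff_continuousAt.2 fun p => ?_
  refine tendsto_iff_norm_sub_tendsto_zero.2 ?_
  obtain ⟨y, s⟩ := p
  have hXy : Continuous (X y) := by
    have : X y = fun t => (Icc 0 b).domRestrict (X y) (projIcc 0 b hb t) :=
      funext fun t => hproj y t
    rw [this]
    exact (continuousOn_iff_continuous_domRestrict.1 (hX y).continuousOn).comp continuous_projIcc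
  set R := (1 + ‖y‖) * Real.exp (A * M * b)
  have hR : ∀ s ∈ Icc 0 b, 1 + ‖X y s‖ ≤ R :=
    fun s hs => (hX y).one_add_norm_le' hF hM hs hs.2
  refine squeeze_zero (g := fun q : E × ℝ => ‖q.1 - y‖ * Real.exp (A * M * R * b)
    + ‖X y q.2 - X y s‖) (fun _ => norm_nonneg _) (fun q => ?_) ?_
  · have h1 := (hX q.1).norm_sub_le hF hcm hcm hM hM (hX y) hR (projIcc 0 b hb q.2).2
    rw [← hproj, ← hproj] at h1
    simp only [sub_self, norm_zero, intervalIntegral.integral_zero, mul_zero, add_zero] at h1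
    have h2 : Real.exp (A * M * R * (projIcc 0 b hb q.2 : ℝ)) ≤ Real.exp (A * M * R * b) := by
      have := (projIcc 0 b hb q.2).2.2
      gcongr
    calc ‖X q.1 q.2 - X y s‖ ≤ ‖X q.1 q.2 - X y q.2‖ + ‖X y q.2 - X y s‖ :=
          norm_sub_le_norm_sub_add_norm_sub _ _ _
      _ ≤ _ := by
        gcongr
        exact h1.trans (by gcongr)
  · have : Continuous fun q : E × ℝ => ‖q.1 - y‖ * Real.exp (A * M * R * b)
        + ‖X y q.2 - X y s‖ := by fun_prop
    simpa using this.tendsto (y, s)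

/-- Uniqueness of paths. -/
theorem IsPath.eqOn {F : V → E → E} {A : ℝ} (hF : IsControlledField F A)
    {c : ℝ → V} (hcm : AEStronglyMeasurable c) {M b : ℝ} (hM : ∀ s ∈ Icc 0 b, ‖c s‖ ≤ M)
    {x : E} {X Y : ℝ → E} (hX : IsPath F c x b X) (hY : IsPath F c x b Y) :
    ∀ t ∈ Icc 0 b, X t = Y t := by
  intro t ht
  have := hX.norm_sub_le_expBound hF hcm hcm hM hM le_rfl hY ht
  simp only [sub_self, norm_zero, intervalIntegral.integral_zero, mul_zero] at this
  exact sub_eq_zero.1 (norm_le_zero_iff.1 this)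

theorem IsPath.apply_zero {F : V → E → E} {c : ℝ → V} {b : ℝ} (hb : 0 ≤ b)
    {x : E} {X : ℝ → E} (hX : IsPath F c x b X) : X 0 = x := by
  simpa using hX.eq 0 ⟨le_rfl, hb⟩

/-! ### Observables and their moments along the flow -/

/-- A function of the state that is locally Lipschitz with at most quadratic growth of the
Lipschitz constant. -/
structure IsObservable (ψ : E → W) (B : ℝ) : Prop where
  nonneg : 0 ≤ B
  lip : ∀ X Y, ‖ψ X - ψ Y‖ ≤ B * (1 + ‖X‖ + ‖Y‖) ^ 2 * ‖X - Y‖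

theorem IsObservable.continuous {ψ : E → W} {B : ℝ} (hψ : IsObservable ψ B) : Continuous ψ := by
  refine continuous_iff_continuousAt.2 fun Y => tendsto_iff_norm_sub_tendsto_zero.2 ?_
  refine squeeze_zero (fun _ => norm_nonneg _) (fun X => hψ.lip X Y) ?_
  have : Continuous fun X : E => B * (1 + ‖X‖ + ‖Y‖) ^ 2 * ‖X - Y‖ := by fun_prop
  simpa using this.tendsto Y

theorem IsObservable.norm_sub_le {ψ : E → W} {B : ℝ} (hψ : IsObservable ψ B) {a : ℝ}
    {x X Y : E} (hX : 1 + ‖X‖ ≤ expBound a x) (hY : 1 + ‖Y‖ ≤ expBound a x) {D : ℝ}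
    (h : ‖X - Y‖ ≤ expBound a x * D) :
    ‖ψ X - ψ Y‖ ≤ expBound (‖ψ 0‖ + 4 * B + 3 * a) x * D := by
  have hB := hψ.nonneg
  have hR := expBound_pos a x
  have hD : 0 ≤ D := nonneg_of_mul_nonneg_right ((norm_nonneg _).trans h) hR
  have h1 : 4 * B ≤ expBound (‖ψ 0‖ + 4 * B) x :=
    (le_expBound (by positivity) x).trans (expBound_mono (by linarith [norm_nonneg (ψ 0)]) x)
  calc ‖ψ X - ψ Y‖ ≤ B * (1 + ‖X‖ + ‖Y‖) ^ 2 * ‖X - Y‖ := hψ.lip X Y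
    _ ≤ B * (2 * expBound a x) ^ 2 * (expBound a x * D) := by
      gcongr
      linarith [norm_nonneg X, norm_nonneg Y]
    _ = 4 * B * (expBound a x ^ 3 * D) := by ring
    _ ≤ expBound (‖ψ 0‖ + 4 * B) x * (expBound a x ^ 3 * D) := by gcongr
    _ = _ := by
      rw [expBound_pow, ← mul_assoc, expBound_mul]; norm_num

theorem IsObservable.norm_le {ψ : E → W} {B : ℝ} (hψ : IsObservable ψ B) {a : ℝ} (ha : 0 ≤ a)
    {x X : E} (hX : 1 + ‖X‖ ≤ expBound a x) :
    ‖ψ X‖ ≤ expBound (‖ψ 0‖ + 4 * B + 3 * a) x := by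
  have hB := hψ.nonneg
  have h1 := hψ.lip X 0
  have h2 := one_le_expBound ha x
  have h3 : ‖ψ X‖ ≤ ‖ψ X - ψ 0‖ + ‖ψ 0‖ := by simpa using norm_add_le (ψ X - ψ 0) (ψ 0)
  rw [norm_zero, add_zero, sub_zero] at h1
  have h4 : B * (1 + ‖X‖) ^ 2 * ‖X‖ ≤ B * expBound a x ^ 2 * expBound a x := by
    gcongr; linarith
  have h5 : ‖ψ 0‖ ≤ ‖ψ 0‖ * expBound a x ^ 3 :=
    le_mul_of_one_le_right (norm_nonneg _) (one_le_pow₀ h2)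
  calc ‖ψ X‖ ≤ (‖ψ 0‖ + 4 * B) * expBound a x ^ 3 := by
        nlinarith [mul_nonneg hB (pow_nonneg (expBound_pos a x).le 3)]
    _ ≤ expBound (‖ψ 0‖ + 4 * B) x * expBound a x ^ 3 := by
      have := expBound_pos a x
      gcongr
      exact le_expBound (by positivity) x
    _ = _ := by rw [expBound_pow, expBound_mul]; norm_num

variable [MeasurableSpace E] [BorelSpace E] [SecondCountableTopology E]

theorem IsObservable.integrable {ψ : E → W} {B : ℝ} (hψ : IsObservable ψ B) {a : ℝ}
    (ha : 0 ≤ a) {ν : Measure E} (hν : HasExpMoments ν) {X : E → E} (hXc : Continuous X)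
    (hX : ∀ x, 1 + ‖X x‖ ≤ expBound a x) : Integrable (fun x => ψ (X x)) ν :=
  (hν _).mono' (hψ.continuous.comp hXc).aestronglyMeasurable
    (ae_of_all _ fun x => hψ.norm_le ha (hX x))

/-- Moments evolve by the time derivative `D` of the observable along paths. -/
theorem integral_comp_flow_eq [CompleteSpace E] {F : V → E → E} {A : ℝ} (hF : IsControlledField F A)
    {c : ℝ → V} (hcm : AEStronglyMeasurable c) {M b : ℝ} (hM : ∀ s ∈ Icc 0 b, ‖c s‖ ≤ M)
    {N : Set ℝ} (hN : N.Countable) (hcN : ∀ s ∉ N, ContinuousAt c s)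
    {X : E → ℝ → E} (hXc : Continuous (Function.uncurry X)) (hX : ∀ x, IsPath F c x b (X x))
    {ν : Measure E} [IsProbabilityMeasure ν] (hν : HasExpMoments ν)
    {ψ : E → ℝ} {B : ℝ} (hψ : IsObservable ψ B) {D : V → E → ℝ} {C : ℝ}
    (hDc : Continuous fun p : V × E => D p.1 p.2)
    (hDb : ∀ c X, |D c X| ≤ C * ‖c‖ * (1 + ‖X‖) ^ 4)
    (hD : ∀ (Y : ℝ → E) (t : ℝ) (c : V), HasDerivAt Y (F c (Y t)) t →
      HasDerivAt (fun s => ψ (Y s)) (D c (Y t)) t) {t : ℝ} (ht : t ∈ Icc 0 b) :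
    ∫ x, ψ (X x t) ∂ν = ∫ x, ψ x ∂ν + ∫ s in (0 : ℝ)..t, ∫ x, D (c s) (X x s) ∂ν := by
  have hb : 0 ≤ b := ht.1.trans ht.2
  have h0 : (0 : ℝ) ∈ Icc 0 b := ⟨le_rfl, hb⟩
  have hA := hF.nonneg
  have hM0 : 0 ≤ M := (norm_nonneg _).trans (hM 0 h0)
  have ha := pathRate_nonneg hA hM0 hb
  have hXx : ∀ x, Continuous (X x) := fun x => hXc.comp (by fun_prop : Continuous fun t => (x, t))
  have hXt : ∀ t, Continuous fun x => X x t :=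
    fun t => hXc.comp (by fun_prop : Continuous fun x => (x, t))
  have hXb : ∀ s ∈ Icc 0 b, ∀ x, 1 + ‖X x s‖ ≤ expBound (pathRate A M b) x :=
    fun s hs x => (hX x).one_add_norm_le_expBound hF hM le_rfl hs
  set G : E → ℝ → ℝ := fun x s => D (c s) (X x s)
  have hbound : ∀ x, ∀ s ∈ Ioc 0 t,
      ‖G x s‖ ≤ |C| * M * expBound (4 * pathRate A M b) x := by
    intro x s hs
    have hs' : s ∈ Icc 0 b := ⟨hs.1.le, hs.2.trans ht.2⟩
    refine (hDb _ _).trans ?_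
    have h1 := hM s hs'
    have h2 := hXb s hs' x
    have h3 : expBound (4 * pathRate A M b) x = expBound (pathRate A M b) x ^ 4 := by
      rw [expBound_pow]; norm_num
    rw [h3]
    have := le_abs_self C
    gcongr
  have hmeas : AEStronglyMeasurable (Function.uncurry G)
      (ν.prod (volume.restrict (Ioc 0 t))) :=
    hDc.comp_aestronglyMeasurable
      ((hcm.restrict (s := Ioc 0 t)).comp_snd.prodMk hXc.aestronglyMeasurable)
  have hintG : Integrable (Function.uncurry G) (ν.prod (volume.restrict (Ioc 0 t))) := by
    have hi : Integrable (fun p : E × ℝ => |C| * M * expBound (4 * pathRate A M b) p.1 * 1)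
        (ν.prod (volume.restrict (Ioc 0 t))) :=
      ((hν _).const_mul _).mul_prod (integrable_const 1)
    refine hi.mono' hmeas ?_
    have : ∀ᵐ p ∂(ν.prod (volume.restrict (Ioc 0 t))), p.2 ∈ Ioc 0 t :=
      Measure.quasiMeasurePreserving_snd.ae (ae_restrict_mem measurableSet_Ioc)
    filter_upwards [this] with p hp
    rw [mul_one]
    exact hbound p.1 p.2 hp
  have hpath : ∀ x, ψ (X x t) = ψ x + ∫ s in (0 : ℝ)..t, G x s := by
    intro x
    have hGi : IntervalIntegrable (G x) volume 0 t := by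
      rw [intervalIntegrable_iff, uIoc_of_le ht.1]
      refine Integrable.of_bound (C := |C| * M * expBound (4 * pathRate A M b) x)
        (hDc.comp_aestronglyMeasurable
          ((hcm.restrict (s := Ioc 0 t)).prodMk (hXx x).aestronglyMeasurable)) ?_
      exact (ae_restrict_iff' measurableSet_Ioc).2 (ae_of_all _ fun s hs => hbound x s hs)
    have := integral_eq_of_hasDerivAt_off_countable_of_le (fun s => ψ (X x s)) (G x) ht.1 hN
      (hψ.continuous.comp (hXx x)).continuousOn (fun s hs => ?_) hGi
    · rw [this, (hX x).apply_zero hb]; ring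
    · -- the path is differentiable wherever the control is continuous
      refine hD _ _ _ ?_
      have hs' : s ∈ Ioo 0 b := ⟨hs.1.1, hs.1.2.trans_le ht.2⟩
      have hcs : ContinuousAt (fun r => F (c r) (X x r)) s :=
        hF.continuous.continuousAt.comp ((hcN s hs.2).prodMk (hXx x).continuousAt)
      have hm : StronglyMeasurableAtFilter (fun r => F (c r) (X x r)) (𝓝 s) :=
        ⟨univ, univ_mem, by
          rw [Measure.restrict_univ]
          exact hF.continuous.comp_aestronglyMeasurable
            (hcm.prodMk (hXx x).aestronglyMeasurable)⟩
      have hd := intervalIntegral.integral_hasDerivAt_right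
        (hF.intervalIntegrable hcm hM (hX x).continuousOn h0 (Ioo_subset_Icc_self hs')) hm hcs
      refine (hd.const_add x).congr_of_eventuallyEq ?_
      filter_upwards [Icc_mem_nhds hs'.1 hs'.2] with r hr using (hX x).eq r hr
  have hi1 : Integrable ψ ν := hψ.integrable (a := 1) zero_le_one hν (X := fun x => x)
    continuous_id fun x => by
      rw [expBound, one_mul]; linarith [Real.add_one_le_exp (1 + ‖x‖)]
  simp_rw [hpath, intervalIntegral.integral_of_le ht.1]
  have hi2 : Integrable (fun x => ∫ s in Ioc 0 t, G x s) ν := hintG.integral_prod_left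
  rw [integral_add hi1 hi2, integral_integral_swap hintG]

/-- Moments along the flow are Lipschitz in time. -/
theorem norm_integral_comp_flow_sub_le [NormedSpace ℝ W] {F : V → E → E} {A : ℝ}
    (hF : IsControlledField F A)
    {c : ℝ → V} (hcm : AEStronglyMeasurable c) {M b : ℝ} (hM : ∀ s ∈ Icc 0 b, ‖c s‖ ≤ M)
    {X : E → ℝ → E} (hXc : Continuous (Function.uncurry X)) (hX : ∀ x, IsPath F c x b (X x))
    {ν : Measure E} (hν : HasExpMoments ν)
    {ψ : E → W} {B : ℝ} (hψ : IsObservable ψ B) :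
    ∃ K : ℝ, 0 ≤ K ∧ ∀ s ∈ Icc 0 b, ∀ t ∈ Icc 0 b,
      ‖∫ x, ψ (X x t) ∂ν - ∫ x, ψ (X x s) ∂ν‖ ≤ K * |t - s| := by
  refine ⟨∫ x, expBound (‖ψ 0‖ + 4 * B + 3 * pathRate A M b) x ∂ν,
    integral_nonneg fun x => (expBound_pos _ x).le, fun s hs t ht => ?_⟩
  have hM0 : 0 ≤ M := (norm_nonneg _).trans (hM s hs)
  have ha := pathRate_nonneg hF.nonneg hM0 (hs.1.trans hs.2)
  have hXt : ∀ t, Continuous fun x => X x t :=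
    fun t => hXc.comp (by fun_prop : Continuous fun x => (x, t))
  have hXb : ∀ s ∈ Icc 0 b, ∀ x, 1 + ‖X x s‖ ≤ expBound (pathRate A M b) x :=
    fun s hs x => (hX x).one_add_norm_le_expBound hF hM le_rfl hs
  rw [← integral_sub (hψ.integrable ha hν (hXt t) (hXb t ht))
    (hψ.integrable ha hν (hXt s) (hXb s hs)), ← integral_mul_const]
  refine norm_integral_le_of_norm_le ((hν _).mul_const _) (ae_of_all _ fun x => ?_)
  exact hψ.norm_sub_le (hXb t ht x) (hXb s hs x)
    ((hX x).norm_sub_time_le_expBound hF hcm hM hs ht)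

/-! ### The vector field of a single site -/

/-- The regularity of the activation function, with one constant for all bounds. -/
structure IsActivation (φ : ℝ → ℝ) (C : ℝ) : Prop where
  differentiable : Differentiable ℝ φ
  one_le : 1 ≤ C
  bound : ∀ u, |φ u| ≤ C * (1 + |u|)
  lip : ∀ u v, |φ u - φ v| ≤ C * |u - v|
  deriv_bound : ∀ u, |deriv φ u| ≤ C
  deriv_lip : ∀ u v, |deriv φ u - deriv φ v| ≤ C * |u - v|

theorem exists_isActivation {φ : ℝ → ℝ} (hφ : Differentiable ℝ φ)
    (hφ_bdd : ∃ C : ℝ, ∀ u, |deriv φ u| ≤ C)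
    (hφ_lip : ∃ L : NNReal, LipschitzWith L (deriv φ)) : ∃ C, IsActivation φ C := by
  obtain ⟨C, hC⟩ := hφ_bdd
  obtain ⟨L, hL⟩ := hφ_lip
  have hC0 : 0 ≤ C := (abs_nonneg _).trans (hC 0)
  have hlip : ∀ u v, |φ u - φ v| ≤ C * |u - v| := fun u v =>
    Convex.norm_image_sub_le_of_norm_deriv_le (s := univ) (fun x _ => hφ x) (fun x _ => hC x)
      convex_univ (mem_univ v) (mem_univ u)
  refine ⟨1 + C + L + |φ 0|, hφ, ?_, fun u => ?_, fun u v => (hlip u v).trans ?_,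
    fun u => (hC u).trans ?_, fun u v => ?_⟩
  · have := abs_nonneg (φ 0); have := L.2; change 1 ≤ 1 + C + (L : ℝ) + |φ 0|
    linarith [L.coe_nonneg]
  · have h1 := hlip u 0
    rw [sub_zero] at h1
    have h2 : |φ u| ≤ |φ u - φ 0| + |φ 0| := by simpa using abs_add_le (φ u - φ 0) (φ 0)
    have h3 := mul_nonneg L.coe_nonneg (abs_nonneg u)
    have h4 := mul_nonneg (abs_nonneg (φ 0)) (abs_nonneg u)
    nlinarith [abs_nonneg u, L.coe_nonneg]
  · refine mul_le_mul_of_nonneg_right ?_ (abs_nonneg _)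
    linarith [abs_nonneg (φ 0), L.coe_nonneg]
  · linarith [abs_nonneg (φ 0), L.coe_nonneg]
  · have := hL.dist_le_mul u v
    rw [Real.dist_eq, Real.dist_eq] at this
    refine this.trans (mul_le_mul_of_nonneg_right ?_ (abs_nonneg _))
    linarith [abs_nonneg (φ 0)]

variable {ι : Type*} [Fintype ι]

/-- The velocity of the fields `(h, z)` of a single site under the control `c`. -/
noncomputable def siteField (φ : ℝ → ℝ) (γ₀ : ℝ) (K : Matrix ι ι ℝ) (c : ι → ℝ) (X : (ι → ℝ) × ℝ) :
    (ι → ℝ) × ℝ :=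
  (fun μ => γ₀ * ∑ α, c α * (deriv φ (X.1 α) * X.2) * K μ α, γ₀ * ∑ α, c α * φ (X.1 α))

/-- Functions of the state of linear growth whose Lipschitz constant also grows linearly. Products
of two of them are observables. -/
structure IsFactor (a : ℝ) (u : (ι → ℝ) × ℝ → ℝ) : Prop where
  nonneg : 0 ≤ a
  growth : ∀ X, |u X| ≤ a * (1 + ‖X‖)
  lip : ∀ X Y, |u X - u Y| ≤ a * (1 + ‖Y‖) * ‖X - Y‖

theorem abs_fst_le (X : (ι → ℝ) × ℝ) (μ : ι) : |X.1 μ| ≤ ‖X‖ :=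
  (norm_le_pi_norm X.1 μ).trans (norm_fst_le X)

theorem abs_snd_le (X : (ι → ℝ) × ℝ) : |X.2| ≤ ‖X‖ := norm_snd_le X

theorem isFactor_fst {a : ℝ} (ha : 1 ≤ a) (μ : ι) : IsFactor a (fun X => X.1 μ) := by
  refine ⟨by linarith, fun X => ?_, fun X Y => ?_⟩
  · nlinarith [abs_fst_le X μ, norm_nonneg X]
  · have h1 : |X.1 μ - Y.1 μ| ≤ ‖X - Y‖ := abs_fst_le (X - Y) μ
    refine h1.trans (le_mul_of_one_le_left (norm_nonneg _) ?_)
    nlinarith [norm_nonneg Y]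

theorem isFactor_snd {a : ℝ} (ha : 1 ≤ a) : IsFactor a (fun X : (ι → ℝ) × ℝ => X.2) := by
  refine ⟨by linarith, fun X => ?_, fun X Y => ?_⟩
  · nlinarith [abs_snd_le X, norm_nonneg X]
  · have h1 : |X.2 - Y.2| ≤ ‖X - Y‖ := abs_snd_le (X - Y)
    refine h1.trans (le_mul_of_one_le_left (norm_nonneg _) ?_)
    nlinarith [norm_nonneg Y]

variable {φ : ℝ → ℝ} {C : ℝ}

theorem IsActivation.isFactor_comp_fst (hφ : IsActivation φ C) (μ : ι) :
    IsFactor C (fun X => φ (X.1 μ)) := by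
  have hC := hφ.one_le
  refine ⟨by linarith, fun X => (hφ.bound _).trans ?_, fun X Y => (hφ.lip _ _).trans ?_⟩
  · have := abs_fst_le X μ
    gcongr
  · have h1 : |X.1 μ - Y.1 μ| ≤ ‖X - Y‖ := abs_fst_le (X - Y) μ
    have h2 : C ≤ C * (1 + ‖Y‖) := by nlinarith [norm_nonneg Y]
    gcongr

theorem IsActivation.isFactor_grad (hφ : IsActivation φ C) (μ : ι) :
    IsFactor C (fun X => deriv φ (X.1 μ) * X.2) := by
  have hC := hφ.one_le
  refine ⟨by linarith, fun X => ?_, fun X Y => ?_⟩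
  · rw [abs_mul]
    have h1 := abs_snd_le X
    have h2 := hφ.deriv_bound (X.1 μ)
    gcongr
    linarith
  · have h1 : |X.1 μ - Y.1 μ| ≤ ‖X - Y‖ := abs_fst_le (X - Y) μ
    have h2 : |X.2 - Y.2| ≤ ‖X - Y‖ := abs_snd_le (X - Y)
    have h3 := abs_snd_le Y
    have h4 := hφ.deriv_bound (X.1 μ)
    have h5 := hφ.deriv_lip (X.1 μ) (Y.1 μ)
    have h6 : deriv φ (X.1 μ) * X.2 - deriv φ (Y.1 μ) * Y.2 =
      deriv φ (X.1 μ) * (X.2 - Y.2) + (deriv φ (X.1 μ) - deriv φ (Y.1 μ)) * Y.2 := by ring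
    rw [h6]
    refine (abs_add_le _ _).trans ?_
    rw [abs_mul, abs_mul]
    calc _ ≤ C * ‖X - Y‖ + C * ‖X - Y‖ * ‖Y‖ := by
          gcongr
          exact h5.trans (by gcongr)
      _ = _ := by ring

theorem IsFactor.mul {a : ℝ} {u v : (ι → ℝ) × ℝ → ℝ} (hu : IsFactor a u) (hv : IsFactor a v) :
    IsObservable (fun X => u X * v X) (2 * a ^ 2) := by
  have ha := hu.nonneg
  refine ⟨by positivity, fun X Y => ?_⟩
  have h6 : u X * v X - u Y * v Y = u X * (v X - v Y) + (u X - u Y) * v Y := by ring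
  rw [h6]
  refine (norm_add_le _ _).trans ?_
  rw [norm_mul, norm_mul]
  simp only [Real.norm_eq_abs]
  have h1 := hu.growth X
  have h2 := hv.growth Y
  have h3 := hu.lip X Y
  have h4 := hv.lip X Y
  calc _ ≤ a * (1 + ‖X‖) * (a * (1 + ‖Y‖) * ‖X - Y‖)
        + a * (1 + ‖Y‖) * ‖X - Y‖ * (a * (1 + ‖Y‖)) := by gcongr
    _ = a ^ 2 * ((1 + ‖X‖) * (1 + ‖Y‖) + (1 + ‖Y‖) * (1 + ‖Y‖)) * ‖X - Y‖ := by ring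
    _ ≤ a ^ 2 * ((1 + ‖X‖ + ‖Y‖) * (1 + ‖X‖ + ‖Y‖)
        + (1 + ‖X‖ + ‖Y‖) * (1 + ‖X‖ + ‖Y‖)) * ‖X - Y‖ := by
      have h7 := norm_nonneg X
      have h8 := norm_nonneg Y
      refine mul_le_mul_of_nonneg_right (mul_le_mul_of_nonneg_left ?_ (sq_nonneg a))
        (norm_nonneg _)
      exact add_le_add (mul_le_mul (by linarith) (by linarith) (by linarith) (by linarith))
        (mul_le_mul (by linarith) (by linarith) (by linarith) (by linarith))
    _ = _ := by ring

theorem abs_sum_le_card_mul {t : ι → ℝ} {s : ℝ} (h : ∀ α, |t α| ≤ s) :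
    |∑ α, t α| ≤ Fintype.card ι * s := by
  refine (Finset.abs_sum_le_sum_abs _ _).trans ((Finset.sum_le_sum fun α _ => h α).trans_eq ?_)
  simp

theorem IsFactor.abs_control_mul_sub_le {a : ℝ} {u : (ι → ℝ) × ℝ → ℝ} (hu : IsFactor a u)
    (c c' : ι → ℝ) (X Y : (ι → ℝ) × ℝ) (α : ι) :
    |c α * u X - c' α * u Y| ≤
      a * (‖c - c'‖ * (1 + ‖Y‖) + ‖c‖ * (1 + ‖Y‖) * ‖X - Y‖) := by
  have h1 : c α * u X - c' α * u Y = c α * (u X - u Y) + (c - c') α * u Y := by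
    simp only [Pi.sub_apply]; ring
  rw [h1]
  refine (abs_add_le _ _).trans ?_
  rw [abs_mul, abs_mul]
  have h2 : |c α| ≤ ‖c‖ := norm_le_pi_norm c α
  have h3 : |(c - c') α| ≤ ‖c - c'‖ := norm_le_pi_norm (c - c') α
  have h4 := hu.growth Y
  have h5 := hu.lip X Y
  calc _ ≤ ‖c‖ * (a * (1 + ‖Y‖) * ‖X - Y‖) + ‖c - c'‖ * (a * (1 + ‖Y‖)) := by gcongr
    _ = _ := by ring

theorem IsActivation.exists_isControlledField (hφ : IsActivation φ C) (γ₀ : ℝ) (K : Matrix ι ι ℝ) :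
    ∃ A, IsControlledField (siteField φ γ₀ K) A := by
  have hC := hφ.one_le
  set k : ℝ := ∑ μ, ∑ α, |K μ α| with hk
  have hKk : ∀ μ α, |K μ α| ≤ 1 + k := by
    intro μ α
    have h1 : |K μ α| ≤ ∑ α, |K μ α| :=
      Finset.single_le_sum (f := fun α => |K μ α|) (fun _ _ => abs_nonneg _) (Finset.mem_univ α)
    have h2 : ∑ α, |K μ α| ≤ k :=
      Finset.single_le_sum (f := fun μ => ∑ α, |K μ α|)
        (fun _ _ => Finset.sum_nonneg fun _ _ => abs_nonneg _) (Finset.mem_univ μ)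
    linarith
  have hk0 : 0 ≤ k := Finset.sum_nonneg fun _ _ => Finset.sum_nonneg fun _ _ => abs_nonneg _
  have hlip : ∀ (c c' : ι → ℝ) (X Y : (ι → ℝ) × ℝ),
      ‖siteField φ γ₀ K c X - siteField φ γ₀ K c' Y‖ ≤
      |γ₀| * (Fintype.card ι * (C * (‖c - c'‖ * (1 + ‖Y‖) + ‖c‖ * (1 + ‖Y‖) * ‖X - Y‖)
        * (1 + k))) := by
    intro c c' X Y
    rw [norm_prod_le_iff, pi_norm_le_iff_of_nonneg (by positivity)]
    constructor
    · intro μ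
      have : (siteField φ γ₀ K c X - siteField φ γ₀ K c' Y).1 μ = γ₀ * ∑ α,
          (c α * (deriv φ (X.1 α) * X.2) - c' α * (deriv φ (Y.1 α) * Y.2)) * K μ α := by
        simp only [siteField, Prod.fst_sub, Pi.sub_apply, ← mul_sub, ← Finset.sum_sub_distrib,
          sub_mul]
      rw [this, Real.norm_eq_abs, abs_mul]
      gcongr
      refine abs_sum_le_card_mul fun α => ?_
      rw [abs_mul]
      exact mul_le_mul ((hφ.isFactor_grad α).abs_control_mul_sub_le c c' X Y α) (hKk μ α)
        (abs_nonneg _) (by positivity)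
    · have : (siteField φ γ₀ K c X - siteField φ γ₀ K c' Y).2 = γ₀ * ∑ α,
          (c α * φ (X.1 α) - c' α * φ (Y.1 α)) := by
        simp only [siteField, Prod.snd_sub, ← mul_sub, ← Finset.sum_sub_distrib]
      rw [this, Real.norm_eq_abs, abs_mul]
      gcongr
      refine abs_sum_le_card_mul fun α => ?_
      refine ((hφ.isFactor_comp_fst α).abs_control_mul_sub_le c c' X Y α).trans ?_
      exact le_mul_of_one_le_right (by positivity) (by linarith)
  refine ⟨|γ₀| * (Fintype.card ι * (C * (1 + k))), by positivity, fun c X => ?_,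
    fun c c' X Y => (hlip c c' X Y).trans_eq (by ring)⟩
  -- the growth bound is the Lipschitz bound against the zero control
  have h0 : siteField φ γ₀ K 0 X = 0 := by
    ext <;> simp [siteField]
  have := hlip c 0 X X
  rw [h0, sub_zero, sub_zero, sub_self, norm_zero, mul_zero, add_zero] at this
  exact this.trans_eq (by ring)

/-! ### Algebra of observables -/

section
variable {E : Type*} [NormedAddCommGroup E] [NormedSpace ℝ E]

theorem IsObservable.add {ψ ψ' : E → ℝ} {B B' : ℝ} (h : IsObservable ψ B)
    (h' : IsObservable ψ' B') : IsObservable (fun X => ψ X + ψ' X) (B + B') := by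
  refine ⟨add_nonneg h.nonneg h'.nonneg, fun X Y => ?_⟩
  rw [add_sub_add_comm]
  refine (norm_add_le _ _).trans ((add_le_add (h.lip X Y) (h'.lip X Y)).trans_eq ?_)
  ring

theorem IsObservable.const_mul {ψ : E → ℝ} {B : ℝ} (h : IsObservable ψ B) (a : ℝ) :
    IsObservable (fun X => a * ψ X) (|a| * B) := by
  refine ⟨mul_nonneg (abs_nonneg _) h.nonneg, fun X Y => ?_⟩
  rw [← mul_sub, norm_mul, Real.norm_eq_abs a, mul_assoc, mul_assoc]
  exact mul_le_mul_of_nonneg_left ((h.lip X Y).trans_eq (by ring)) (abs_nonneg _)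

theorem IsObservable.pi {ψ : ι → E → ℝ} {B : ℝ} (hB : 0 ≤ B) (h : ∀ μ, IsObservable (ψ μ) B) :
    IsObservable (fun X μ => ψ μ X) B :=
  ⟨hB, fun X Y => (pi_norm_le_iff_of_nonneg (by positivity)).2 fun μ => (h μ).lip X Y⟩

theorem IsObservable.abs_le {ψ : E → ℝ} {B : ℝ} (h : IsObservable ψ B) (X : E) :
    |ψ X| ≤ (|ψ 0| + B) * (1 + ‖X‖) ^ 3 := by
  have h1 := h.lip X 0
  have h2 := h.nonneg
  rw [norm_zero, add_zero, sub_zero, Real.norm_eq_abs] at h1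
  have h3 : |ψ X| ≤ |ψ X - ψ 0| + |ψ 0| := by simpa using abs_add_le (ψ X - ψ 0) (ψ 0)
  have h4 : (1 : ℝ) ≤ (1 + ‖X‖) ^ 3 := one_le_pow₀ (by linarith [norm_nonneg X])
  have h5 : B * (1 + ‖X‖) ^ 2 * ‖X‖ ≤ B * (1 + ‖X‖) ^ 2 * (1 + ‖X‖) := by
    gcongr; linarith
  nlinarith [abs_nonneg (ψ 0), mul_le_mul_of_nonneg_left h4 (abs_nonneg (ψ 0))]

variable [MeasurableSpace E] [BorelSpace E] [SecondCountableTopology E]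

/-- Evolution of moments when the time derivative of the observable is a combination of observables,
with the control as coefficients. -/
theorem integral_comp_flow_eq_sum [CompleteSpace E] {F : (ι → ℝ) → E → E} {A : ℝ}
    (hF : IsControlledField F A)
    {c : ℝ → ι → ℝ} (hcm : AEStronglyMeasurable c) {M b : ℝ} (hM : ∀ s ∈ Icc 0 b, ‖c s‖ ≤ M)
    {N : Set ℝ} (hN : N.Countable) (hcN : ∀ s ∉ N, ContinuousAt c s)
    {X : E → ℝ → E} (hXc : Continuous (Function.uncurry X)) (hX : ∀ x, IsPath F c x b (X x))
    {ν : Measure E} [IsProbabilityMeasure ν] (hν : HasExpMoments ν)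
    {ψ : E → ℝ} {B : ℝ} (hψ : IsObservable ψ B) {w : ι → E → ℝ}
    (hw : ∀ α, ∃ B, IsObservable (w α) B)
    (hD : ∀ (Y : ℝ → E) (t : ℝ) (c : ι → ℝ), HasDerivAt Y (F c (Y t)) t →
      HasDerivAt (fun s => ψ (Y s)) (∑ α, c α * w α (Y t)) t) {t : ℝ} (ht : t ∈ Icc 0 b) :
    ∫ x, ψ (X x t) ∂ν = ∫ x, ψ x ∂ν
      + ∫ s in (0 : ℝ)..t, ∑ α, c s α * ∫ x, w α (X x s) ∂ν := by
  choose B' hB' using hw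
  have hXt : ∀ t, Continuous fun x => X x t :=
    fun t => hXc.comp (by fun_prop : Continuous fun x => (x, t))
  have hM0 : 0 ≤ M := (norm_nonneg _).trans (hM t ht)
  have ha := pathRate_nonneg hF.nonneg hM0 (ht.1.trans ht.2)
  rw [integral_comp_flow_eq hF hcm hM hN hcN hXc hX hν hψ
    (D := fun c X => ∑ α, c α * w α X) (C := ∑ α, (|w α 0| + B' α)) ?_ ?_ hD ht]
  · congr 1
    refine intervalIntegral.integral_congr fun s hs => ?_
    rw [uIcc_of_le ht.1] at hs
    have hs' : s ∈ Icc 0 b := ⟨hs.1, hs.2.trans ht.2⟩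
    rw [integral_finsetSum _ fun α _ => ((hB' α).integrable ha hν (hXt s) fun x =>
      (hX x).one_add_norm_le_expBound hF hM le_rfl hs').const_mul _]
    simp_rw [integral_const_mul]
  · refine continuous_finsetSum _ fun α _ => ?_
    exact ((continuous_apply α).comp continuous_fst).mul ((hB' α).continuous.comp continuous_snd)
  · intro c X
    refine (Finset.abs_sum_le_sum_abs _ _).trans ?_
    rw [Finset.sum_mul, Finset.sum_mul]
    refine Finset.sum_le_sum fun α _ => ?_
    rw [abs_mul]
    have h1 : |c α| ≤ ‖c‖ := norm_le_pi_norm c α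
    have h2 := (hB' α).abs_le X
    have h3 := (hB' α).nonneg
    have h4 : (1 + ‖X‖) ^ 3 ≤ (1 + ‖X‖) ^ 4 :=
      pow_le_pow_right₀ (by linarith [norm_nonneg X]) (by norm_num)
    calc _ ≤ ‖c‖ * ((|w α 0| + B' α) * (1 + ‖X‖) ^ 4) := by
          gcongr
          exact h2.trans (by gcongr)
      _ = _ := by ring

end

/-! ### Time derivatives of the observables of a site -/

theorem hasDerivAt_site_fst {γ₀ : ℝ} {K : Matrix ι ι ℝ} {Y : ℝ → (ι → ℝ) × ℝ} {t : ℝ}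
    {c : ι → ℝ} (h : HasDerivAt Y (siteField φ γ₀ K c (Y t)) t) (μ : ι) :
    HasDerivAt (fun s => (Y s).1 μ)
      (γ₀ * ∑ α, c α * (deriv φ ((Y t).1 α) * (Y t).2) * K μ α) t := by
  have h1 : HasDerivAt (fun s => (Y s).1) (siteField φ γ₀ K c (Y t)).1 t := by
    exact (hasFDerivAt_fst (𝕜 := ℝ) (p := Y t)).comp_hasDerivAt t h
  exact (hasDerivAt_pi.1 h1) μ

theorem hasDerivAt_site_snd {γ₀ : ℝ} {K : Matrix ι ι ℝ} {Y : ℝ → (ι → ℝ) × ℝ} {t : ℝ}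
    {c : ι → ℝ} (h : HasDerivAt Y (siteField φ γ₀ K c (Y t)) t) :
    HasDerivAt (fun s => (Y s).2) (γ₀ * ∑ α, c α * φ ((Y t).1 α)) t := by
  exact (hasFDerivAt_snd (𝕜 := ℝ) (p := Y t)).comp_hasDerivAt t h

theorem hasDerivAt_site_output (hφ : IsActivation φ C) {γ₀ : ℝ} {K : Matrix ι ι ℝ} (μ : ι)
    (Y : ℝ → (ι → ℝ) × ℝ) (t : ℝ) (c : ι → ℝ) (h : HasDerivAt Y (siteField φ γ₀ K c (Y t)) t) :
    HasDerivAt (fun s => (Y s).2 * φ ((Y s).1 μ))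
      (∑ α, c α * (γ₀ * (φ ((Y t).1 μ) * φ ((Y t).1 α) + K μ α *
        (deriv φ ((Y t).1 μ) * (Y t).2 * (deriv φ ((Y t).1 α) * (Y t).2))))) t := by
  have h1 := (hφ.differentiable ((Y t).1 μ)).hasDerivAt.comp t (hasDerivAt_site_fst h μ)
  refine ((hasDerivAt_site_snd h).mul h1).congr_deriv ?_
  simp only [Finset.mul_sum, Finset.sum_mul, ← Finset.sum_add_distrib, Function.comp_apply]
  exact Finset.sum_congr rfl fun α _ => by ring

theorem hasDerivAt_site_snd_sq {γ₀ : ℝ} {K : Matrix ι ι ℝ}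
    (Y : ℝ → (ι → ℝ) × ℝ) (t : ℝ) (c : ι → ℝ) (h : HasDerivAt Y (siteField φ γ₀ K c (Y t)) t) :
    HasDerivAt (fun s => (Y s).2 * (Y s).2)
      (∑ α, c α * (2 * γ₀ * ((Y t).2 * φ ((Y t).1 α)))) t := by
  refine ((hasDerivAt_site_snd h).mul (hasDerivAt_site_snd h)).congr_deriv ?_
  simp only [Finset.mul_sum, Finset.sum_mul, ← Finset.sum_add_distrib]
  exact Finset.sum_congr rfl fun α _ => by ring

theorem hasDerivAt_site_fst_sq {γ₀ : ℝ} {K : Matrix ι ι ℝ} (μ : ι)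
    (Y : ℝ → (ι → ℝ) × ℝ) (t : ℝ) (c : ι → ℝ) (h : HasDerivAt Y (siteField φ γ₀ K c (Y t)) t) :
    HasDerivAt (fun s => (Y s).1 μ * (Y s).1 μ)
      (∑ α, c α * (2 * γ₀ * K μ α * ((Y t).1 μ * (deriv φ ((Y t).1 α) * (Y t).2)))) t := by
  refine ((hasDerivAt_site_fst h μ).mul (hasDerivAt_site_fst h μ)).congr_deriv ?_
  simp only [Finset.mul_sum, Finset.sum_mul, ← Finset.sum_add_distrib]
  exact Finset.sum_congr rfl fun α _ => by ring

/-- The output observable `z φ(h_μ)`, for all samples at once. -/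
def outputObs (φ : ℝ → ℝ) (X : (ι → ℝ) × ℝ) (μ : ι) : ℝ := X.2 * φ (X.1 μ)

theorem IsActivation.isObservable_output (hφ : IsActivation φ C) :
    IsObservable (outputObs φ : (ι → ℝ) × ℝ → ι → ℝ) (2 * C ^ 2) :=
  IsObservable.pi (by positivity) fun μ =>
    (isFactor_snd hφ.one_le).mul (hφ.isFactor_comp_fst μ)

theorem IsActivation.isObservable_feature (hφ : IsActivation φ C) (μ ν : ι) :
    IsObservable (fun X : (ι → ℝ) × ℝ => φ (X.1 μ) * φ (X.1 ν)) (2 * C ^ 2) :=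
  (hφ.isFactor_comp_fst μ).mul (hφ.isFactor_comp_fst ν)

theorem IsActivation.isObservable_gradient (hφ : IsActivation φ C) (μ ν : ι) :
    IsObservable (fun X : (ι → ℝ) × ℝ =>
      deriv φ (X.1 μ) * X.2 * (deriv φ (X.1 ν) * X.2)) (2 * C ^ 2) :=
  (hφ.isFactor_grad μ).mul (hφ.isFactor_grad ν)

/-! ### Self-consistent moments -/

/-- There is a flow whose control is a prescribed bounded Lipschitz function of its own moments
`m t = 𝔼[ψ(X t)]`: the moments are a fixed point of a causal contraction. -/
theorem IsControlledField.exists_selfConsistent_flow {V E : Type*} [NormedAddCommGroup V]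
    [NormedSpace ℝ V] [CompleteSpace V] [NormedAddCommGroup E] [NormedSpace ℝ E] [CompleteSpace E]
    [MeasurableSpace E] [BorelSpace E] [SecondCountableTopology E]
    {F : V → E → E} {A : ℝ} (hF : IsControlledField F A) {ψ : E → V} {B : ℝ}
    (hψ : IsObservable ψ B) {ν : Measure E} (hν : HasExpMoments ν)
    {κ : ℝ → V → V} {M l b : ℝ} (hb : 0 ≤ b) (hl : 0 ≤ l)
    (hκm : ∀ m : ℝ → V, Continuous m → AEStronglyMeasurable fun s => κ s (m s))
    (hκM : ∀ s v, ‖κ s v‖ ≤ M) (hκl : ∀ s v w, ‖κ s v - κ s w‖ ≤ l * ‖v - w‖) :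
    ∃ (m : ℝ → V) (X : E → ℝ → E), Continuous m ∧ Continuous (Function.uncurry X) ∧
      (∀ x, IsPath F (fun s => κ s (m s)) x b (X x)) ∧
      ∀ t ∈ Icc 0 b, m t = ∫ x, ψ (X x t) ∂ν := by
  have hM0 : 0 ≤ M := (norm_nonneg _).trans (hκM 0 0)
  have ha := pathRate_nonneg hF.nonneg hM0 hb
  have hcont : ∀ u : C(Icc (0 : ℝ) b, V), Continuous (IccExtend hb u) :=
    fun u => u.continuous.Icc_extend'
  have hext : ∀ (u : C(Icc (0 : ℝ) b, V)) (r : ℝ) (hr : r ∈ Icc (0 : ℝ) b),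
      IccExtend hb u r = u ⟨r, hr⟩ := fun u r hr => IccExtend_of_mem hb _ hr
  have hm : ∀ u : C(Icc (0 : ℝ) b, V), AEStronglyMeasurable fun s => κ s (IccExtend hb u s) :=
    fun u => hκm _ (hcont u)
  choose X hXc hX using fun u : C(Icc (0 : ℝ) b, V) =>
    hF.exists_flow (hm u) (M := M) (fun s _ => hκM _ _) hb
  have hmom : ∀ u, ContinuousOn (fun t => ∫ x, ψ (X u x t) ∂ν) (Icc 0 b) := by
    intro u
    obtain ⟨K, hK, hKl⟩ := norm_integral_comp_flow_sub_le hF (hm u) (M := M) (fun s _ => hκM _ _)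
      (hXc u) (hX u) hν hψ
    refine (LipschitzOnWith.of_dist_le_mul (K := ⟨K, hK⟩) fun t ht s hs => ?_).continuousOn
    rw [dist_eq_norm, Real.dist_eq]
    exact hKl s hs t ht
  let Γ : C(Icc (0 : ℝ) b, V) → C(Icc (0 : ℝ) b, V) := fun u =>
    ⟨fun t => ∫ x, ψ (X u x t) ∂ν, continuousOn_iff_continuous_domRestrict.1 (hmom u)⟩
  set r : ℝ := ‖ψ 0‖ + 4 * B + 3 * pathRate A M b
  set Q : ℝ := ∫ x, expBound r x ∂ν
  have hQ : 0 ≤ Q := integral_nonneg fun x => (expBound_pos _ x).le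
  have hXb : ∀ u, ∀ s ∈ Icc 0 b, ∀ x, 1 + ‖X u x s‖ ≤ expBound (pathRate A M b) x :=
    fun u s hs x => (hX u x).one_add_norm_le_expBound hF (fun s _ => hκM _ _) le_rfl hs
  have hXt : ∀ u t, Continuous fun x => X u x t :=
    fun u t => (hXc u).comp (by fun_prop : Continuous fun x => (x, t))
  -- the weight `exp (L t)` for which the map from controls to moments contracts by `1 / 2`
  set L : ℝ := 2 * (Q * l + 1) with hL
  have hL0 : 0 < L := by positivity
  have hcontr : ∀ u ∈ (univ : Set C(Icc (0 : ℝ) b, V)), ∀ v ∈ (univ : Set C(Icc (0 : ℝ) b, V)),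
      ∀ D, 0 ≤ D → (∀ t, dist (u t) (v t) ≤ D * Real.exp (L * t)) →
      ∀ t, dist (Γ u t) (Γ v t) ≤ D / 2 * Real.exp (L * t) := by
    intro u _ v _ D hD huv t
    have h1 : ∫ s in (0 : ℝ)..t, ‖κ s (IccExtend hb u s) - κ s (IccExtend hb v s)‖ ≤
        l * D * (Real.exp (L * t) / L) := by
      have h2 : ∫ s in (0 : ℝ)..t, ‖κ s (IccExtend hb u s) - κ s (IccExtend hb v s)‖ ≤
          ∫ s in (0 : ℝ)..t, l * D * Real.exp (L * s) := by
        refine (Real.le_norm_self _).trans (intervalIntegral.norm_integral_le_of_norm_le t.2.1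
          (ae_of_all _ fun s hs => ?_) ((by fun_prop : Continuous fun s : ℝ =>
            l * D * Real.exp (L * s)).intervalIntegrable _ _))
        have hs' : s ∈ Icc 0 b := ⟨hs.1.le, hs.2.trans t.2.2⟩
        rw [norm_norm]
        refine (hκl _ _ _).trans ?_
        rw [hext u s hs', hext v s hs', ← dist_eq_norm, mul_assoc]
        exact mul_le_mul_of_nonneg_left (huv ⟨s, hs'⟩) hl
      rw [intervalIntegral.integral_const_mul] at h2
      exact h2.trans (mul_le_mul_of_nonneg_left (integral_exp_le hL0) (by positivity))
    have h3 : dist (Γ u t) (Γ v t) ≤ Q * (l * D * (Real.exp (L * t) / L)) := by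
      rw [dist_eq_norm]
      change ‖∫ x, ψ (X u x t) ∂ν - ∫ x, ψ (X v x t) ∂ν‖ ≤ _
      rw [← integral_sub (hψ.integrable ha hν (hXt u t) (hXb u t t.2))
        (hψ.integrable ha hν (hXt v t) (hXb v t t.2)), ← integral_mul_const]
      refine norm_integral_le_of_norm_le ((hν _).mul_const _) (ae_of_all _ fun x => ?_)
      refine hψ.norm_sub_le (hXb u t t.2 x) (hXb v t t.2 x) ?_
      refine ((hX u x).norm_sub_le_expBound hF (hm u) (hm v) (fun s _ => hκM _ _)
        (fun s _ => hκM _ _) le_rfl (hX v x) t.2).trans ?_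
      exact mul_le_mul_of_nonneg_left h1 (expBound_pos _ x).le
    refine h3.trans ?_
    have h4 : Q * l ≤ L / 2 := by rw [hL]; linarith
    calc Q * (l * D * (Real.exp (L * t) / L)) = Q * l * (D * (Real.exp (L * t) / L)) := by ring
      _ ≤ L / 2 * (D * (Real.exp (L * t) / L)) := by gcongr
      _ = _ := by field_simp
  obtain ⟨u, -, hu⟩ := exists_fixedPoint_of_weighted_contraction univ isClosed_univ univ_nonempty Γ
    (mapsTo_univ _ _) hL0.le hcontr
  refine ⟨IccExtend hb u, X u, hcont u, hXc u, hX u, fun t ht => ?_⟩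
  rw [hext u t ht]
  exact (congrArg (fun w : C(Icc (0 : ℝ) b, V) => w ⟨t, ht⟩) hu).symm

/-! ### A priori bounds for the limit -/

/-- The Cauchy-Schwarz inequality for integrals. -/
theorem sq_integral_mul_le {Ω : Type*} [MeasurableSpace Ω] {P : Measure Ω} {f g : Ω → ℝ}
    (hff : Integrable (fun x => f x * f x) P) (hfg : Integrable (fun x => f x * g x) P)
    (hgg : Integrable (fun x => g x * g x) P) :
    (∫ x, f x * g x ∂P) ^ 2 ≤ (∫ x, f x * f x ∂P) * ∫ x, g x * g x ∂P := by
  have h : ∀ τ : ℝ, 0 ≤ (∫ x, f x * f x ∂P) * (τ * τ) + 2 * (∫ x, f x * g x ∂P) * τ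
      + ∫ x, g x * g x ∂P := by
    intro τ
    have h1 : 0 ≤ ∫ x, (τ * f x + g x) * (τ * f x + g x) ∂P :=
      integral_nonneg fun x => mul_self_nonneg _
    have h2 : (fun x => (τ * f x + g x) * (τ * f x + g x)) = fun x =>
        τ * τ * (f x * f x) + 2 * τ * (f x * g x) + g x * g x := by
      funext x; ring
    have h3 : Integrable (fun x => τ * τ * (f x * f x) + 2 * τ * (f x * g x)) P :=
      (hff.const_mul _).add (hfg.const_mul _)
    rw [h2, integral_add h3 hgg, integral_add (hff.const_mul _) (hfg.const_mul _), integral_const_mul,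
      integral_const_mul] at h1
    linarith
  have := discrim_le_zero h
  rw [discrim] at this
  linarith

/-- One-sided comparison of interval integrals that needs no integrability of the smaller function:
if it fails, the integral on the left is zero. -/
theorem intervalIntegral_le_of_le {f g : ℝ → ℝ} {t : ℝ} (ht : 0 ≤ t)
    (hg : IntervalIntegrable g volume 0 t) (hg0 : ∀ s ∈ Icc 0 t, 0 ≤ g s)
    (hfg : ∀ s ∈ Icc 0 t, f s ≤ g s) :
    ∫ s in (0 : ℝ)..t, f s ≤ ∫ s in (0 : ℝ)..t, g s := by
  by_cases hf : IntervalIntegrable f volume 0 t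
  · exact intervalIntegral.integral_mono_on ht hf hg hfg
  · rw [intervalIntegral.integral_undef hf]
    exact intervalIntegral.integral_nonneg ht hg0

/-- Truncation of the residuals at height `M`. -/
def clip (M v : ℝ) : ℝ := max (-M) (min M v)

theorem continuous_clip (M : ℝ) : Continuous (clip M) := by unfold clip; fun_prop

theorem abs_clip_le {M : ℝ} (hM : 0 ≤ M) (v : ℝ) : |clip M v| ≤ M := by
  unfold clip
  rw [abs_le]
  exact ⟨le_max_left _ _, max_le (by linarith) (min_le_left _ _)⟩

theorem clip_eq {M v : ℝ} (h : |v| ≤ M) : clip M v = v := by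
  rw [abs_le] at h
  rw [clip, min_eq_right h.2, max_eq_right h.1]

theorem abs_clip_sub_le (M v w : ℝ) : |clip M v - clip M w| ≤ |v - w| :=
  (abs_max_sub_max_le_max _ _ _ _).trans (by
    rw [sub_self, abs_zero]
    refine max_le (abs_nonneg _) ((abs_min_sub_min_le_max _ _ _ _).trans ?_)
    rw [sub_self, abs_zero]
    exact max_le (abs_nonneg _) le_rfl)

theorem abs_clip_le_abs {M : ℝ} (hM : 0 ≤ M) (v : ℝ) : |clip M v| ≤ |v| := by
  simpa [clip_eq (show |(0 : ℝ)| ≤ M by simpa)] using abs_clip_sub_le M v 0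

/-- The energy inequality behind the global existence of the limit: truncation only scales a
residual down, so that it preserves the bound `Δ (y - Δ) ≤ y² / 4`. -/
theorem clip_mul_sub_le {M : ℝ} (hM : 0 ≤ M) (v y : ℝ) : clip M v * (y - v) ≤ y ^ 2 / 4 := by
  have h1 := abs_clip_le_abs hM v
  rcases le_total 0 v with hv | hv
  · have h2 : 0 ≤ clip M v := le_max_of_le_right (le_min hM hv)
    rw [abs_of_nonneg h2, abs_of_nonneg hv] at h1
    rcases le_total 0 (y - v) with h | h
    · nlinarith [sq_nonneg (y - 2 * v)]
    · nlinarith [sq_nonneg y]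
  · have h2 : clip M v ≤ 0 := max_le (by linarith) ((min_le_right _ _).trans hv)
    rw [abs_of_nonpos h2, abs_of_nonpos hv] at h1
    rcases le_total 0 (y - v) with h | h
    · nlinarith [sq_nonneg y]
    · nlinarith [sq_nonneg (y - 2 * v)]

variable {ι : Type*} [Fintype ι] {φ : ℝ → ℝ} {C : ℝ}

/-- The second moments of a self-consistent flow, and hence its outputs, are bounded independently
of the level `M` at which the residuals are truncated. -/
theorem exists_bound_selfConsistent (hφ : IsActivation φ C) {γ₀ : ℝ} (hγ₀ : 0 < γ₀)
    (K : Matrix ι ι ℝ) (y : ι → ℝ) (b : ℝ) {ν : Measure ((ι → ℝ) × ℝ)} [IsProbabilityMeasure ν]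
    (hν : HasExpMoments ν) :
    ∃ M₀ : ℝ, ∀ (U : ι → ℝ → ℝ) (N : Set ℝ) (M : ℝ) (m : ℝ → ι → ℝ)
      (X : (ι → ℝ) × ℝ → ℝ → (ι → ℝ) × ℝ), (∀ α s, 0 ≤ U α s) → (∀ α s, U α s ≤ 1) →
      (∀ α, Measurable (U α)) → N.Countable → (∀ α, ∀ s ∉ N, ContinuousAt (U α) s) → 0 ≤ M →
      Continuous m → Continuous (Function.uncurry X) →
      (∀ x, IsPath (siteField φ γ₀ K)
        (fun s α => U α s * clip M (y α - γ₀⁻¹ * m s α)) x b (X x)) →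
      (∀ t ∈ Icc 0 b, m t = ∫ x, outputObs φ (X x t) ∂ν) →
      ∀ t ∈ Icc 0 b, ∀ α, |m t α| ≤ M₀ := by
  obtain ⟨A, hF⟩ := hφ.exists_isControlledField γ₀ K
  have hC := hφ.one_le
  set Z : ℝ := ∫ x, x.2 * x.2 ∂ν + γ₀ ^ 2 * (∑ α, y α ^ 2) / 2 * |b| with hZ
  set k₁ : ℝ := 2 * ∑ α, y α ^ 2 + 4 * γ₀⁻¹ ^ 2 * C ^ 2 * Z + C ^ 2 * Z with hk₁
  set k : ℝ := ∑ μ, ∑ α, γ₀ * |K μ α| * k₁ with hk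
  set u₀ : ℝ := ∑ μ, ∫ x, x.1 μ * x.1 μ ∂ν with hu₀
  set H : ℝ := (1 + u₀) * Real.exp (k * |b|) with hH
  refine ⟨1 + 2 * C ^ 2 * Z * H, ?_⟩
  intro U N M m X hU0 hU1 hUm hN hUN hM hm hXc hX hmX t₀ ht₀ α₀
  have hb : 0 ≤ b := ht₀.1.trans ht₀.2
  have hγi : 0 ≤ γ₀⁻¹ := (inv_pos.2 hγ₀).le
  set c : ℝ → ι → ℝ := fun s α => U α s * clip M (y α - γ₀⁻¹ * m s α) with hc
  have hcmeas : AEStronglyMeasurable c := by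
    refine (measurable_pi_iff.2 fun α => ?_).aestronglyMeasurable
    refine (hUm α).mul ((continuous_clip M).comp ?_).measurable
    have : Continuous fun s => m s α := (continuous_apply α).comp hm
    fun_prop
  have hcabs : ∀ s α, |c s α| ≤ |clip M (y α - γ₀⁻¹ * m s α)| := fun s α => by
    rw [hc, abs_mul, abs_of_nonneg (hU0 α s)]
    exact mul_le_of_le_one_left (abs_nonneg _) (hU1 α s)
  have hcM : ∀ s ∈ Icc 0 b, ‖c s‖ ≤ M := fun s _ =>
    (pi_norm_le_iff_of_nonneg hM).2 fun α => (hcabs s α).trans (abs_clip_le hM _)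
  have hcN : ∀ s ∉ N, ContinuousAt c s := by
    intro s hs
    refine continuousAt_pi.2 fun α => (hUN α s hs).mul ?_
    have : Continuous fun s => m s α := (continuous_apply α).comp hm
    exact ((continuous_clip M).comp (by fun_prop)).continuousAt
  have ha := pathRate_nonneg hF.nonneg hM hb
  have hXb : ∀ s ∈ Icc 0 b, ∀ x, 1 + ‖X x s‖ ≤ expBound (pathRate A M b) x :=
    fun s hs x => (hX x).one_add_norm_le_expBound hF hcM le_rfl hs
  have hXt : ∀ t, Continuous fun x => X x t :=
    fun t => hXc.comp (by fun_prop : Continuous fun x => (x, t))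
  have hint : ∀ {ψ : (ι → ℝ) × ℝ → ℝ} {B : ℝ}, IsObservable ψ B → ∀ t ∈ Icc 0 b,
      Integrable (fun x => ψ (X x t)) ν :=
    fun hψ t ht => hψ.integrable ha hν (hXt t) (hXb t ht)
  have hzz := (isFactor_snd (ι := ι) hC).mul (isFactor_snd hC)
  have hzq := fun α => (isFactor_snd hC).mul (hφ.isFactor_comp_fst (ι := ι) α)
  have hqq := fun α => (hφ.isFactor_comp_fst (ι := ι) α).mul (hφ.isFactor_comp_fst α)
  have hhh := fun μ => (isFactor_fst (ι := ι) hC μ).mul (isFactor_fst hC μ)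
  have hhp := fun μ α => (isFactor_fst (ι := ι) hC μ).mul (hφ.isFactor_grad α)
  have hpp := fun α => (hφ.isFactor_grad (ι := ι) α).mul (hφ.isFactor_grad α)
  have hmα : ∀ t ∈ Icc 0 b, ∀ α, m t α = ∫ x, (X x t).2 * φ ((X x t).1 α) ∂ν := by
    intro t ht α
    rw [hmX t ht, eval_integral]
    · rfl
    · exact fun i => hint (hzq i) t ht
  have hy0 : 0 ≤ ∑ α, y α ^ 2 := Finset.sum_nonneg fun α _ => sq_nonneg _
  -- The derivative of `𝔼[z²]` is `2 γ₀² ∑ U_α clip(Δ_α) (y_α - Δ_α)`, since the output is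
  -- `γ₀⁻¹ 𝔼[z φ(h_α)] = y_α - Δ_α`; so it is bounded without any knowledge of the outputs.
  have hzb : ∀ t ∈ Icc 0 b, ∫ x, (X x t).2 * (X x t).2 ∂ν ≤ Z := by
    intro t ht
    rw [integral_comp_flow_eq_sum hF hcmeas hcM hN hcN hXc hX hν hzz
      (w := fun α x => 2 * γ₀ * (x.2 * φ (x.1 α)))
      (fun α => ⟨_, (hzq α).const_mul (2 * γ₀)⟩) (fun Y t c h => hasDerivAt_site_snd_sq Y t c h) ht,
      hZ]
    refine add_le_add_right ?_ _
    refine (intervalIntegral_le_of_le (g := fun _ => γ₀ ^ 2 * (∑ α, y α ^ 2) / 2) ht.1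
      (by simp) (fun _ _ => by positivity) fun s hs => ?_).trans ?_
    · have hs' : s ∈ Icc 0 b := ⟨hs.1, hs.2.trans ht.2⟩
      rw [Finset.mul_sum, Finset.sum_div]
      refine Finset.sum_le_sum fun α _ => ?_
      rw [integral_const_mul, ← hmα s hs' α]
      have h1 := clip_mul_sub_le hM (y α - γ₀⁻¹ * m s α) (y α)
      have h2 : y α - (y α - γ₀⁻¹ * m s α) = γ₀⁻¹ * m s α := by ring
      rw [h2] at h1
      have h3 : c s α * (2 * γ₀ * m s α) = U α s * (2 * γ₀ ^ 2 *
          (clip M (y α - γ₀⁻¹ * m s α) * (γ₀⁻¹ * m s α))) := by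
        simp only [hc]; field_simp
      rw [h3]
      calc _ ≤ U α s * (2 * γ₀ ^ 2 * (y α ^ 2 / 4)) := by
            gcongr
            exact hU0 α s
        _ ≤ 1 * (2 * γ₀ ^ 2 * (y α ^ 2 / 4)) := by
            gcongr
            exact hU1 α s
        _ = _ := by ring
    · rw [intervalIntegral.integral_const, smul_eq_mul, sub_zero, mul_comm]
      exact mul_le_mul_of_nonneg_left (ht.2.trans (le_abs_self b)) (by positivity)
  have hZ0 : 0 ≤ Z := (integral_nonneg fun x => mul_self_nonneg _).trans (hzb t₀ ht₀)
  have hk₁0 : 0 ≤ k₁ := by positivity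
  have hk0 : 0 ≤ k := Finset.sum_nonneg fun μ _ => Finset.sum_nonneg fun α _ => by positivity
  set u : ℝ → ℝ := fun t => ∑ μ, ∫ x, (X x t).1 μ * (X x t).1 μ ∂ν with hu
  have huμ : ∀ t μ, ∫ x, (X x t).1 μ * (X x t).1 μ ∂ν ≤ u t := fun t μ =>
    Finset.single_le_sum (f := fun μ => ∫ x, (X x t).1 μ * (X x t).1 μ ∂ν)
      (fun μ _ => integral_nonneg fun x => mul_self_nonneg _) (Finset.mem_univ μ)
  have hu0 : ∀ t, 0 ≤ u t := fun t =>
    Finset.sum_nonneg fun μ _ => integral_nonneg fun x => mul_self_nonneg _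
  -- by Cauchy-Schwarz, the outputs are controlled by the second moments of `z` and `h`
  have hmsq : ∀ t ∈ Icc 0 b, ∀ α, m t α ^ 2 ≤ 2 * C ^ 2 * Z * (1 + u t) := by
    intro t ht α
    rw [hmα t ht α]
    refine (sq_integral_mul_le (hint hzz t ht) (hint (hzq α) t ht) (hint (hqq α) t ht)).trans ?_
    have h1 : ∫ x, φ ((X x t).1 α) * φ ((X x t).1 α) ∂ν ≤ 2 * C ^ 2 * (1 + u t) := by
      calc _ ≤ ∫ x, 2 * C ^ 2 * (1 + (X x t).1 α * (X x t).1 α) ∂ν := by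
            refine integral_mono (hint (hqq α) t ht)
              (((integrable_const 1).add (hint (hhh α) t ht)).const_mul _) fun x => ?_
            have h2 := hφ.bound ((X x t).1 α)
            have h3 := mul_self_le_mul_self (abs_nonneg _) h2
            rw [abs_mul_abs_self] at h3
            have h4 : (1 + |(X x t).1 α|) * (1 + |(X x t).1 α|) ≤
                2 * (1 + (X x t).1 α * (X x t).1 α) := by
              rw [← abs_mul_abs_self ((X x t).1 α)]
              nlinarith [sq_nonneg (1 - |(X x t).1 α|)]
            calc _ ≤ _ := h3
              _ = C ^ 2 * ((1 + |(X x t).1 α|) * (1 + |(X x t).1 α|)) := by ring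
              _ ≤ C ^ 2 * (2 * (1 + (X x t).1 α * (X x t).1 α)) := by gcongr
              _ = _ := by ring
        _ = 2 * C ^ 2 * (1 + ∫ x, (X x t).1 α * (X x t).1 α ∂ν) := by
            rw [integral_const_mul, integral_add (integrable_const 1) (hint (hhh α) t ht)]
            simp
        _ ≤ _ := by
            have := huμ t α
            gcongr
    calc _ ≤ Z * (2 * C ^ 2 * (1 + u t)) :=
          mul_le_mul (hzb t ht) h1 (integral_nonneg fun x => mul_self_nonneg _) hZ0
      _ = _ := by ring
  have hucont : ContinuousOn u (Icc 0 b) := by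
    refine continuousOn_finsetSum _ fun μ _ => ?_
    obtain ⟨L, hL, hLl⟩ := norm_integral_comp_flow_sub_le hF hcmeas hcM hXc hX hν (hhh μ)
    refine (LipschitzOnWith.of_dist_le_mul (K := ⟨L, hL⟩) fun t ht s hs => ?_).continuousOn
    rw [dist_eq_norm, Real.dist_eq]
    exact hLl s hs t ht
  -- the second moments of `h` satisfy a linear integral inequality, as `𝔼[z²]` is bounded
  have hub : ∀ t ∈ Icc 0 b, 1 + u t ≤ (1 + u₀) * Real.exp (k * t) := by
    refine le_mul_exp_of_le_integral hk0 (hucont.const_add 1) fun t ht => ?_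
    have hi : IntervalIntegrable (fun s => 1 + u s) volume 0 t := by
      refine ContinuousOn.intervalIntegrable ?_
      rw [uIcc_of_le ht.1]
      exact (hucont.const_add 1).mono (Icc_subset_Icc_right ht.2)
    rw [add_assoc, hu₀, hk, Finset.sum_mul, ← Finset.sum_add_distrib]
    refine add_le_add_right (Finset.sum_le_sum fun μ _ => ?_) _
    rw [integral_comp_flow_eq_sum hF hcmeas hcM hN hcN hXc hX hν (hhh μ)
      (w := fun α x => 2 * γ₀ * K μ α * (x.1 μ * (deriv φ (x.1 α) * x.2)))
      (fun α => ⟨_, (hhp μ α).const_mul (2 * γ₀ * K μ α)⟩)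
      (fun Y t c h => hasDerivAt_site_fst_sq μ Y t c h) ht]
    refine add_le_add_right ?_ _
    rw [← intervalIntegral.integral_const_mul]
    have hk' : 0 ≤ ∑ α, γ₀ * |K μ α| * k₁ := Finset.sum_nonneg fun α _ => by positivity
    refine intervalIntegral_le_of_le ht.1 (hi.const_mul _)
      (fun s _ => mul_nonneg hk' (by linarith [hu0 s])) fun s hs => ?_
    have hs' : s ∈ Icc 0 b := ⟨hs.1, hs.2.trans ht.2⟩
    rw [Finset.sum_mul]
    refine Finset.sum_le_sum fun α _ => ?_
    rw [integral_const_mul]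
    set I := ∫ x, (X x s).1 μ * (deriv φ ((X x s).1 α) * (X x s).2) ∂ν with hI
    have h1 : I ^ 2 ≤ C ^ 2 * Z * u s := by
      refine (sq_integral_mul_le (hint (hhh μ) s hs') (hint (hhp μ α) s hs')
        (hint (hpp α) s hs')).trans ?_
      have h2 : ∫ x, deriv φ ((X x s).1 α) * (X x s).2 * (deriv φ ((X x s).1 α) * (X x s).2) ∂ν
          ≤ C ^ 2 * Z := by
        calc _ ≤ ∫ x, C ^ 2 * ((X x s).2 * (X x s).2) ∂ν := by
              refine integral_mono (hint (hpp α) s hs') ((hint hzz s hs').const_mul _) fun x => ?_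
              have h3 := mul_self_le_mul_self (abs_nonneg _) (hφ.deriv_bound ((X x s).1 α))
              rw [abs_mul_abs_self] at h3
              have h4 := mul_le_mul_of_nonneg_right h3 (mul_self_nonneg (X x s).2)
              simp only
              linarith
          _ ≤ _ := by
              rw [integral_const_mul]
              exact mul_le_mul_of_nonneg_left (hzb s hs') (by positivity)
      calc _ ≤ u s * (C ^ 2 * Z) :=
            mul_le_mul (huμ s μ) h2 (integral_nonneg fun x => mul_self_nonneg _) (hu0 s)
        _ = _ := by ring
    have h5 : c s α ^ 2 ≤ 2 * y α ^ 2 + 2 * γ₀⁻¹ ^ 2 * (2 * C ^ 2 * Z * (1 + u s)) := by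
      have h6 := (hcabs s α).trans (abs_clip_le_abs hM _)
      have h7 := sq_le_sq.2 h6
      have h8 := mul_le_mul_of_nonneg_left (hmsq s hs' α) (by positivity : 0 ≤ 2 * γ₀⁻¹ ^ 2)
      nlinarith [sq_nonneg (y α + γ₀⁻¹ * m s α)]
    have h9 : c s α ^ 2 + I ^ 2 ≤ k₁ * (1 + u s) := by
      have h10 : y α ^ 2 ≤ ∑ α, y α ^ 2 :=
        Finset.single_le_sum (f := fun α => y α ^ 2) (fun _ _ => sq_nonneg _) (Finset.mem_univ α)
      have h11 : 0 ≤ C ^ 2 * Z := by positivity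
      have h12 := mul_nonneg hy0 (hu0 s)
      rw [hk₁]
      linarith
    have h13 : ∀ p q r : ℝ, |p * (2 * γ₀ * q * r)| = γ₀ * |q| * (2 * |p| * |r|) := by
      intro p q r
      rw [abs_mul, abs_mul, abs_mul, abs_mul, abs_two, abs_of_pos hγ₀]; ring
    calc c s α * (2 * γ₀ * K μ α * I) ≤ |c s α * (2 * γ₀ * K μ α * I)| := le_abs_self _
      _ = γ₀ * |K μ α| * (2 * |c s α| * |I|) := h13 _ _ _
      _ ≤ γ₀ * |K μ α| * (c s α ^ 2 + I ^ 2) := by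
          rw [← sq_abs (c s α), ← sq_abs I]
          gcongr
          exact two_mul_le_add_sq _ _
      _ ≤ γ₀ * |K μ α| * (k₁ * (1 + u s)) := by gcongr
      _ = _ := by ring
  have h1 : 1 + u t₀ ≤ H := by
    refine (hub t₀ ht₀).trans ?_
    have : 0 ≤ u₀ := Finset.sum_nonneg fun μ _ => integral_nonneg fun x => mul_self_nonneg _
    have := ht₀.2.trans (le_abs_self b)
    rw [hH]
    gcongr
  have h2 : m t₀ α₀ ^ 2 ≤ 2 * C ^ 2 * Z * H := (hmsq t₀ ht₀ α₀).trans (by gcongr)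
  rw [← sq_abs] at h2
  nlinarith [sq_nonneg (|m t₀ α₀| - 1)]

/-- Existence of the limit: a flow of the site equation whose residuals are those of its own mean
output. -/
theorem exists_selfConsistent_site (hφ : IsActivation φ C) {γ₀ : ℝ} (hγ₀ : 0 < γ₀)
    (K : Matrix ι ι ℝ) (y : ι → ℝ) {b : ℝ} (hb : 0 ≤ b) {ν : Measure ((ι → ℝ) × ℝ)}
    [IsProbabilityMeasure ν] (hν : HasExpMoments ν) {U : ι → ℝ → ℝ} {N : Set ℝ}
    (hU0 : ∀ α s, 0 ≤ U α s) (hU1 : ∀ α s, U α s ≤ 1)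
    (hUm : ∀ α, Measurable (U α)) (hN : N.Countable)
    (hUN : ∀ α, ∀ s ∉ N, ContinuousAt (U α) s) :
    ∃ (m : ℝ → ι → ℝ) (X : (ι → ℝ) × ℝ → ℝ → (ι → ℝ) × ℝ), Continuous m ∧
      Continuous (Function.uncurry X) ∧
      (∀ x, IsPath (siteField φ γ₀ K) (fun s α => U α s * (y α - γ₀⁻¹ * m s α)) x b (X x)) ∧
      ∀ t ∈ Icc 0 b, m t = ∫ x, outputObs φ (X x t) ∂ν := by
  obtain ⟨A, hF⟩ := hφ.exists_isControlledField γ₀ K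
  obtain ⟨M₀, hM₀⟩ := exists_bound_selfConsistent hφ hγ₀ K y b hν
  have hγi : 0 ≤ γ₀⁻¹ := (inv_pos.2 hγ₀).le
  -- at this level the truncation does not change the residuals of a self-consistent flow
  set M : ℝ := ‖y‖ + γ₀⁻¹ * |M₀|
  have hM : 0 ≤ M := by positivity
  obtain ⟨m, X, hm, hXc, hX, hmX⟩ := hF.exists_selfConsistent_flow hφ.isObservable_output hν
    (κ := fun s v α => U α s * clip M (y α - γ₀⁻¹ * v α)) (M := M) (l := γ₀⁻¹) hb hγi
    (fun m hm => by
      refine (measurable_pi_iff.2 fun α => ?_).aestronglyMeasurable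
      refine (hUm α).mul ((continuous_clip M).comp ?_).measurable
      have : Continuous fun s => m s α := (continuous_apply α).comp hm
      fun_prop)
    (fun s v => (pi_norm_le_iff_of_nonneg hM).2 fun α => by
      rw [Real.norm_eq_abs, abs_mul, abs_of_nonneg (hU0 α s)]
      exact (mul_le_of_le_one_left (abs_nonneg _) (hU1 α s)).trans (abs_clip_le hM _))
    (fun s v w => (pi_norm_le_iff_of_nonneg (by positivity)).2 fun α => by
      rw [Real.norm_eq_abs, Pi.sub_apply, ← mul_sub, abs_mul, abs_of_nonneg (hU0 α s)]
      refine (mul_le_of_le_one_left (abs_nonneg _) (hU1 α s)).trans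
        ((abs_clip_sub_le _ _ _).trans ?_)
      have h1 : |v α - w α| ≤ ‖v - w‖ := norm_le_pi_norm (v - w) α
      rw [sub_sub_sub_cancel_left, ← mul_sub, abs_mul, abs_of_nonneg hγi, abs_sub_comm]
      gcongr)
  refine ⟨m, X, hm, hXc, fun x => (hX x).congr (fun t ht => ?_) fun _ _ => rfl, hmX⟩
  funext α
  have h1 := hM₀ U N M m X hU0 hU1 hUm hN hUN hM hm hXc hX hmX t ht α
  rw [clip_eq]
  refine (abs_sub _ _).trans ?_
  rw [abs_mul, abs_of_nonneg hγi]
  have h2 : |y α| ≤ ‖y‖ := norm_le_pi_norm y α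
  exact add_le_add h2 (mul_le_mul_of_nonneg_left (h1.trans (le_abs_self M₀)) hγi)

/-! ### Coupling of interacting particles with the limiting flow -/

/-- A continuous function that starts below `δ`, and that is at most `δ` as long as it has stayed
below `1`, never exceeds `δ`. -/
theorem le_of_bootstrap {e : ℝ → ℝ} {b δ : ℝ} (he : ContinuousOn e (Icc 0 b)) (hδ : δ < 1)
    (h0 : e 0 ≤ δ) (h : ∀ τ ∈ Icc 0 b, (∀ s ∈ Icc 0 τ, e s ≤ 1) → e τ ≤ δ) :
    ∀ t ∈ Icc 0 b, e t ≤ δ := by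
  intro t₁ ht₁
  by_contra! hlt
  -- the first time at which a level between `δ` and `1` is reached
  set l : ℝ := min 1 (e t₁) with hl
  have hδl : δ < l := lt_min hδ hlt
  have hsub : Icc 0 t₁ ⊆ Icc 0 b := Icc_subset_Icc_right ht₁.2
  have hcl : IsCompact (Icc 0 t₁ ∩ e ⁻¹' Ici l) :=
    isCompact_Icc.of_isClosed_subset
      ((he.mono hsub).preimage_isClosed_of_isClosed isClosed_Icc isClosed_Ici) inter_subset_left
  obtain ⟨t₀, ⟨ht₀, hlt₀⟩, hmin⟩ := hcl.exists_isLeast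
    ⟨t₁, ⟨ht₁.1, le_rfl⟩, mem_preimage.2 (min_le_right 1 (e t₁))⟩
  have hivt := intermediate_value_Icc ht₀.1 (he.mono ((Icc_subset_Icc_right ht₀.2).trans hsub))
  obtain ⟨t', ht', het'⟩ := hivt ⟨h0.trans hδl.le, hlt₀⟩
  have htt : t₀ ≤ t' := hmin ⟨⟨ht'.1, ht'.2.trans ht₀.2⟩, het'.ge⟩
  obtain rfl : t' = t₀ := le_antisymm ht'.2 htt
  have := h t' (hsub ht₀) fun s hs => by
    rcases hs.2.eq_or_lt with rfl | hs2
    · rw [het']; exact min_le_left _ _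
    · by_contra! hgt
      exact absurd (hmin ⟨⟨hs.1, hs.2.trans ht₀.2⟩, (min_le_left _ _).trans hgt.le⟩) (not_le.2 hs2)
  rw [het'] at this
  exact absurd this (not_le.2 hδl)

/-- The empirical mean over `N` particles. -/
noncomputable def average {N : ℕ} {W : Type*} [AddCommGroup W] [Module ℝ W] (u : Fin N → W) : W :=
  (N : ℝ)⁻¹ • ∑ i, u i

section average
variable {N : ℕ} {W : Type*} [NormedAddCommGroup W] [NormedSpace ℝ W]

theorem average_sub (u v : Fin N → W) :
    average u - average v = average fun i => u i - v i := by
  simp only [average, ← smul_sub, Finset.sum_sub_distrib]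

theorem norm_average_le (u : Fin N → W) {v : Fin N → ℝ} (h : ∀ i, ‖u i‖ ≤ v i) :
    ‖average u‖ ≤ average v := by
  rw [average, average, norm_smul, Real.norm_of_nonneg (by positivity), smul_eq_mul]
  exact mul_le_mul_of_nonneg_left ((norm_sum_le _ _).trans (Finset.sum_le_sum fun i _ => h i))
    (by positivity)

theorem average_mul_const (u : Fin N → ℝ) (a : ℝ) :
    average (fun i => u i * a) = average u * a := by
  simp only [average, smul_eq_mul, ← Finset.sum_mul, mul_assoc]

theorem average_const_mul (a : ℝ) (u : Fin N → ℝ) :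
    average (fun i => a * u i) = a * average u := by
  simp_rw [mul_comm a]
  exact average_mul_const u a

theorem average_nonneg {u : Fin N → ℝ} (h : ∀ i, 0 ≤ u i) : 0 ≤ average u := by
  rw [average, smul_eq_mul]
  exact mul_nonneg (by positivity) (Finset.sum_nonneg fun i _ => h i)

theorem average_apply {ι : Type*} (u : Fin N → ι → ℝ) (α : ι) :
    average u α = average fun i => u i α := by
  simp [average]

end average

section coupling
variable {V E : Type*} [NormedAddCommGroup V]
    [NormedSpace ℝ V] [NormedAddCommGroup E] [NormedSpace ℝ E]

/-- Particles `X i` that interact through the empirical mean of `ψ` stay close to the particles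
`Y i` with the same initial values that are driven by `m`, provided that the empirical mean of `ψ`
over the latter is close to `m`. As long as the error is at most `1`, the control of the `X i` is
bounded by `M + l`, and Grönwall's inequality improves the error to `δ < 1`; so it never reaches
`1`. -/
theorem IsControlledField.coupling
    {F : V → E → E} {A : ℝ} (hF : IsControlledField F A) {ψ : E → V} {B : ℝ}
    (hψ : IsObservable ψ B)
    {κ : ℝ → V → V} {M l b : ℝ} (hb : 0 ≤ b) (hl : 0 ≤ l)
    (hκm : ∀ m : ℝ → V, Continuous m → AEStronglyMeasurable fun s => κ s (m s))
    (hκl : ∀ s v w, ‖κ s v - κ s w‖ ≤ l * ‖v - w‖)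
    {m : ℝ → V} (hm : Continuous m) (hκM : ∀ s ∈ Icc 0 b, ‖κ s (m s)‖ ≤ M)
    {N : ℕ} {x : Fin N → E} {X Y : Fin N → ℝ → E} (hXc : ∀ i, Continuous (X i))
    (hX : ∀ i, IsPath F (fun s => κ s (average fun i => ψ (X i s))) (x i) b (X i))
    (hY : ∀ i, IsPath F (fun s => κ s (m s)) (x i) b (Y i)) {η q δ : ℝ}
    (hη : ∀ t ∈ Icc 0 b, ‖(average fun i => ψ (Y i t)) - m t‖ ≤ η)
    (hq : average (fun i => expBound (‖ψ 0‖ + 4 * B + 3 * pathRate A (M + l) b) (x i)) ≤ q)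
    (hδ : η * Real.exp (q * l * b) ≤ δ) (hδ1 : δ < 1) {t : ℝ} (ht : t ∈ Icc 0 b) :
    ‖(average fun i => ψ (X i t)) - m t‖ ≤ δ ∧
      ∀ i, ‖X i t - Y i t‖ ≤ expBound (pathRate A (M + l) b) (x i) * (l * b * δ) ∧
        1 + ‖X i t‖ ≤ expBound (pathRate A (M + l) b) (x i) ∧
        1 + ‖Y i t‖ ≤ expBound (pathRate A (M + l) b) (x i) := by
  have h0 : (0 : ℝ) ∈ Icc 0 b := ⟨le_rfl, hb⟩
  have hM0 : 0 ≤ M := (norm_nonneg _).trans (hκM 0 h0)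
  set mX : ℝ → V := fun s => average fun i => ψ (X i s) with hmX
  have hmXc : Continuous mX :=
    (continuous_finsetSum _ fun i _ => hψ.continuous.comp (hXc i)).const_smul _
  set e : ℝ → ℝ := fun s => ‖mX s - m s‖ with he
  have hec : Continuous e := (hmXc.sub hm).norm
  have hq0 : 0 ≤ q := (average_nonneg fun i => (expBound_pos _ _).le).trans hq
  have hη0 : 0 ≤ η := (norm_nonneg _).trans (hη 0 h0)
  have hηδ : η ≤ δ := le_trans (le_mul_of_one_le_right hη0 (Real.one_le_exp (by positivity))) hδ
  -- comparison of single particles, up to a time until which the error is at most `1`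
  have hdiff : ∀ τ ∈ Icc 0 b, (∀ s ∈ Icc 0 τ, e s ≤ 1) → ∀ t ∈ Icc 0 τ, ∀ i,
      ‖X i t - Y i t‖ ≤ expBound (pathRate A (M + l) b) (x i) * (l * ∫ s in (0 : ℝ)..t, e s) ∧
      1 + ‖X i t‖ ≤ expBound (pathRate A (M + l) b) (x i) ∧
      1 + ‖Y i t‖ ≤ expBound (pathRate A (M + l) b) (x i) := by
    intro τ hτ he1 t ht i
    have hbd : ∀ s ∈ Icc 0 τ, ‖κ s (m s)‖ ≤ M + l := fun s hs =>
      (hκM s ⟨hs.1, hs.2.trans hτ.2⟩).trans (by linarith)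
    have hbdX : ∀ s ∈ Icc 0 τ, ‖κ s (mX s)‖ ≤ M + l := fun s hs => by
      have h1 := hκl s (mX s) (m s)
      have h2 : l * ‖mX s - m s‖ ≤ l * 1 := mul_le_mul_of_nonneg_left (he1 s hs) hl
      have h3 := hκM s ⟨hs.1, hs.2.trans hτ.2⟩
      have h4 : ‖κ s (mX s)‖ ≤ ‖κ s (mX s) - κ s (m s)‖ + ‖κ s (m s)‖ := by
        simpa using norm_add_le (κ s (mX s) - κ s (m s)) (κ s (m s))
      linarith
    refine ⟨?_, ((hX i).mono hτ.2).one_add_norm_le_expBound hF hbdX hτ.2 ht,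
      ((hY i).mono hτ.2).one_add_norm_le_expBound hF hbd hτ.2 ht⟩
    refine (((hX i).mono hτ.2).norm_sub_le_expBound hF (hκm _ hmXc) (hκm _ hm) hbdX hbd hτ.2
      ((hY i).mono hτ.2) ht).trans ?_
    refine mul_le_mul_of_nonneg_left ?_ (expBound_pos _ _).le
    rw [← intervalIntegral.integral_const_mul]
    exact intervalIntegral_le_of_le ht.1 ((hec.const_mul l).intervalIntegrable _ _)
      (fun s _ => mul_nonneg hl (norm_nonneg _)) fun s _ => hκl _ _ _
  have hboot : ∀ τ ∈ Icc 0 b, (∀ s ∈ Icc 0 τ, e s ≤ 1) → e τ ≤ δ := by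
    intro τ hτ he1
    have hgr : ∀ t ∈ Icc 0 τ, e t ≤ η + q * l * ∫ s in (0 : ℝ)..t, e s := by
      intro t ht
      have htb : t ∈ Icc 0 b := ⟨ht.1, ht.2.trans hτ.2⟩
      have hI : 0 ≤ l * ∫ s in (0 : ℝ)..t, e s :=
        mul_nonneg hl (intervalIntegral.integral_nonneg ht.1 fun _ _ => norm_nonneg _)
      have h1 : ‖mX t - average fun i => ψ (Y i t)‖ ≤ q * (l * ∫ s in (0 : ℝ)..t, e s) := by
        rw [hmX, average_sub]
        refine (norm_average_le _ fun i => ?_).trans ((average_mul_const _ _).trans_le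
          (mul_le_mul_of_nonneg_right hq hI))
        obtain ⟨h1, h2, h3⟩ := hdiff τ hτ he1 t ht i
        exact hψ.norm_sub_le h2 h3 h1
      have h2 : e t ≤ ‖mX t - average fun i => ψ (Y i t)‖
          + ‖(average fun i => ψ (Y i t)) - m t‖ := norm_sub_le_norm_sub_add_norm_sub _ _ _
      have h3 := hη t htb
      rw [mul_assoc]
      linarith
    refine (le_mul_exp_of_le_integral (by positivity) hec.continuousOn hgr τ
      ⟨hτ.1, le_rfl⟩).trans (le_trans ?_ hδ)
    have := hτ.2
    gcongr
  have he0 : e 0 ≤ δ := by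
    have h1 : mX 0 = average fun i => ψ (Y i 0) := by
      simp only [hmX, fun i => (hX i).apply_zero hb, fun i => (hY i).apply_zero hb]
    rw [he]
    simp only [h1]
    exact (hη 0 h0).trans hηδ
  have hall := le_of_bootstrap hec.continuousOn hδ1 he0 hboot
  refine ⟨hall t ht, fun i => ?_⟩
  refine (hdiff b ⟨hb, le_rfl⟩ (fun s hs => (hall s hs).trans hδ1.le) t ht i).imp_left
    fun h => h.trans ?_
  refine mul_le_mul_of_nonneg_left ?_ (expBound_pos _ _).le
  rw [mul_assoc]
  refine mul_le_mul_of_nonneg_left ?_ hl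
  have h1 : ∫ s in (0 : ℝ)..t, e s ≤ ∫ s in (0 : ℝ)..t, δ :=
    intervalIntegral_le_of_le ht.1 (by simp) (fun _ _ => hη0.trans hηδ)
      fun s hs => hall s ⟨hs.1, hs.2.trans ht.2⟩
  rw [intervalIntegral.integral_const, smul_eq_mul, sub_zero] at h1
  exact h1.trans (mul_le_mul_of_nonneg_right ht.2 (hη0.trans hηδ))

end coupling

/-! ### Laws of large numbers for triangular arrays -/

section lln
variable {Ω : ℕ → Type*} [∀ N, MeasurableSpace (Ω N)] {P : ∀ N, Measure (Ω N)}

/-- Events whose probabilities tend to zero. -/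
def IsNegligible (P : ∀ N, Measure (Ω N)) (s : ∀ N, Set (Ω N)) : Prop :=
  Tendsto (fun N => P N (s N)) atTop (𝓝 0)

theorem IsNegligible.mono_ae {s t : ∀ N, Set (Ω N)} (hs : IsNegligible P s)
    (h : ∀ N, ∀ᵐ ω ∂(P N), ω ∈ t N → ω ∈ s N) : IsNegligible P t :=
  tendsto_of_tendsto_of_tendsto_of_le_of_le tendsto_const_nhds hs (fun _ => zero_le)
    fun N => measure_mono_ae (h N)

theorem IsNegligible.mono {s t : ∀ N, Set (Ω N)} (hs : IsNegligible P s)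
    (h : ∀ N, t N ⊆ s N) : IsNegligible P t :=
  hs.mono_ae fun N => ae_of_all _ (h N)

theorem IsNegligible.union {s t : ∀ N, Set (Ω N)} (hs : IsNegligible P s) (ht : IsNegligible P t) :
    IsNegligible P fun N => s N ∪ t N := by
  have : Tendsto (fun N => P N (s N) + P N (t N)) atTop (𝓝 0) := by simpa using hs.add ht
  exact tendsto_of_tendsto_of_tendsto_of_le_of_le tendsto_const_nhds this (fun _ => zero_le)
    fun N => measure_union_le _ _

theorem IsNegligible.biUnion_finset {κ : Type*} (I : Finset κ) {s : κ → ∀ N, Set (Ω N)}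
    (hs : ∀ k ∈ I, IsNegligible P (s k)) : IsNegligible P fun N => ⋃ k ∈ I, s k N := by
  have : Tendsto (fun N => ∑ k ∈ I, P N (s k N)) atTop (𝓝 0) := by
    simpa using tendsto_finsetSum I hs
  exact tendsto_of_tendsto_of_tendsto_of_le_of_le tendsto_const_nhds this (fun _ => zero_le)
    fun N => measure_biUnion_finset_le _ _

variable {E : Type*} [NormedAddCommGroup E] [NormedSpace ℝ E] [MeasurableSpace E]

/-- For every `N`, the `N` random variables `x N i` are independent with law `ν`. -/
structure IsIIDArray (P : ∀ N, Measure (Ω N)) (ν : Measure E) (x : ∀ N, Fin N → Ω N → E) :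
    Prop where
  hasLaw : ∀ N i, HasLaw (x N i) ν (P N)
  indep : ∀ N, iIndepFun (x N) (P N)

variable [∀ N, IsProbabilityMeasure (P N)] {ν : Measure E} {x : ∀ N, Fin N → Ω N → E}

/-- The weak law of large numbers, by Chebyshev's inequality. -/
theorem IsIIDArray.average_sub_integral (hx : IsIIDArray P ν x) {G : E → ℝ} (hG : Measurable G)
    (hG2 : MemLp G 2 ν) {ε : ℝ} (hε : 0 < ε) :
    IsNegligible P fun N => {ω | ε ≤ |average (fun i => G (x N i ω)) - ∫ y, G y ∂ν|} := by
  have hbound : ∀ N : ℕ, 0 < N →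
      P N {ω | ε ≤ |average (fun i => G (x N i ω)) - ∫ y, G y ∂ν|} ≤
      ENNReal.ofReal ((N : ℝ)⁻¹ * (Var[G; ν] / ε ^ 2)) := by
    intro N hN
    have hL : ∀ i, MemLp (fun ω => G (x N i ω)) 2 (P N) := fun i =>
      MemLp.comp_of_map (by rw [(hx.hasLaw N i).map_eq]; exact hG2) (hx.hasLaw N i).aemeasurable
    have hint : ∀ i, ∫ ω, G (x N i ω) ∂(P N) = ∫ y, G y ∂ν := fun i =>
      (hx.hasLaw N i).integral_comp hG2.aestronglyMeasurable
    have hN' : (N : ℝ) ≠ 0 := Nat.cast_ne_zero.2 hN.ne'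
    have hav : (fun ω => average (fun i => G (x N i ω)))
        = fun ω => (N : ℝ)⁻¹ * (∑ i, fun ω => G (x N i ω)) ω := by
      funext ω; simp [average]
    have hLa : MemLp (fun ω => average (fun i => G (x N i ω))) 2 (P N) := by
      rw [hav]
      exact (memLp_finsetSum' _ fun i _ => hL i).const_mul _
    have hmean : ∫ ω, average (fun i => G (x N i ω)) ∂(P N) = ∫ y, G y ∂ν := by
      simp only [average, smul_eq_mul]
      rw [integral_const_mul, integral_finsetSum _ fun i _ => (hL i).integrable one_le_two]
      simp only [hint, Finset.sum_const, Finset.card_univ, Fintype.card_fin, nsmul_eq_mul]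
      field_simp
    have hvar : Var[fun ω => average (fun i => G (x N i ω)); P N] = (N : ℝ)⁻¹ * Var[G; ν] := by
      rw [hav, variance_const_mul, IndepFun.variance_sum (fun i _ => hL i)
        fun i _ j _ hij => ((hx.indep N).indepFun hij).comp hG hG]
      have : ∀ i, Var[fun ω => G (x N i ω); P N] = Var[G; ν] := fun i => by
        rw [← (hx.hasLaw N i).map_eq, variance_map
          (by rw [(hx.hasLaw N i).map_eq]; exact hG.aemeasurable) (hx.hasLaw N i).aemeasurable]
        rfl
      simp only [this, Finset.sum_const, Finset.card_univ, Fintype.card_fin, nsmul_eq_mul]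
      field_simp
    have := meas_ge_le_variance_div_sq hLa hε
    rw [hmean, hvar] at this
    rwa [mul_div_assoc] at this
  have hlim : Tendsto (fun N : ℕ => ENNReal.ofReal ((N : ℝ)⁻¹ * (Var[G; ν] / ε ^ 2)))
      atTop (𝓝 0) := by
    have h1 : Tendsto (fun N : ℕ => (N : ℝ)⁻¹ * (Var[G; ν] / ε ^ 2)) atTop (𝓝 0) := by
      simpa using tendsto_inv_atTop_nhds_zero_nat.mul_const (Var[G; ν] / ε ^ 2)
    simpa using ENNReal.tendsto_ofReal h1
  refine tendsto_of_tendsto_of_tendsto_of_le_of_le' tendsto_const_nhds hlim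
    (Eventually.of_forall fun _ => zero_le) ?_
  filter_upwards [eventually_gt_atTop 0] with N hN using hbound N hN

variable [BorelSpace E]

theorem memLp_expBound (hν : HasExpMoments ν) (a : ℝ) : MemLp (expBound a) 2 ν := by
  rw [memLp_two_iff_integrable_sq (hν a).aestronglyMeasurable]
  simp only [expBound_pow]
  exact hν _

/-- Empirical means of `expBound` are bounded with high probability. -/
theorem IsIIDArray.average_expBound (hx : IsIIDArray P ν x) (hν : HasExpMoments ν) (a : ℝ) :
    IsNegligible P fun N => {ω | (∫ y, expBound a y ∂ν) + 1 ≤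
      average (fun i => expBound a (x N i ω))} :=
  (hx.average_sub_integral (continuous_expBound a).measurable (memLp_expBound hν a)
    one_pos).mono fun N ω hω => by
      simp only [mem_ofPred_eq] at hω ⊢
      exact (by linarith : _ ≤ _).trans (le_abs_self _)

variable [IsProbabilityMeasure ν]

/-- The law of large numbers, uniformly in time, for functions that are Lipschitz in time. -/
theorem IsIIDArray.average_sub_integral_uniform (hx : IsIIDArray P ν x) (hν : HasExpMoments ν)
    {G : ℝ → E → ℝ} {a b : ℝ} (hG : ∀ t ∈ Icc 0 b, Measurable (G t))
    (hGa : ∀ t ∈ Icc 0 b, ∀ y, |G t y| ≤ expBound a y)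
    (hGl : ∀ s ∈ Icc 0 b, ∀ t ∈ Icc 0 b, ∀ y, |G t y - G s y| ≤ expBound a y * |t - s|)
    {ε : ℝ} (hε : 0 < ε) :
    IsNegligible P fun N => {ω | ∃ t ∈ Icc 0 b,
      ε ≤ |average (fun i => G t (x N i ω)) - ∫ y, G t y ∂ν|} := by
  set q : ℝ := ∫ y, expBound a y ∂ν with hq
  have hq0 : 0 ≤ q := integral_nonneg fun y => (expBound_pos _ _).le
  set r : ℝ := ε / (4 * (2 * q + 1)) with hr
  have hr0 : 0 < r := by positivity
  obtain ⟨I, hIs, hI⟩ := (isCompact_Icc : IsCompact (Icc 0 b)).finite_cover_balls hr0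
  obtain ⟨hIf, hIc⟩ := hI
  have hL : ∀ t ∈ Icc 0 b, MemLp (G t) 2 ν := fun t ht =>
    (memLp_expBound hν a).mono (hG t ht).aestronglyMeasurable (ae_of_all _ fun y => by
      rw [Real.norm_eq_abs, Real.norm_of_nonneg (expBound_pos _ _).le]; exact hGa t ht y)
  have h1 := IsNegligible.biUnion_finset (P := P) hIf.toFinset (s := fun t N =>
    {ω | ε / 2 ≤ |average (fun i => G t (x N i ω)) - ∫ y, G t y ∂ν|}) fun t ht => by
      have ht' := hIs (hIf.mem_toFinset.1 ht)
      exact hx.average_sub_integral (hG t ht') (hL t ht') (half_pos hε)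
  refine (h1.union (hx.average_expBound hν a)).mono fun N ω hω => ?_
  obtain ⟨t, ht, hεt⟩ := hω
  by_contra hcon
  simp only [mem_union, mem_iUnion, mem_ofPred_eq, not_or, not_exists, not_le,
    Finite.mem_toFinset] at hcon
  obtain ⟨hc1, hc2⟩ := hcon
  obtain ⟨s, hs, hts⟩ := mem_iUnion₂.1 (hIc ht)
  have hs' := hIs hs
  rw [Metric.mem_ball, Real.dist_eq] at hts
  have h2 := hc1 s hs
  have h3 : |average (fun i => G t (x N i ω)) - average (fun i => G s (x N i ω))| ≤
      (q + 1) * |t - s| := by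
    rw [average_sub, ← Real.norm_eq_abs]
    refine (norm_average_le (v := fun i => expBound a (x N i ω) * |t - s|) _ fun i => ?_).trans ?_
    · exact hGl s hs' t ht _
    rw [average_mul_const]
    exact mul_le_mul_of_nonneg_right hc2.le (abs_nonneg _)
  have h4 : |∫ y, G t y ∂ν - ∫ y, G s y ∂ν| ≤ q * |t - s| := by
    rw [← integral_sub ((hL t ht).integrable one_le_two) ((hL s hs').integrable one_le_two),
      hq, ← integral_mul_const, ← Real.norm_eq_abs]
    refine norm_integral_le_of_norm_le ((hν a).mul_const _) (ae_of_all _ fun y => ?_)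
    exact hGl s hs' t ht y
  have h5 : (2 * q + 1) * |t - s| < ε / 2 := by
    calc (2 * q + 1) * |t - s| < (2 * q + 1) * r := by gcongr
      _ = ε / 4 := by rw [hr]; field_simp
      _ < ε / 2 := by linarith
  have h6 : |average (fun i => G t (x N i ω)) - ∫ y, G t y ∂ν| ≤
      |average (fun i => G t (x N i ω)) - average (fun i => G s (x N i ω))|
      + |average (fun i => G s (x N i ω)) - ∫ y, G s y ∂ν|
      + |∫ y, G t y ∂ν - ∫ y, G s y ∂ν| := by
    rw [abs_sub_comm (∫ y, G t y ∂ν)]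
    refine (abs_sub_le _ (average (fun i => G s (x N i ω))) _).trans ?_
    rw [add_assoc]
    exact add_le_add_right (abs_sub_le _ _ _) _
  linarith

end lln

/-! ### Propagation of chaos -/

section chaos
variable {ι : Type*} [Fintype ι] {E : Type*} [NormedAddCommGroup E] [NormedSpace ℝ E]
  [MeasurableSpace E] [BorelSpace E] [SecondCountableTopology E]
  {Ω : ℕ → Type*} [∀ N, MeasurableSpace (Ω N)]

/-- A self-consistent flow `Y` with moments `m t = 𝔼[ψ(Y t)]`, together with, for each `N`, a system
`X N` of `N` particles with independent initial values `x N` of law `ν`, for which the empirical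
mean of `ψ` takes the place of `m`. -/
structure IsMeanFieldSystem (F : (ι → ℝ) → E → E) (ψ : E → ι → ℝ) (κ : ℝ → (ι → ℝ) → ι → ℝ)
    (M l b : ℝ) (ν : Measure E) (m : ℝ → ι → ℝ) (Y : E → ℝ → E) (P : ∀ N, Measure (Ω N))
    (x : ∀ N, Fin N → Ω N → E) (X : ∀ N, Ω N → Fin N → ℝ → E) : Prop where
  horizon_nonneg : 0 ≤ b
  lip_nonneg : 0 ≤ l
  measurable_control : ∀ m : ℝ → ι → ℝ, Continuous m → AEStronglyMeasurable fun s => κ s (m s)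
  lip_control : ∀ s v w, ‖κ s v - κ s w‖ ≤ l * ‖v - w‖
  expMoments : HasExpMoments ν
  continuous_moment : Continuous m
  bound_control : ∀ s ∈ Icc 0 b, ‖κ s (m s)‖ ≤ M
  continuous_flow : Continuous (Function.uncurry Y)
  isPath_flow : ∀ x, IsPath F (fun s => κ s (m s)) x b (Y x)
  moment_eq : ∀ t ∈ Icc 0 b, m t = ∫ x, ψ (Y x t) ∂ν
  isIIDArray : IsIIDArray P ν x
  continuous_particle : ∀ N ω i, Continuous (X N ω i)
  isPath_particle : ∀ N, ∀ᵐ ω ∂(P N), ∀ i,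
    IsPath F (fun s => κ s (average fun i => ψ (X N ω i s))) (x N i ω) b (X N ω i)

variable {F : (ι → ℝ) → E → E} {A : ℝ} {ψ : E → ι → ℝ} {B : ℝ} {κ : ℝ → (ι → ℝ) → ι → ℝ}
  {M l b : ℝ} {ν : Measure E} [IsProbabilityMeasure ν] {m : ℝ → ι → ℝ} {Y : E → ℝ → E}
  {P : ∀ N, Measure (Ω N)} [∀ N, IsProbabilityMeasure (P N)]
  {x : ∀ N, Fin N → Ω N → E} {X : ∀ N, Ω N → Fin N → ℝ → E}

/-- Uniform law of large numbers for an observable along the flow. -/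
theorem IsMeanFieldSystem.average_flow
    (h : IsMeanFieldSystem F ψ κ M l b ν m Y P x X) (hF : IsControlledField F A)
    {G : E → ℝ} {B' : ℝ} (hG : IsObservable G B') {ε : ℝ} (hε : 0 < ε) :
    IsNegligible P fun N => {ω | ∃ t ∈ Icc 0 b,
      ε ≤ |average (fun i => G (Y (x N i ω) t)) - ∫ y, G (Y y t) ∂ν|} := by
  have h0 : (0 : ℝ) ∈ Icc 0 b := ⟨le_rfl, h.horizon_nonneg⟩
  have hM0 : 0 ≤ M := (norm_nonneg _).trans (h.bound_control 0 h0)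
  have ha := pathRate_nonneg hF.nonneg hM0 h.horizon_nonneg
  have hYb : ∀ s ∈ Icc 0 b, ∀ y, 1 + ‖Y y s‖ ≤ expBound (pathRate A M b) y :=
    fun s hs y => (h.isPath_flow y).one_add_norm_le_expBound hF h.bound_control le_rfl hs
  refine h.isIIDArray.average_sub_integral_uniform h.expMoments (G := fun t y => G (Y y t))
    (a := ‖G 0‖ + 4 * B' + 3 * pathRate A M b) (fun t _ => ?_) (fun t ht y => ?_)
    (fun s hs t ht y => ?_) hε
  · exact (hG.continuous.comp
      (h.continuous_flow.comp (by fun_prop : Continuous fun y => (y, t)))).measurable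
  · exact hG.norm_le ha (hYb t ht y)
  · exact hG.norm_sub_le (hYb t ht y) (hYb s hs y)
      ((h.isPath_flow y).norm_sub_time_le_expBound hF
        (h.measurable_control m h.continuous_moment) h.bound_control hs ht)

/-- With high probability, every particle stays close to the flow line of its initial value, and
the empirical mean of `ψ` stays close to its limit. -/
theorem IsMeanFieldSystem.negligible_not_close
    (h : IsMeanFieldSystem F ψ κ M l b ν m Y P x X) (hF : IsControlledField F A)
    (hψ : IsObservable ψ B) (hψα : ∀ α, IsObservable (fun X => ψ X α) B)
    {δ : ℝ} (hδ : 0 < δ) (hδ1 : δ < 1) :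
    IsNegligible P fun N => {ω | ¬ ∀ t ∈ Icc 0 b,
      ‖(average fun i => ψ (X N ω i t)) - m t‖ ≤ δ ∧
      ∀ i, ‖X N ω i t - Y (x N i ω) t‖ ≤
          expBound (pathRate A (M + l) b) (x N i ω) * (l * b * δ) ∧
        1 + ‖X N ω i t‖ ≤ expBound (pathRate A (M + l) b) (x N i ω) ∧
        1 + ‖Y (x N i ω) t‖ ≤ expBound (pathRate A (M + l) b) (x N i ω)} := by
  have h0 : (0 : ℝ) ∈ Icc 0 b := ⟨le_rfl, h.horizon_nonneg⟩
  have hM0 : 0 ≤ M := (norm_nonneg _).trans (h.bound_control 0 h0)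
  have ha := pathRate_nonneg hF.nonneg hM0 h.horizon_nonneg
  have hYb : ∀ s ∈ Icc 0 b, ∀ y, 1 + ‖Y y s‖ ≤ expBound (pathRate A M b) y :=
    fun s hs y => (h.isPath_flow y).one_add_norm_le_expBound hF h.bound_control le_rfl hs
  have hYt : ∀ t, Continuous fun y => Y y t :=
    fun t => h.continuous_flow.comp (by fun_prop : Continuous fun y => (y, t))
  set r : ℝ := ‖ψ 0‖ + 4 * B + 3 * pathRate A (M + l) b
  -- `q` bounds the empirical mean of `expBound r`; `η` is the error in the law of large numbers
  -- that the coupling amplifies to `δ`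
  set q : ℝ := (∫ y, expBound r y ∂ν) + 1
  set η : ℝ := δ * Real.exp (-(q * l * b)) with hη
  have hη0 : 0 < η := by positivity
  have hηδ : η * Real.exp (q * l * b) ≤ δ := by
    rw [hη, mul_assoc, ← Real.exp_add]; simp
  have h1 := IsNegligible.biUnion_finset (P := P) (Finset.univ : Finset ι)
    (s := fun α N => {ω | ∃ t ∈ Icc 0 b,
      η ≤ |average (fun i => ψ (Y (x N i ω) t) α) - ∫ y, ψ (Y y t) α ∂ν|})
    fun α _ => h.average_flow hF (hψα α) hη0
  refine (h1.union (h.isIIDArray.average_expBound h.expMoments r)).mono_ae fun N => ?_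
  filter_upwards [h.isPath_particle N] with ω hω hbad
  by_contra hcon
  simp only [mem_union, mem_iUnion, mem_ofPred_eq, not_or, not_exists, not_le, not_and,
    Finset.mem_univ, forall_true_left] at hcon
  obtain ⟨hc1, hc2⟩ := hcon
  refine hbad fun t ht => ?_
  refine hF.coupling hψ h.horizon_nonneg h.lip_nonneg h.measurable_control h.lip_control
    h.continuous_moment h.bound_control (h.continuous_particle N ω) hω
    (fun i => h.isPath_flow (x N i ω)) (fun t ht => ?_) hc2.le hηδ hδ1 ht
  refine (pi_norm_le_iff_of_nonneg hη0.le).2 fun α => ?_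
  have h2 := (hc1 α t ht).le
  rw [Pi.sub_apply, average_apply, h.moment_eq t ht, eval_integral]
  · exact h2
  · exact fun β => (hψα β).integrable ha h.expMoments (hYt t) (hYb t ht)

/-- The empirical mean of every observable concentrates on its expectation along the flow,
uniformly in time. -/
theorem IsMeanFieldSystem.average_observable
    (h : IsMeanFieldSystem F ψ κ M l b ν m Y P x X) (hF : IsControlledField F A)
    (hψ : IsObservable ψ B) (hψα : ∀ α, IsObservable (fun X => ψ X α) B)
    {G : E → ℝ} {B' : ℝ} (hG : IsObservable G B') {ε : ℝ} (hε : 0 < ε) :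
    IsNegligible P fun N => {ω | ∃ t ∈ Icc 0 b,
      ε ≤ |average (fun i => G (X N ω i t)) - ∫ y, G (Y y t) ∂ν|} := by
  have hb := h.horizon_nonneg
  have hl := h.lip_nonneg
  set r : ℝ := ‖G 0‖ + 4 * B' + 3 * pathRate A (M + l) b
  set q : ℝ := (∫ y, expBound r y ∂ν) + 1
  have hq : 0 < q := by
    have : 0 ≤ ∫ y, expBound r y ∂ν := integral_nonneg fun y => (expBound_pos _ _).le
    positivity
  set δ : ℝ := min (ε / (4 * (q * (l * b + 1)))) (1 / 2)
  have hδ : 0 < δ := by positivity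
  have hδ1 : δ < 1 := (min_le_right _ _).trans_lt (by norm_num)
  have hqδ : q * (l * b * δ) ≤ ε / 4 := by
    have h1 : δ ≤ ε / (4 * (q * (l * b + 1))) := min_le_left _ _
    rw [le_div_iff₀ (by positivity)] at h1
    nlinarith [mul_pos hq hδ]
  refine (((h.negligible_not_close hF hψ hψα hδ hδ1).union
    (h.isIIDArray.average_expBound h.expMoments r)).union
    (h.average_flow hF hG (half_pos hε))).mono fun N ω hω => ?_
  by_contra hcon
  simp only [mem_union, mem_ofPred_eq, not_or, not_exists, not_le, not_and, not_not] at hcon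
  obtain ⟨⟨hc1, hc2⟩, hc3⟩ := hcon
  obtain ⟨t, ht, hεt⟩ := hω
  have h1 := hc3 t ht
  have h2 : |average (fun i => G (X N ω i t)) - average (fun i => G (Y (x N i ω) t))| ≤
      q * (l * b * δ) := by
    rw [average_sub, ← Real.norm_eq_abs]
    refine (norm_average_le (v := fun i => expBound r (x N i ω) * (l * b * δ)) _
      fun i => ?_).trans ?_
    · obtain ⟨h3, h4, h5⟩ := (hc1 t ht).2 i
      exact hG.norm_sub_le h4 h5 h3
    · rw [average_mul_const]
      exact mul_le_mul_of_nonneg_right hc2.le (by positivity)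
  have h3 := abs_sub_le (average (fun i => G (X N ω i t)))
    (average (fun i => G (Y (x N i ω) t))) (∫ y, G (Y y t) ∂ν)
  linarith

/-- A single particle stays close to the flow line of its initial value, with a probability that is
uniform over the particles. -/
theorem IsMeanFieldSystem.eventually_particle
    (h : IsMeanFieldSystem F ψ κ M l b ν m Y P x X) (hF : IsControlledField F A)
    (hψ : IsObservable ψ B) (hψα : ∀ α, IsObservable (fun X => ψ X α) B)
    {ε : ℝ} (hε : 0 < ε) {p : ENNReal} (hp : 0 < p) :
    ∀ᶠ N in atTop, ∀ i, P N {ω | ∃ t ∈ Icc 0 b, ε ≤ ‖X N ω i t - Y (x N i ω) t‖} ≤ p := by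
  have hb := h.horizon_nonneg
  have hl := h.lip_nonneg
  set a := pathRate A (M + l) b
  -- a level that `expBound` exceeds with small probability
  obtain ⟨R, hR0, hR⟩ : ∃ R : ℝ, 0 < R ∧ ν {y | R ≤ expBound a y} ≤ p / 2 := by
    have hanti : Antitone fun n : ℕ => {y : E | (n : ℝ) + 1 ≤ expBound a y} := by
      intro k n hkn y hy
      simp only [mem_ofPred_eq] at hy ⊢
      have : (k : ℝ) ≤ n := Nat.cast_le.2 hkn
      linarith
    have ht := tendsto_measure_iInter_atTop (μ := ν)
      (fun n => (measurableSet_le measurable_const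
        (continuous_expBound a).measurable).nullMeasurableSet) hanti ⟨0, measure_ne_top _ _⟩
    have he : (⋂ n : ℕ, {y : E | (n : ℝ) + 1 ≤ expBound a y}) = ∅ := by
      refine eq_empty_of_forall_notMem fun y hy => ?_
      obtain ⟨n, hn⟩ := exists_nat_gt (expBound a y)
      have := mem_iInter.1 hy n
      simp only [mem_ofPred_eq] at this
      linarith
    rw [he, measure_empty] at ht
    obtain ⟨n, hn⟩ := ((ENNReal.tendsto_nhds_zero.1 ht) (p / 2) (ENNReal.half_pos hp.ne')).exists
    exact ⟨n + 1, by positivity, hn⟩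
  set δ : ℝ := min (ε / (2 * (R * (l * b + 1)))) (1 / 2)
  have hδ : 0 < δ := by positivity
  have hδ1 : δ < 1 := (min_le_right _ _).trans_lt (by norm_num)
  have hRδ : R * (l * b * δ) ≤ ε / 2 := by
    have h1 : δ ≤ ε / (2 * (R * (l * b + 1))) := min_le_left _ _
    rw [le_div_iff₀ (by positivity)] at h1
    nlinarith [mul_pos hR0 hδ]
  filter_upwards [(ENNReal.tendsto_nhds_zero.1 (h.negligible_not_close hF hψ hψα hδ hδ1))
    (p / 2) (ENNReal.half_pos hp.ne')] with N hN i
  have hsub : {ω | ∃ t ∈ Icc 0 b, ε ≤ ‖X N ω i t - Y (x N i ω) t‖} ⊆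
      {ω | ¬ ∀ t ∈ Icc 0 b, ‖(average fun i => ψ (X N ω i t)) - m t‖ ≤ δ ∧
      ∀ i, ‖X N ω i t - Y (x N i ω) t‖ ≤ expBound a (x N i ω) * (l * b * δ) ∧
        1 + ‖X N ω i t‖ ≤ expBound a (x N i ω) ∧ 1 + ‖Y (x N i ω) t‖ ≤ expBound a (x N i ω)} ∪
      {ω | R ≤ expBound a (x N i ω)} := by
    rintro ω ⟨t, ht, hεt⟩
    by_contra hcon
    simp only [mem_union, mem_ofPred_eq, not_or, not_not, not_le] at hcon
    have h1 := ((hcon.1 t ht).2 i).1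
    have h2 : expBound a (x N i ω) * (l * b * δ) ≤ R * (l * b * δ) :=
      mul_le_mul_of_nonneg_right hcon.2.le (by positivity)
    linarith
  refine (measure_mono hsub).trans ((measure_union_le _ _).trans ?_)
  rw [(h.isIIDArray.hasLaw N i).measure_eq (p := fun y => R ≤ expBound a y)
    (measurableSet_le measurable_const (continuous_expBound a).measurable)]
  exact (add_le_add hN hR).trans (ENNReal.add_halves p).le

end chaos

/-! ### Convergence in distribution of random paths -/

section paths
variable {b : ℝ} {E : Type*} [NormedAddCommGroup E] [CompleteSpace E]
  [SecondCountableTopology E] [MeasurableSpace E] [BorelSpace E]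

/-- A random path is measurable as soon as its values at fixed times are, since the evaluation at
a countable dense set of times is an injective continuous map of Polish spaces. -/
theorem aemeasurable_path {Ω : Type*} [MeasurableSpace Ω] {P : Measure Ω}
    {Z : Ω → C(Icc (0 : ℝ) b, E)} (h : ∀ t, AEMeasurable (fun ω => Z ω t) P) :
    AEMeasurable Z P := by
  obtain ⟨s, hs, hd⟩ := TopologicalSpace.exists_countable_dense (Icc (0 : ℝ) b)
  have : Countable s := hs
  have hc : Continuous fun (u : C(Icc (0 : ℝ) b, E)) (t : s) => u t := by fun_prop
  have hinj : Function.Injective fun (u : C(Icc (0 : ℝ) b, E)) (t : s) => u t := by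
    intro u v huv
    refine DFunLike.coe_injective (Continuous.ext_on hd u.continuous v.continuous fun t ht => ?_)
    exact congr_fun huv ⟨t, ht⟩
  have he := hc.measurableEmbedding hinj
  rw [← he.aemeasurable_comp_iff, aemeasurable_pi_iff]
  exact fun t => h t

theorem pathOn_apply {u : ℝ → E} (hu : ContinuousOn u (Icc 0 b)) (t : Icc (0 : ℝ) b) :
    pathOn b u t = u t :=
  ContinuousMap.mkD_apply_of_continuous (continuousOn_iff_continuous_domRestrict.1 hu)

theorem pathOn_congr {u v : ℝ → E} (h : ∀ t ∈ Icc 0 b, u t = v t) : pathOn b u = pathOn b v := by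
  unfold pathOn
  congr 1
  exact funext fun t => h t t.2

theorem norm_pathOn_sub_lt {u v : ℝ → E} (hu : ContinuousOn u (Icc 0 b))
    (hv : ContinuousOn v (Icc 0 b)) {ε : ℝ} (hε : 0 < ε) (h : ∀ t ∈ Icc 0 b, ‖u t - v t‖ < ε) :
    ‖pathOn b u - pathOn b v‖ < ε := by
  rw [ContinuousMap.norm_lt_iff _ hε]
  intro t
  rw [ContinuousMap.sub_apply, pathOn_apply hu, pathOn_apply hv]
  exact h t t.2

/-- The path of a jointly continuous family depends measurably on the parameter. -/
theorem measurable_pathOn_flow {V : Type*} [TopologicalSpace V] [MeasurableSpace V]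
    [BorelSpace V] {Y : V → ℝ → E} (hY : Continuous (Function.uncurry Y)) :
    Measurable fun x => pathOn b (Y x) := by
  have h : Continuous fun p : V × Icc (0 : ℝ) b => Y p.1 p.2 :=
    hY.comp (by fun_prop : Continuous fun p : V × Icc (0 : ℝ) b => (p.1, (p.2 : ℝ)))
  have heq : (fun x => pathOn b (Y x)) = ContinuousMap.curry ⟨_, h⟩ := by
    funext x
    ext t
    have hx : Continuous (Y x) := hY.comp (by fun_prop : Continuous fun t : ℝ => (x, t))
    rw [pathOn_apply hx.continuousOn]
    rfl
  rw [heq]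
  exact (ContinuousMap.curry _).continuous.measurable

theorem aemeasurable_pathOn {Ω : Type*} [MeasurableSpace Ω] {P : Measure Ω} {u : Ω → ℝ → E}
    (hc : ∀ᵐ ω ∂P, ContinuousOn (u ω) (Icc 0 b))
    (hm : ∀ t ∈ Icc 0 b, AEMeasurable (fun ω => u ω t) P) :
    AEMeasurable (fun ω => pathOn b (u ω)) P := by
  refine aemeasurable_path fun t => (hm t t.2).congr ?_
  filter_upwards [hc] with ω hω
  rw [pathOn_apply hω]

end paths

/-- Slutsky's lemma for random variables on varying probability spaces: variables that are close
in probability to variables of a fixed law converge in distribution to that law. -/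
theorem tendstoInDistribution_of_identDistrib_of_sub {E : Type*} [NormedAddCommGroup E]
    [MeasurableSpace E] [BorelSpace E] [SecondCountableTopology E]
    {Ω : ℕ → Type*} [∀ n, MeasurableSpace (Ω n)] {P : ∀ n, Measure (Ω n)}
    [∀ n, IsProbabilityMeasure (P n)] {Ω' : Type*} [MeasurableSpace Ω'] {P' : Measure Ω'}
    [IsProbabilityMeasure P'] {X Y : ∀ n, Ω n → E} {Z : Ω' → E}
    (hY : ∀ n, AEMeasurable (Y n) (P n)) (hX : ∀ n, IdentDistrib (X n) Z (P n) P')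
    (hXY : ∀ ε > 0, Tendsto (fun n => P n {ω | ε ≤ ‖Y n ω - X n ω‖}) atTop (𝓝 0)) :
    TendstoInDistribution Y atTop Z P P' := by
  -- all variables are moved to the product of the probability spaces
  set Q := Measure.infinitePi P
  have hev : ∀ n, MeasurePreserving (fun ω : ∀ n, Ω n => ω n) Q (P n) :=
    fun n => measurePreserving_eval_infinitePi P n
  have hmap : ∀ n, ∀ W : Ω n → E, AEMeasurable W (P n) →
      Q.map (fun ω => W (ω n)) = (P n).map W := by
    intro n W hW
    rw [← (hev n).map_eq] at hW ⊢
    exact (AEMeasurable.map_map_of_aemeasurable hW (hev n).measurable.aemeasurable).symm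
  have hY' : ∀ n, AEMeasurable (fun ω => Y n (ω n)) Q :=
    fun n => (hY n).comp_quasiMeasurePreserving (hev n).quasiMeasurePreserving
  have hX' : ∀ n, AEMeasurable (fun ω => X n (ω n)) Q :=
    fun n => (hX n).aemeasurable_fst.comp_quasiMeasurePreserving (hev n).quasiMeasurePreserving
  have hXZ : TendstoInDistribution (fun n ω => X n (ω n)) atTop Z (fun _ => Q) P' := by
    refine ⟨hX', (hX 0).aemeasurable_snd, ?_⟩
    refine tendsto_const_nhds.congr fun n => ?_
    refine Subtype.ext ?_
    change P'.map Z = Q.map (fun ω => X n (ω n))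
    rw [hmap n _ (hX n).aemeasurable_fst, (hX n).map_eq]
  have h := tendstoInDistribution_of_tendstoInMeasure_sub
    (fun n (ω : ∀ n, Ω n) => Y n (ω n)) Z hXZ ?_ hY'
  · refine ⟨hY, h.aemeasurable_limit, h.tendsto.congr fun n => Subtype.ext ?_⟩
    exact hmap n _ (hY n)
  · rw [tendstoInMeasure_iff_norm]
    intro ε hε
    refine (hXY ε hε).congr fun n => ?_
    have hs : NullMeasurableSet {ω | ε ≤ ‖Y n ω - X n ω‖} (P n) :=
      nullMeasurableSet_le aemeasurable_const ((hY n).sub (hX n).aemeasurable_fst).norm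
    rw [← (hev n).measure_preimage hs]
    simp

section neurons
variable {ι : Type*} [Fintype ι] {E : Type*} [NormedAddCommGroup E] [NormedSpace ℝ E]
  [CompleteSpace E] [MeasurableSpace E] [BorelSpace E] [SecondCountableTopology E]
  {Ω : ℕ → Type*} [∀ N, MeasurableSpace (Ω N)]
  {F : (ι → ℝ) → E → E} {A : ℝ} {ψ : E → ι → ℝ} {B : ℝ} {κ : ℝ → (ι → ℝ) → ι → ℝ}
  {M l b : ℝ} {ν : Measure E} [IsProbabilityMeasure ν] {m : ℝ → ι → ℝ} {Y : E → ℝ → E}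
  {P : ∀ N, Measure (Ω N)} [∀ N, IsProbabilityMeasure (P N)]
  {x : ∀ N, Fin N → Ω N → E} {X : ∀ N, Ω N → Fin N → ℝ → E}

/-- Distinct members of an i.i.d. array have the law of independent copies. -/
theorem IsIIDArray.identDistrib (hx : IsIIDArray P ν x) {Ω' : Type*} [MeasurableSpace Ω']
    {P' : Measure Ω'} [IsProbabilityMeasure P'] {x₀ : Ω' → E} (hx₀ : HasLaw x₀ ν P')
    {k N : ℕ} (e : Fin k ↪ Fin N) :
    IdentDistrib (fun ω i => x N (e i) ω) (fun (ω : Fin k → Ω') i => x₀ (ω i)) (P N)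
      (Measure.pi fun _ => P') := by
  have h1 : ∀ i, AEMeasurable (x N (e i)) (P N) := fun i => (hx.hasLaw N _).aemeasurable
  have h2 : ∀ i : Fin k, AEMeasurable (fun ω : Fin k → Ω' => x₀ (ω i))
      (Measure.pi fun _ => P') := fun i =>
    hx₀.aemeasurable.comp_quasiMeasurePreserving
      (measurePreserving_eval (fun _ : Fin k => P') i).quasiMeasurePreserving
  refine ⟨aemeasurable_pi_iff.2 h1, aemeasurable_pi_iff.2 h2, ?_⟩
  rw [(iIndepFun_iff_map_fun_eq_pi_map h1).1 ((hx.indep N).precomp e.injective),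
    Measure.pi_map_pi fun _ => hx₀.aemeasurable, hx₀.map_eq]
  simp_rw [(hx.hasLaw N _).map_eq]

/-- The trajectories of `k` distinct particles converge in distribution to those of `k`
independent points moving along the self-consistent flow. -/
theorem IsMeanFieldSystem.tendstoInDistribution
    (h : IsMeanFieldSystem F ψ κ M l b ν m Y P x X) (hF : IsControlledField F A)
    (hψ : IsObservable ψ B) (hψα : ∀ α, IsObservable (fun X => ψ X α) B)
    (hX : ∀ N i, ∀ t ∈ Icc 0 b, AEMeasurable (fun ω => X N ω i t) (P N))
    {Ω' : Type*} [MeasurableSpace Ω'] {P' : Measure Ω'} [IsProbabilityMeasure P'] {x₀ : Ω' → E}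
    (hx₀ : HasLaw x₀ ν P') (k : ℕ) (e : ∀ n, Fin k ↪ Fin (k + n)) :
    TendstoInDistribution
      (fun n (ω : Ω (k + n)) => pathOn b (fun t (i : Fin k) => X (k + n) ω (e n i) t)) atTop
      (fun ω : Fin k → Ω' => pathOn b (fun t (i : Fin k) => Y (x₀ (ω i)) t))
      (fun n => P (k + n)) (Measure.pi fun _ : Fin k => P') := by
  have hYc : ∀ y, Continuous (Y y) := fun y =>
    h.continuous_flow.comp (by fun_prop : Continuous fun t : ℝ => (y, t))
  have hY : Continuous (Function.uncurry fun (v : Fin k → E) t (i : Fin k) => Y (v i) t) :=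
    continuous_pi fun i => h.continuous_flow.comp
      (by fun_prop : Continuous fun p : (Fin k → E) × ℝ => (p.1 i, p.2))
  refine tendstoInDistribution_of_identDistrib_of_sub
    (X := fun n ω => pathOn b fun t (i : Fin k) => Y (x (k + n) (e n i) ω) t)
    (fun n => ?_) (fun n => ?_) fun ε hε => ?_
  · refine aemeasurable_pathOn (ae_of_all _ fun ω => ?_) fun t ht => ?_
    · exact (continuous_pi fun i => h.continuous_particle _ _ _).continuousOn
    · exact aemeasurable_pi_iff.2 fun i => hX _ _ t ht
  · exact (h.isIIDArray.identDistrib hx₀ (e n)).comp (measurable_pathOn_flow hY)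
  · have hsum : ∀ n, P (k + n) {ω | ε ≤ ‖pathOn b (fun t (i : Fin k) => X (k + n) ω (e n i) t) -
        pathOn b fun t (i : Fin k) => Y (x (k + n) (e n i) ω) t‖} ≤
        ∑ i : Fin k, P (k + n) {ω | ∃ t ∈ Icc 0 b,
          ε ≤ ‖X (k + n) ω (e n i) t - Y (x (k + n) (e n i) ω) t‖} := by
      intro n
      refine (measure_mono fun ω hω => ?_).trans (measure_biUnion_finset_le _ _)
      by_contra hcon
      simp only [mem_iUnion, mem_ofPred_eq, Finset.mem_univ, exists_true_left, not_exists,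
        not_and, not_le] at hcon
      refine absurd hω (not_le.2 (norm_pathOn_sub_lt ?_ ?_ hε fun t ht => ?_))
      · exact (continuous_pi fun i => h.continuous_particle _ _ _).continuousOn
      · exact (continuous_pi fun i => hYc _).continuousOn
      · exact (pi_norm_lt_iff hε).2 fun i => hcon i t ht
    refine ENNReal.tendsto_nhds_zero.2 fun p hp => ?_
    have hp' : 0 < p / (k + 1) := by
      refine ENNReal.div_pos hp.ne' ?_
      finiteness
    filter_upwards [(tendsto_atTop_mono (fun n => Nat.le_add_left n k) tendsto_id).eventually
      (h.eventually_particle hF hψ hψα hε hp')] with n hn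
    refine (hsum n).trans ((Finset.sum_le_sum fun i _ => hn (e n i)).trans ?_)
    rw [Finset.sum_const, Finset.card_univ, Fintype.card_fin, nsmul_eq_mul, ← mul_div_assoc]
    refine ENNReal.div_le_of_le_mul ?_
    rw [mul_comm]
    gcongr
    exact le_self_add

end neurons

/-! ### Training windows -/

section network
variable {T D : ℕ} (S : TaskSequence T D)

theorem heaviside_nonneg (t : ℝ) : 0 ≤ heaviside t := by unfold heaviside; split_ifs <;> simp

theorem heaviside_le_one (t : ℝ) : heaviside t ≤ 1 := by unfold heaviside; split_ifs <;> simp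

theorem measurable_heaviside : Measurable heaviside :=
  Measurable.ite measurableSet_Ioi measurable_const measurable_const

theorem continuousAt_heaviside {t : ℝ} (ht : t ≠ 0) : ContinuousAt heaviside t := by
  rcases ht.lt_or_gt with h | h
  · refine continuousAt_const.congr (f := fun _ => 0) ?_
    filter_upwards [Iio_mem_nhds h] with s hs
    simp [heaviside, (mem_Iio.1 hs).le]
  · refine continuousAt_const.congr (f := fun _ => 1) ?_
    filter_upwards [Ioi_mem_nhds h] with s hs
    simp [heaviside, mem_Ioi.1 hs]

theorem window_nonneg (j : Fin T) (t : ℝ) : 0 ≤ S.window j t :=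
  mul_nonneg (heaviside_nonneg _) (heaviside_nonneg _)

theorem window_le_one (j : Fin T) (t : ℝ) : S.window j t ≤ 1 :=
  mul_le_one₀ (heaviside_le_one _) (heaviside_nonneg _) (heaviside_le_one _)

theorem measurable_window (j : Fin T) : Measurable (S.window j) :=
  (measurable_heaviside.comp (measurable_id.sub_const _)).mul
    (measurable_heaviside.comp (measurable_const.sub measurable_id))

theorem continuousAt_window (j : Fin T) {t : ℝ} (ht : t ∉ range S.time) :
    ContinuousAt (S.window j) t := by
  have h : ∀ i, t - S.time i ≠ 0 := fun i h => ht ⟨i, (sub_eq_zero.1 h).symm⟩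
  refine ContinuousAt.mul ?_ ?_
  · exact ContinuousAt.comp (g := heaviside) (continuousAt_heaviside (h _)) (by fun_prop)
  · refine ContinuousAt.comp (g := heaviside) (continuousAt_heaviside fun h' => h j.succ ?_)
      (by fun_prop)
    linarith

theorem window_eq_ite {j : Fin T} {t : ℝ} (ht : t ∈ Ioo (S.time j.castSucc) (S.time j.succ))
    (i : Fin T) : S.window i t = if i = j then 1 else 0 := by
  unfold TaskSequence.window heaviside
  rcases lt_trichotomy i j with h | h | h
  · have h1 : S.time i.succ ≤ S.time j.castSucc := S.time_mono (Fin.succ_le_castSucc_iff.2 h)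
    rw [if_neg (c := 0 < S.time i.succ - t) (by linarith [ht.1]), if_neg h.ne, mul_zero]
  · subst h
    simp [ht.1, ht.2]
  · have h1 : S.time j.succ ≤ S.time i.castSucc := S.time_mono (Fin.succ_le_castSucc_iff.2 h)
    rw [if_neg (c := 0 < t - S.time i.castSucc) (by linarith [ht.2]), if_neg h.ne', zero_mul]

/-- Apart from the finitely many boundary times, every time lies in one of the windows. -/
theorem exists_mem_window {t : ℝ} (ht : t ∈ Ioo 0 S.horizon) (htr : t ∉ range S.time) :
    ∃ j : Fin T, t ∈ Ioo (S.time j.castSucc) (S.time j.succ) := by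
  by_contra! hcon
  have h : ∀ i, S.time i < t := by
    intro i
    induction i using Fin.induction with
    | zero => rw [S.time_zero]; exact ht.1
    | succ j hj =>
      have h1 : ¬ t < S.time j.succ := fun h => hcon j ⟨hj, h⟩
      exact lt_of_le_of_ne (not_lt.1 h1) fun h => htr ⟨_, h⟩
  exact (h (Fin.last T)).not_gt ht.2

theorem horizon_nonneg : 0 ≤ S.horizon := by
  rw [← S.time_zero]
  exact S.time_mono (Fin.zero_le _)

/-! ### Gradient flow as a system of interacting neurons -/

/-- The residual-weighted control that drives the neurons: the window of the task of sample `α`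
times the residual of the output `γ₀⁻¹ v α`. -/
noncomputable def trainingControl (γ₀ s : ℝ) (v : S.Sample → ℝ) (α : S.Sample) : ℝ :=
  S.window α.1 s * (S.label α - γ₀⁻¹ * v α)

/-- The fields of neuron `i`: its preactivations on all samples and its pre-gradient. -/
noncomputable def neuronState {N : ℕ} (θ : Param N D) (i : Fin N) : (S.Sample → ℝ) × ℝ :=
  (fun μ => preact θ (S.input μ) i, preGrad θ i)

variable {N : ℕ} {φ : ℝ → ℝ} {γ₀ : ℝ}

theorem output_eq_sum (θ : Param N D) (x : EuclideanSpace ℝ (Fin D)) :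
    output φ γ₀ θ x = (γ₀ * N)⁻¹ * ∑ i, θ (Sum.inr i) * φ (preact θ x i) := by
  have h : √(N : ℝ) * √(N : ℝ) = N := Real.mul_self_sqrt (Nat.cast_nonneg N)
  unfold output readout
  rw [mul_comm, mul_div_assoc, one_div, div_eq_mul_inv, ← mul_inv, mul_left_comm, h, mul_comm]

theorem output_eq_average (θ : Param N D) (μ : S.Sample) :
    output φ γ₀ θ (S.input μ) = γ₀⁻¹ * average (fun i => outputObs φ (neuronState S θ i) μ) := by
  rw [output_eq_sum, mul_inv, mul_assoc]
  rfl

theorem featureKernel_eq_average (θ : Param N D) (μ ν : S.Sample) :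
    featureKernel φ θ (S.input μ) (S.input ν) =
      average fun i => φ ((neuronState S θ i).1 μ) * φ ((neuronState S θ i).1 ν) := by
  rw [featureKernel, average, one_div]
  rfl

theorem gradNeuron_eq (hφ : Differentiable ℝ φ) (θ : Param N D) (x : EuclideanSpace ℝ (Fin D))
    (i : Fin N) : gradNeuron φ θ x i = deriv φ (preact θ x i) * θ (Sum.inr i) := by
  -- there is a neuron, so `N` is not zero
  have hN : 0 < √(N : ℝ) := Real.sqrt_pos.2 (Nat.cast_pos.2 i.pos)
  have h : HasDerivAt (fun u => readout φ θ (Function.update (preact θ x) i u))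
      ((1 / √(N : ℝ)) * ∑ k, if k = i then θ (Sum.inr i) * deriv φ (preact θ x i) else 0)
      (preact θ x i) := by
    refine HasDerivAt.const_mul _ (HasDerivAt.fun_sum fun k _ => ?_)
    split_ifs with hk
    · subst hk
      simpa using (hφ _).hasDerivAt.const_mul (θ (Sum.inr k))
    · simp only [Function.update_of_ne hk]
      exact hasDerivAt_const _ _
  rw [gradNeuron, h.deriv, Finset.sum_ite_eq' Finset.univ i, if_pos (Finset.mem_univ i)]
  field_simp

theorem gradientKernel_eq_average (hφ : Differentiable ℝ φ) (θ : Param N D) (μ ν : S.Sample) :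
    gradientKernel φ θ (S.input μ) (S.input ν) =
      average fun i => deriv φ ((neuronState S θ i).1 μ) * (neuronState S θ i).2 *
        (deriv φ ((neuronState S θ i).1 ν) * (neuronState S θ i).2) := by
  rw [gradientKernel, average, one_div]
  simp_rw [gradNeuron_eq hφ]
  rfl

/-- The linear functional `θ ↦ h_i(x)`. -/
noncomputable def preactCLM (x : EuclideanSpace ℝ (Fin D)) (i : Fin N) : Param N D →L[ℝ] ℝ :=
  (1 / √(D : ℝ)) • ∑ d, x d • EuclideanSpace.proj (Sum.inl (i, d))

theorem preactCLM_apply (x : EuclideanSpace ℝ (Fin D)) (i : Fin N) (θ : Param N D) :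
    preactCLM x i θ = preact θ x i := by
  simp [preactCLM, preact, mul_comm]

theorem hasFDerivAt_preact (x : EuclideanSpace ℝ (Fin D)) (i : Fin N) (θ : Param N D) :
    HasFDerivAt (fun θ => preact θ x i) (preactCLM x i) θ := by
  simp_rw [← preactCLM_apply]
  exact (preactCLM x i).hasFDerivAt

theorem continuous_preact (x : EuclideanSpace ℝ (Fin D)) (i : Fin N) :
    Continuous fun θ : Param N D => preact θ x i := by
  simp_rw [← preactCLM_apply]
  exact (preactCLM x i).continuous

theorem continuous_neuronState (i : Fin N) : Continuous fun θ : Param N D => neuronState S θ i :=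
  (continuous_pi fun _ => continuous_preact _ _).prodMk
    (EuclideanSpace.proj (Sum.inr i) : Param N D →L[ℝ] ℝ).continuous

theorem hasFDerivAt_output (hφ : Differentiable ℝ φ) (θ : Param N D)
    (x : EuclideanSpace ℝ (Fin D)) :
    HasFDerivAt (fun θ => output φ γ₀ θ x)
      ((γ₀ * N)⁻¹ • ∑ i, (θ (Sum.inr i) • deriv φ (preact θ x i) • preactCLM x i +
        φ (preact θ x i) • EuclideanSpace.proj (Sum.inr i))) θ := by
  simp_rw [output_eq_sum]
  refine (HasFDerivAt.fun_sum fun i _ => ?_).const_mul _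
  refine HasFDerivAt.mul ?_ ?_
  · exact (EuclideanSpace.proj (Sum.inr i) : Param N D →L[ℝ] ℝ).hasFDerivAt
  · exact (hφ _).hasDerivAt.comp_hasFDerivAt θ (hasFDerivAt_preact x i θ)

/-- The directional derivatives of the loss of a task. -/
theorem inner_gradient_taskLoss (hφ : Differentiable ℝ φ) (j : Fin T) (θ v : Param N D) :
    inner ℝ (gradient (taskLoss S φ γ₀ j) θ) v =
      -∑ a : Fin (S.size j), (S.label ⟨j, a⟩ - output φ γ₀ θ (S.input ⟨j, a⟩)) * ((γ₀ * N)⁻¹ *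
        ∑ i, (θ (Sum.inr i) * (deriv φ (preact θ (S.input ⟨j, a⟩) i) *
          preact v (S.input ⟨j, a⟩) i) + φ (preact θ (S.input ⟨j, a⟩) i) * v (Sum.inr i))) := by
  have h : HasFDerivAt (taskLoss S φ γ₀ j) (∑ a : Fin (S.size j), (1 / 2 : ℝ) •
      ((2 * (S.label ⟨j, a⟩ - output φ γ₀ θ (S.input ⟨j, a⟩)) ^ (2 - 1)) •
        -((γ₀ * N)⁻¹ • ∑ i, (θ (Sum.inr i) • deriv φ (preact θ (S.input ⟨j, a⟩) i) •
          preactCLM (S.input ⟨j, a⟩) i +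
          φ (preact θ (S.input ⟨j, a⟩) i) • EuclideanSpace.proj (Sum.inr i))))) θ := by
    unfold taskLoss
    refine HasFDerivAt.fun_sum fun a _ => HasFDerivAt.const_mul ?_ _
    have := ((hasFDerivAt_output (γ₀ := γ₀) hφ θ (S.input ⟨j, a⟩)).const_sub
      (S.label ⟨j, a⟩)).pow 2
    simpa using this
  rw [← InnerProductSpace.toDual_apply_apply, toDual_gradient, h.fderiv,
    sum_apply, ← Finset.sum_neg_distrib]
  refine Finset.sum_congr rfl fun a _ => ?_
  simp only [smul_apply, neg_apply, sum_apply, add_apply, smul_eq_mul, preactCLM_apply,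
    PiLp.proj_apply]
  ring

theorem gradient_taskLoss_inr (hφ : Differentiable ℝ φ) (j : Fin T) (θ : Param N D) (k : Fin N) :
    gradient (taskLoss S φ γ₀ j) θ (Sum.inr k) =
      -∑ a : Fin (S.size j), (S.label ⟨j, a⟩ - output φ γ₀ θ (S.input ⟨j, a⟩)) *
        ((γ₀ * N)⁻¹ * φ (preact θ (S.input ⟨j, a⟩) k)) := by
  have h := inner_gradient_taskLoss S (γ₀ := γ₀) hφ j θ (EuclideanSpace.single (Sum.inr k) 1)
  rw [EuclideanSpace.inner_single_right] at h
  simpa [preact, Pi.single_apply] using h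

theorem gradient_taskLoss_inl (hφ : Differentiable ℝ φ) (j : Fin T) (θ : Param N D) (k : Fin N)
    (d : Fin D) :
    gradient (taskLoss S φ γ₀ j) θ (Sum.inl (k, d)) =
      -∑ a : Fin (S.size j), (S.label ⟨j, a⟩ - output φ γ₀ θ (S.input ⟨j, a⟩)) *
        ((γ₀ * N)⁻¹ * (θ (Sum.inr k) * (deriv φ (preact θ (S.input ⟨j, a⟩) k) *
          ((1 / √(D : ℝ)) * S.input ⟨j, a⟩ d)))) := by
  have h := inner_gradient_taskLoss S (γ₀ := γ₀) hφ j θ (EuclideanSpace.single (Sum.inl (k, d)) 1)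
  rw [EuclideanSpace.inner_single_right] at h
  have hp : ∀ x : EuclideanSpace ℝ (Fin D), ∀ i : Fin N,
      preact (EuclideanSpace.single (Sum.inl (k, d)) 1) x i =
        if i = k then (1 / √(D : ℝ)) * x d else 0 := by
    intro x i
    by_cases hi : i = k
    · subst hi
      simp [preact]
    · simp [preact, hi]
  simpa [hp] using h

theorem sum_window {j : Fin T} {t : ℝ} (ht : t ∈ Ioo (S.time j.castSucc) (S.time j.succ))
    (u : S.Sample → ℝ) : ∑ α, S.window α.1 t * u α = ∑ a, u ⟨j, a⟩ := by
  rw [Fintype.sum_sigma, Finset.sum_eq_single j]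
  · simp [window_eq_ite S ht]
  · intro i _ hi
    simp [window_eq_ite S ht, hi]
  · simp

theorem inputKernel_eq_sum (μ ν : S.Sample) :
    S.inputKernel μ ν =
      ∑ d, (1 / √(D : ℝ)) * S.input ν d * ((1 / √(D : ℝ)) * S.input μ d) := by
  have h : (1 / √(D : ℝ)) * (1 / √(D : ℝ)) = 1 / D := by
    rw [div_mul_div_comm, one_mul, Real.mul_self_sqrt (Nat.cast_nonneg D)]
  have h2 : ∀ d, (1 / √(D : ℝ)) * S.input ν d * ((1 / √(D : ℝ)) * S.input μ d) =
      1 / D * (S.input ν d * S.input μ d) := fun d => by rw [← h]; ring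
  rw [Finset.sum_congr rfl fun d _ => h2 d, ← Finset.mul_sum, TaskSequence.inputKernel,
    PiLp.inner_apply, div_eq_mul_inv, mul_comm, one_div]
  simp

/-- During training, the neurons interact only through the outputs of the network: each of them
follows the single-site vector field with the residuals of the network as control. -/
theorem IsSequentialGradientFlow.hasDerivAt_neuronState (hφ : Differentiable ℝ φ) (hγ₀ : γ₀ ≠ 0)
    {θ : ℝ → Param N D} (hθ : IsSequentialGradientFlow S φ γ₀ θ) {j : Fin T} {t : ℝ}
    (ht : t ∈ Ioo (S.time j.castSucc) (S.time j.succ)) (k : Fin N) :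
    HasDerivAt (fun t => neuronState S (θ t) k)
      (siteField φ γ₀ S.inputKernel (trainingControl S γ₀ t
        (average fun i => outputObs φ (neuronState S (θ t) i))) (neuronState S (θ t) k)) t := by
  have hN : (N : ℝ) ≠ 0 := Nat.cast_ne_zero.2 k.pos.ne'
  have hc : ∀ p, HasDerivAt (fun t => θ t p)
      (-(γ₀ ^ 2 * N * gradient (taskLoss S φ γ₀ j) (θ t) p)) t := fun p =>
    ((EuclideanSpace.proj p : Param N D →L[ℝ] ℝ).hasFDerivAt.comp_hasDerivAt t
      (hθ.hasDerivAt j t ht))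
  -- the control consists of the residuals of the network
  have hr : ∀ α, trainingControl S γ₀ t (average fun i => outputObs φ (neuronState S (θ t) i)) α =
      S.window α.1 t * (S.label α - output φ γ₀ (θ t) (S.input α)) := fun α => by
    rw [output_eq_average, ← average_apply]
    rfl
  refine HasDerivAt.prodMk (hasDerivAt_pi.2 fun μ => ?_) ?_
  · refine ((HasDerivAt.fun_sum (u := Finset.univ) fun d _ =>
      (hc (Sum.inl (k, d))).mul_const (S.input μ d)).const_mul (1 / √(D : ℝ))).congr_deriv ?_
    simp_rw [hr, mul_assoc, sum_window S ht, gradient_taskLoss_inl S hφ, inputKernel_eq_sum,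
      Finset.mul_sum, ← Finset.sum_neg_distrib, Finset.mul_sum, ← Finset.sum_neg_distrib,
      Finset.sum_mul, Finset.mul_sum]
    rw [Finset.sum_comm]
    refine Finset.sum_congr rfl fun a _ => Finset.sum_congr rfl fun d _ => ?_
    simp only [neuronState, preGrad]
    field_simp
  · refine (hc (Sum.inr k)).congr_deriv ?_
    simp_rw [hr, mul_assoc, sum_window S ht, gradient_taskLoss_inr S hφ, Finset.mul_sum,
      ← Finset.sum_neg_distrib, Finset.mul_sum, ← Finset.sum_neg_distrib]
    refine Finset.sum_congr rfl fun a _ => ?_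
    simp only [neuronState]
    field_simp

theorem trainingControl_lip (hγ₀ : 0 ≤ γ₀) (s : ℝ) (v w : S.Sample → ℝ) :
    ‖trainingControl S γ₀ s v - trainingControl S γ₀ s w‖ ≤ γ₀⁻¹ * ‖v - w‖ := by
  refine (pi_norm_le_iff_of_nonneg (by positivity)).2 fun α => ?_
  have h : (trainingControl S γ₀ s v - trainingControl S γ₀ s w) α =
      S.window α.1 s * (γ₀⁻¹ * (w α - v α)) := by
    simp only [Pi.sub_apply, trainingControl]
    ring
  rw [h, norm_mul, norm_mul, Real.norm_of_nonneg (window_nonneg _ _ _),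
    Real.norm_of_nonneg (inv_nonneg.2 hγ₀), norm_sub_rev]
  have h1 : ‖v α - w α‖ ≤ ‖v - w‖ := norm_le_pi_norm (v - w) α
  have h2 : γ₀⁻¹ * ‖v α - w α‖ ≤ γ₀⁻¹ * ‖v - w‖ := by gcongr
  exact (mul_le_of_le_one_left (by positivity) (window_le_one _ _ _)).trans h2

theorem measurable_trainingControl (γ₀ : ℝ) {m : ℝ → S.Sample → ℝ} (hm : Measurable m) :
    Measurable fun s => trainingControl S γ₀ s (m s) :=
  measurable_pi_iff.2 fun α => (measurable_window S α.1).mul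
    ((((measurable_pi_apply α).comp hm).const_mul _).const_sub _)

theorem continuousAt_trainingControl (γ₀ : ℝ) {m : ℝ → S.Sample → ℝ} {t : ℝ}
    (hm : ContinuousAt m t) (ht : t ∉ range S.time) :
    ContinuousAt (fun s => trainingControl S γ₀ s (m s)) t :=
  continuousAt_pi.2 fun α => (continuousAt_window S α.1 ht).mul
    ((((continuous_apply α).continuousAt.comp hm).const_mul _).const_sub _)

theorem exists_bound_trainingControl (γ₀ : ℝ) {m : ℝ → S.Sample → ℝ} (b : ℝ)
    (hm : ContinuousOn m (Icc 0 b)) :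
    ∃ M, ∀ s ∈ Icc 0 b, ‖trainingControl S γ₀ s (m s)‖ ≤ M := by
  have h : ContinuousOn (fun s α => S.label α - γ₀⁻¹ * m s α) (Icc 0 b) :=
    continuousOn_pi.2 fun α =>
      continuousOn_const.sub (continuousOn_const.mul (continuousOn_pi.1 hm α))
  obtain ⟨M, hM⟩ := isCompact_Icc.exists_bound_of_continuousOn h
  refine ⟨M, fun s hs => ?_⟩
  refine (pi_norm_le_iff_of_nonneg ((norm_nonneg _).trans (hM s hs))).2 fun α => ?_
  refine le_trans ?_ ((norm_le_pi_norm _ α).trans (hM s hs))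
  rw [trainingControl, norm_mul, Real.norm_of_nonneg (window_nonneg _ _ _)]
  exact mul_le_of_le_one_left (norm_nonneg _) (window_le_one _ _ _)

/-- The neurons of a trained network solve the single-site equation in integral form. -/
theorem IsSequentialGradientFlow.isPath_neuronState {C : ℝ} (hφ : IsActivation φ C)
    (hγ₀ : γ₀ ≠ 0) {θ : ℝ → Param N D} (hθ : IsSequentialGradientFlow S φ γ₀ θ) (k : Fin N) :
    IsPath (siteField φ γ₀ S.inputKernel) (fun s => trainingControl S γ₀ s
      (average fun i => outputObs φ (neuronState S (θ s) i))) (neuronState S (θ 0) k) S.horizon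
      (fun t => neuronState S (θ t) k) := by
  obtain ⟨A, hF⟩ := hφ.exists_isControlledField γ₀ S.inputKernel
  have hb := horizon_nonneg S
  -- the trajectory is extended continuously to the whole line
  set η : ℝ → Param N D := IccExtend hb ((Icc 0 S.horizon).domRestrict θ) with hη
  have hηc : Continuous η := (continuousOn_iff_continuous_domRestrict.1 hθ.continuousOn).Icc_extend'
  have hηθ : ∀ t ∈ Icc 0 S.horizon, η t = θ t := fun t ht => IccExtend_of_mem _ _ ht
  have hX : ∀ i, Continuous fun t => neuronState S (η t) i :=
    fun i => (continuous_neuronState S i).comp hηc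
  set m : ℝ → S.Sample → ℝ := fun s => average fun i => outputObs φ (neuronState S (η s) i)
  have hm : Continuous m := by
    have h : ∀ i, Continuous fun s => outputObs φ (neuronState S (η s) i) :=
      fun i => hφ.isObservable_output.continuous.comp (hX i)
    have h' := continuous_finsetSum Finset.univ fun i _ => h i
    exact h'.const_smul ((N : ℝ)⁻¹)
  obtain ⟨M, hM⟩ := exists_bound_trainingControl S γ₀ S.horizon hm.continuousOn
  have hcm := (measurable_trainingControl S γ₀ hm.measurable).aestronglyMeasurable
    (μ := volume)
  refine IsPath.congr (c := fun s => trainingControl S γ₀ s (m s))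
    (X := fun t => neuronState S (η t) k) ⟨(hX k).continuousOn, fun t ht => ?_⟩
    (fun t ht => by simp only [m, hηθ t ht]) fun t ht => by rw [hηθ t ht]
  have h0 : (0 : ℝ) ∈ Icc 0 S.horizon := ⟨le_rfl, hb⟩
  rw [integral_eq_of_hasDerivAt_off_countable_of_le (fun t => neuronState S (η t) k) _ ht.1
    (countable_range S.time) (hX k).continuousOn (fun s hs => ?_)
    (hF.intervalIntegrable hcm hM (hX k).continuousOn h0 ht), hηθ 0 h0]
  · abel
  · have hs' : s ∈ Ioo 0 S.horizon := ⟨hs.1.1, hs.1.2.trans_le ht.2⟩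
    obtain ⟨j, hj⟩ := exists_mem_window S hs' hs.2
    have heq : (fun t => neuronState S (η t) k) =ᶠ[𝓝 s] fun t => neuronState S (θ t) k := by
      filter_upwards [Icc_mem_nhds hs'.1 hs'.2] with t ht
      rw [hηθ t ht]
    have h1 := (hθ.hasDerivAt_neuronState S hφ.differentiable hγ₀ hj k).congr_of_eventuallyEq heq
    simpa only [m, hηθ s (Ioo_subset_Icc_self hs')] using h1

end network

/-! ### Gaussian initial fields -/

section gaussian

/-- Gaussian measures have exponential moments, by Fernique's theorem. -/
theorem hasExpMoments_of_isGaussian {E : Type*} [NormedAddCommGroup E] [NormedSpace ℝ E]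
    [MeasurableSpace E] [BorelSpace E] [SecondCountableTopology E] [CompleteSpace E]
    (ν : Measure E) [IsGaussian ν] : HasExpMoments ν := by
  intro a
  obtain ⟨c, hc, hint⟩ := IsGaussian.exists_integrable_exp_sq ν
  refine (hint.const_mul (Real.exp (a + a ^ 2 / (4 * c)))).mono'
    (continuous_expBound a).aestronglyMeasurable (ae_of_all _ fun x => ?_)
  rw [Real.norm_of_nonneg (expBound_pos _ _).le, expBound, ← Real.exp_add]
  refine Real.exp_le_exp.2 ?_
  have h : a * ‖x‖ ≤ a ^ 2 / (4 * c) + c * ‖x‖ ^ 2 := by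
    have h1 : a ^ 2 / (4 * c) + c * ‖x‖ ^ 2 - a * ‖x‖ = (a - 2 * c * ‖x‖) ^ 2 / (4 * c) := by
      field_simp
      ring
    have h2 : 0 ≤ (a - 2 * c * ‖x‖) ^ 2 / (4 * c) := by positivity
    linarith
  linarith

variable {Ω : Type*} [MeasurableSpace Ω] {P : Measure Ω} [IsProbabilityMeasure P]
  {p : Type*} [Fintype p] {g : p → Ω → ℝ}

theorem memLp_two_of_gaussian (hg : ∀ i, HasLaw (g i) (gaussianReal 0 1) P) (i : p) :
    MemLp (g i) 2 P := (hg i).hasGaussianLaw.memLp_two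

theorem integral_sum_gaussian (hg : ∀ i, HasLaw (g i) (gaussianReal 0 1) P) (a : p → ℝ) :
    ∫ ω, ∑ i, a i * g i ω ∂P = 0 := by
  rw [integral_finsetSum _ fun i _ => ((memLp_two_of_gaussian hg i).integrable
    one_le_two).const_mul _]
  refine Finset.sum_eq_zero fun i _ => ?_
  rw [integral_const_mul, (hg i).integral_eq, integral_id_gaussianReal, mul_zero]

theorem covariance_sum_gaussian (hg : ∀ i, HasLaw (g i) (gaussianReal 0 1) P)
    (hi : iIndepFun g P) (a b : p → ℝ) :
    cov[fun ω => ∑ i, a i * g i ω, fun ω => ∑ i, b i * g i ω; P] = ∑ i, a i * b i := by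
  classical
  have h2 := memLp_two_of_gaussian hg
  have hc : ∀ i j, cov[g i, g j; P] = if i = j then 1 else 0 := by
    intro i j
    split_ifs with hij
    · subst hij
      rw [covariance_self (hg i).aemeasurable, (hg i).variance_eq, variance_id_gaussianReal]
      simp
    · exact (hi.indepFun hij).covariance_eq_zero (h2 i) (h2 j)
  rw [covariance_fun_sum_fun_sum (fun i => (h2 i).const_mul _) fun i => (h2 i).const_mul _]
  simp_rw [covariance_const_mul_left, covariance_const_mul_right, hc]
  simp

/-- Linear combinations of independent Gaussian variables are jointly Gaussian. -/
theorem hasGaussianLaw_sum_gaussian (hg : ∀ i, HasLaw (g i) (gaussianReal 0 1) P)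
    (hi : iIndepFun g P) {κ : Type*} [Fintype κ] (a : κ → p → ℝ) :
    HasGaussianLaw (fun ω k => ∑ i, a k i * g i ω) P := by
  let L : (p → ℝ) →L[ℝ] (κ → ℝ) :=
    ContinuousLinearMap.pi fun k => ∑ i, a k i • ContinuousLinearMap.proj i
  have h := (hi.hasGaussianLaw fun i => (hg i).hasGaussianLaw).map_fun L
  refine h.congr (ae_of_all _ fun ω => ?_)
  funext k
  simp [L]

theorem posSemidef_of_sum_mul {ι : Type*} [Fintype ι] {B : ι → p → ℝ} {K : Matrix ι ι ℝ}
    (hK : ∀ μ ν, ∑ i, B μ i * B ν i = K μ ν) : K.PosSemidef := by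
  have h : K = Matrix.of B * (Matrix.of B).conjTranspose := by
    ext μ ν
    simp [Matrix.mul_apply, ← hK]
  rw [h]
  exact Matrix.posSemidef_self_mul_conjTranspose _

/-- Linear combinations of independent standard Gaussian variables are a Gaussian vector whose
covariance is the Gram matrix of the coefficients. -/
theorem hasLaw_multivariateGaussian (hg : ∀ i, HasLaw (g i) (gaussianReal 0 1) P)
    (hi : iIndepFun g P) {ι : Type*} [Fintype ι] [DecidableEq ι] {B : ι → p → ℝ}
    {K : Matrix ι ι ℝ} (hK : ∀ μ ν, ∑ i, B μ i * B ν i = K μ ν) :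
    HasLaw (fun ω => WithLp.toLp 2 fun μ => ∑ i, B μ i * g i ω) (multivariateGaussian 0 K) P := by
  have hG := (hasGaussianLaw_sum_gaussian hg hi B).toLp_pi 2
  have := hG.isGaussian_map
  refine ⟨hG.aemeasurable, Measure.ext_of_charFun (funext fun t => ?_)⟩
  have hin : ∀ ω, inner ℝ t (WithLp.toLp 2 fun μ => ∑ i, B μ i * g i ω) =
      ∑ i, (∑ μ, t μ * B μ i) * g i ω := by
    intro ω
    simp_rw [PiLp.inner_apply, Finset.sum_mul]
    rw [Finset.sum_comm]
    refine Finset.sum_congr rfl fun μ _ => ?_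
    simp only [RCLike.inner_apply, conj_trivial, Finset.sum_mul]
    exact Finset.sum_congr rfl fun i _ => by ring
  have hmeas : AEMeasurable (fun ω => ∑ i, (∑ μ, t μ * B μ i) * g i ω) P :=
    Finset.aemeasurable_fun_sum _ fun i _ => (hg i).aemeasurable.const_mul _
  rw [hG.charFun_map_eq, charFun_multivariateGaussian (posSemidef_of_sum_mul hK)]
  simp_rw [hin]
  rw [integral_sum_gaussian hg, ← covariance_self hmeas, covariance_sum_gaussian hg hi]
  have hq : ∑ i, (∑ μ, t μ * B μ i) * (∑ μ, t μ * B μ i) =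
      dotProduct t.ofLp (K.mulVec t.ofLp) := by
    simp only [dotProduct, Matrix.mulVec, ← hK, Finset.mul_sum, Finset.sum_mul]
    rw [Finset.sum_comm]
    simp_rw [Finset.sum_comm (s := (Finset.univ : Finset p))]
    refine Finset.sum_congr rfl fun i _ => Finset.sum_congr rfl fun j _ =>
      Finset.sum_congr rfl fun k _ => ?_
    ring
  rw [hq]
  simp

/-- The law of the initial fields of a single site: `χ ∼ 𝒩(0, K)` and an independent standard
Gaussian variable. -/
noncomputable def siteLaw {ι : Type*} [Fintype ι] [DecidableEq ι] (K : Matrix ι ι ℝ) :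
    Measure ((ι → ℝ) × ℝ) :=
  ((multivariateGaussian 0 K).map (fun v => (v.ofLp : ι → ℝ))).prod (gaussianReal 0 1)

section siteLaw
variable {ι : Type*} [Fintype ι] [DecidableEq ι] (K : Matrix ι ι ℝ)

theorem isGaussian_map_ofLp :
    IsGaussian ((multivariateGaussian 0 K).map (fun v => (v.ofLp : ι → ℝ))) :=
  (IsGaussian.hasGaussianLaw_id.map_fun
    (PiLp.continuousLinearEquiv 2 ℝ fun _ : ι => ℝ).toContinuousLinearMap).isGaussian_map

instance isGaussian_siteLaw : IsGaussian (siteLaw K) := by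
  have := isGaussian_map_ofLp K
  unfold siteLaw
  infer_instance

/-- The expected output vanishes initially, since `ξ` is centered and independent of `χ`. -/
theorem integral_outputObs_siteLaw (φ : ℝ → ℝ) (μ : ι) :
    ∫ X, outputObs φ X μ ∂(siteLaw K) = 0 := by
  have := isGaussian_map_ofLp K
  refine (integral_congr_ae (ae_of_all _ fun X : (ι → ℝ) × ℝ =>
    mul_comm X.2 (φ (X.1 μ)))).trans ?_
  rw [siteLaw, integral_prod_mul (fun v : ι → ℝ => φ (v μ)) (fun z : ℝ => z), integral_id_gaussianReal,
    mul_zero]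

/-- A pair of independent variables `χ ∼ 𝒩(0, K)`, `ξ ∼ 𝒩(0, 1)` has law `siteLaw K`. -/
theorem hasLaw_siteLaw {χ : Ω → EuclideanSpace ℝ ι} {ξ : Ω → ℝ}
    (hχ : HasLaw χ (multivariateGaussian 0 K) P) (hξ : HasLaw ξ (gaussianReal 0 1) P)
    (h : IndepFun χ ξ P) : HasLaw (fun ω => ((χ ω).ofLp, ξ ω)) (siteLaw K) P := by
  have hm : Measurable fun v : EuclideanSpace ℝ ι => (v.ofLp : ι → ℝ) := by fun_prop
  refine IndepFun.hasLaw_prod ?_ hξ (h.comp hm measurable_id)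
  exact HasLaw.comp ⟨hm.aemeasurable, rfl⟩ hχ

end siteLaw

end gaussian

section init
variable {T D : ℕ} (S : TaskSequence T D) {N : ℕ}

/-- The coefficients of the fields of neuron `i` (`some μ`: the preactivation on `x_μ`, `none`: the
pre-gradient) as linear combinations of the weights. -/
noncomputable def fieldCoeff (i : Fin N) : Option S.Sample → (Fin N × Fin D) ⊕ Fin N → ℝ
  | some μ, Sum.inl (k, d) => if k = i then (1 / √(D : ℝ)) * S.input μ d else 0
  | some _, Sum.inr _ => 0
  | none, Sum.inl _ => 0
  | none, Sum.inr k => if k = i then 1 else 0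

theorem sum_fieldCoeff_mul (θ : Param N D) (i : Fin N) :
    ((fun μ => ∑ p, fieldCoeff S i (some μ) p * θ p), ∑ p, fieldCoeff S i none p * θ p) =
      neuronState S θ i := by
  refine Prod.ext (funext fun μ => ?_) ?_
  · simp [fieldCoeff, neuronState, preact, Fintype.sum_prod_type, Finset.mul_sum, mul_comm,
      mul_left_comm]
  · simp [fieldCoeff, neuronState, preGrad]

theorem sum_fieldCoeff_of_ne {i j : Fin N} (hij : i ≠ j) (k l : Option S.Sample) :
    ∑ p, fieldCoeff S i k p * fieldCoeff S j l p = 0 := by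
  refine Finset.sum_eq_zero fun p _ => ?_
  rcases k with _ | k <;> rcases l with _ | l <;> rcases p with ⟨q, d⟩ | q <;>
    simp only [fieldCoeff, mul_zero, zero_mul]
  all_goals
    split_ifs with h1 h2
    · exact absurd (h1.symm.trans h2) hij
    all_goals simp

theorem sum_fieldCoeff_some (i : Fin N) (μ ν : S.Sample) :
    ∑ p, fieldCoeff S i (some μ) p * fieldCoeff S i (some ν) p = S.inputKernel μ ν := by
  rw [inputKernel_eq_sum]
  simp [fieldCoeff, Fintype.sum_prod_type]
  exact Finset.sum_congr rfl fun d _ => by ring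

theorem sum_fieldCoeff_none (i : Fin N) (μ : S.Sample) :
    ∑ p, fieldCoeff S i (some μ) p * fieldCoeff S i none p = 0 := by
  refine Finset.sum_eq_zero fun p _ => ?_
  rcases p with ⟨q, d⟩ | q <;> simp [fieldCoeff]

/-- At initialization the fields of each neuron have the law of the initial fields of a single
site. -/
theorem IsStandardInit.hasLaw_neuronState {Ω : Type*} [MeasurableSpace Ω] {P : Measure Ω}
    [IsProbabilityMeasure P] {θ₀ : Ω → Param N D} (h : IsStandardInit P θ₀) (i : Fin N) :
    HasLaw (fun ω => neuronState S (θ₀ ω) i) (siteLaw S.inputKernel) P := by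
  simp_rw [← sum_fieldCoeff_mul]
  have hχ := hasLaw_multivariateGaussian h.hasLaw h.indep (sum_fieldCoeff_some S i)
  have hw : ∀ ω, ∑ p, fieldCoeff S i none p * θ₀ ω p = θ₀ ω (Sum.inr i) := by
    simp [fieldCoeff]
  refine hasLaw_siteLaw S.inputKernel hχ ?_ ?_
  · simp_rw [hw]
    exact h.hasLaw _
  · have hG : HasGaussianLaw (fun ω => ((fun μ => ∑ p, fieldCoeff S i (some μ) p * θ₀ ω p),
        fun _ : Unit => ∑ p, fieldCoeff S i none p * θ₀ ω p)) P := by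
      have h1 := hasGaussianLaw_sum_gaussian h.hasLaw h.indep (fieldCoeff S i)
      exact h1.map_fun ((ContinuousLinearMap.pi fun μ =>
        ContinuousLinearMap.proj (some μ) : (Option S.Sample → ℝ) →L[ℝ] (S.Sample → ℝ)).prod
          (ContinuousLinearMap.pi fun _ : Unit => ContinuousLinearMap.proj none))
    have hind := hG.indepFun_of_covariance_eval (X := fun μ ω =>
      ∑ p, fieldCoeff S i (some μ) p * θ₀ ω p) (Y := fun _ ω =>
      ∑ p, fieldCoeff S i none p * θ₀ ω p) fun μ _ => by
        rw [covariance_sum_gaussian h.hasLaw h.indep, sum_fieldCoeff_none]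
    exact hind.comp (φ := fun v => WithLp.toLp 2 v) (ψ := fun v : Unit → ℝ => v ())
      (by fun_prop) (by fun_prop)

/-- At initialization the fields of different neurons are independent: they are jointly Gaussian and
uncorrelated. -/
theorem IsStandardInit.iIndepFun_neuronState {Ω : Type*} [MeasurableSpace Ω] {P : Measure Ω}
    [IsProbabilityMeasure P] {θ₀ : Ω → Param N D} (h : IsStandardInit P θ₀) :
    iIndepFun (fun i ω => neuronState S (θ₀ ω) i) P := by
  have hG : HasGaussianLaw (fun ω i k => ∑ p, fieldCoeff S (N := N) i k p * θ₀ ω p) P := by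
    have h1 := hasGaussianLaw_sum_gaussian h.hasLaw h.indep
      fun q : Fin N × Option S.Sample => fieldCoeff S q.1 q.2
    let L : (Fin N × Option S.Sample → ℝ) →L[ℝ] (Fin N → Option S.Sample → ℝ) :=
      ContinuousLinearMap.pi fun i => ContinuousLinearMap.pi fun k =>
        ContinuousLinearMap.proj (i, k)
    exact h1.map_fun L
  have hind := hG.iIndepFun_of_covariance_eval
    (X := fun i k ω => ∑ p, fieldCoeff S i k p * θ₀ ω p) fun i j hij k l => by
      rw [covariance_sum_gaussian h.hasLaw h.indep, sum_fieldCoeff_of_ne S hij]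
  simp_rw [← sum_fieldCoeff_mul]
  exact hind.comp (fun _ v => ((fun μ => v (some μ)), v none)) fun _ => by fun_prop

end init

/-! ### The single-site system -/

section site
variable {T D : ℕ} (S : TaskSequence T D) {φ : ℝ → ℝ} {γ₀ C : ℝ}

theorem sum_trainingControl_mul (γ₀ s : ℝ) (v u : S.Sample → ℝ) :
    ∑ α, trainingControl S γ₀ s v α * u α =
      ∑ j, S.window j s * ∑ a, (S.label ⟨j, a⟩ - γ₀⁻¹ * v ⟨j, a⟩) * u ⟨j, a⟩ := by
  simp only [Fintype.sum_sigma, trainingControl, Finset.mul_sum, mul_assoc]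

/-- A flow of the single-site vector field that is driven by the residuals of the outputs
`γ₀⁻¹ m`. -/
structure IsSiteFlow (φ : ℝ → ℝ) (γ₀ : ℝ) (m : ℝ → S.Sample → ℝ)
    (Y : (S.Sample → ℝ) × ℝ → ℝ → (S.Sample → ℝ) × ℝ) : Prop where
  continuous_moment : Continuous m
  continuous_flow : Continuous (Function.uncurry Y)
  isPath : ∀ x, IsPath (siteField φ γ₀ S.inputKernel) (fun s => trainingControl S γ₀ s (m s)) x
    S.horizon (Y x)

variable {m : ℝ → S.Sample → ℝ} {Y : (S.Sample → ℝ) × ℝ → ℝ → (S.Sample → ℝ) × ℝ}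

theorem aestronglyMeasurable_trainingControl (γ₀ : ℝ) (hm : Continuous m) :
    AEStronglyMeasurable fun s => trainingControl S γ₀ s (m s) :=
  (measurable_trainingControl S γ₀ hm.measurable).aestronglyMeasurable

theorem integral_siteField {K : Matrix S.Sample S.Sample ℝ} {c : ℝ → S.Sample → ℝ}
    {X : ℝ → (S.Sample → ℝ) × ℝ} {t : ℝ}
    (h : IntervalIntegrable (fun s => siteField φ γ₀ K (c s) (X s)) volume 0 t) :
    ∫ s in (0 : ℝ)..t, siteField φ γ₀ K (c s) (X s) =
      (fun μ => γ₀ * ∫ s in (0 : ℝ)..t, ∑ α, c s α *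
          (deriv φ ((X s).1 α) * (X s).2 * K μ α),
        γ₀ * ∫ s in (0 : ℝ)..t, ∑ α, c s α * φ ((X s).1 α)) := by
  refine Prod.ext (funext fun μ => ?_) ?_
  · have h1 := ((ContinuousLinearMap.proj μ : (S.Sample → ℝ) →L[ℝ] ℝ).comp
      (ContinuousLinearMap.fst ℝ (S.Sample → ℝ) ℝ)).intervalIntegral_comp_comm h
    have h2 : (∫ s in (0 : ℝ)..t, siteField φ γ₀ K (c s) (X s)).1 μ =
        ∫ s in (0 : ℝ)..t, (siteField φ γ₀ K (c s) (X s)).1 μ := h1.symm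
    rw [h2]
    simp only [siteField, mul_assoc, intervalIntegral.integral_const_mul]
  · have h1 := (ContinuousLinearMap.snd ℝ (S.Sample → ℝ) ℝ).intervalIntegral_comp_comm h
    rw [← intervalIntegral.integral_const_mul]
    exact h1.symm

/-- The single-site equations say that the process is a path of the single-site vector field. -/
theorem isPath_siteField_iff (hφ : IsActivation φ C) (hm : Continuous m) {f : S.Sample → ℝ → ℝ}
    (hf : ∀ t ∈ Icc 0 S.horizon, ∀ α, γ₀⁻¹ * m t α = f α t) {x : (S.Sample → ℝ) × ℝ}
    {X : ℝ → (S.Sample → ℝ) × ℝ} (hX : ContinuousOn X (Icc 0 S.horizon)) :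
    IsPath (siteField φ γ₀ S.inputKernel) (fun s => trainingControl S γ₀ s (m s)) x S.horizon X ↔
      (∀ μ, ∀ t ∈ Icc 0 S.horizon, (X t).1 μ = x.1 μ + γ₀ * ∫ s in (0 : ℝ)..t,
        ∑ j, S.window j s * ∑ a : Fin (S.size j), (S.label ⟨j, a⟩ - f ⟨j, a⟩ s) *
          (deriv φ ((X s).1 ⟨j, a⟩) * (X s).2) * S.inputKernel μ ⟨j, a⟩) ∧
      ∀ t ∈ Icc 0 S.horizon, (X t).2 = x.2 + γ₀ * ∫ s in (0 : ℝ)..t,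
        ∑ j, S.window j s * ∑ a : Fin (S.size j), (S.label ⟨j, a⟩ - f ⟨j, a⟩ s) *
          φ ((X s).1 ⟨j, a⟩) := by
  obtain ⟨A, hF⟩ := hφ.exists_isControlledField γ₀ S.inputKernel
  obtain ⟨M, hM⟩ := exists_bound_trainingControl S γ₀ S.horizon hm.continuousOn
  have h0 : (0 : ℝ) ∈ Icc 0 S.horizon := ⟨le_rfl, horizon_nonneg S⟩
  have hint : ∀ t ∈ Icc 0 S.horizon, IntervalIntegrable (fun s => siteField φ γ₀ S.inputKernel
      (trainingControl S γ₀ s (m s)) (X s)) volume 0 t := fun t ht =>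
    hF.intervalIntegrable (aestronglyMeasurable_trainingControl S γ₀ hm) hM hX h0 ht
  -- the control is expressed through `f`
  have hcongr : ∀ t ∈ Icc 0 S.horizon, ∀ u : S.Sample → ℝ → ℝ,
      ∫ s in (0 : ℝ)..t, ∑ α, trainingControl S γ₀ s (m s) α * u α s =
      ∫ s in (0 : ℝ)..t, ∑ j, S.window j s * ∑ a : Fin (S.size j),
        (S.label ⟨j, a⟩ - f ⟨j, a⟩ s) * u ⟨j, a⟩ s := by
    intro t ht u
    refine intervalIntegral.integral_congr fun s hs => ?_
    rw [uIcc_of_le ht.1] at hs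
    simp only [sum_trainingControl_mul S γ₀ s (m s) fun α => u α s,
      hf s ⟨hs.1, hs.2.trans ht.2⟩]
  have key : ∀ t ∈ Icc 0 S.horizon, x + ∫ s in (0 : ℝ)..t, siteField φ γ₀ S.inputKernel
      (trainingControl S γ₀ s (m s)) (X s) =
      (fun μ => x.1 μ + γ₀ * ∫ s in (0 : ℝ)..t,
        ∑ j, S.window j s * ∑ a : Fin (S.size j), (S.label ⟨j, a⟩ - f ⟨j, a⟩ s) *
          (deriv φ ((X s).1 ⟨j, a⟩) * (X s).2) * S.inputKernel μ ⟨j, a⟩,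
      x.2 + γ₀ * ∫ s in (0 : ℝ)..t,
        ∑ j, S.window j s * ∑ a : Fin (S.size j), (S.label ⟨j, a⟩ - f ⟨j, a⟩ s) *
          φ ((X s).1 ⟨j, a⟩)) := by
    intro t ht
    rw [integral_siteField S (hint t ht)]
    refine Prod.ext (funext fun μ => ?_) ?_
    · simp only [Prod.fst_add, Pi.add_apply]
      rw [hcongr t ht fun α s => deriv φ ((X s).1 α) * (X s).2 * S.inputKernel μ α]
      simp only [mul_assoc]
    · simp only [Prod.snd_add]
      rw [hcongr t ht fun α s => φ ((X s).1 α)]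
  constructor
  · intro h
    refine ⟨fun μ t ht => ?_, fun t ht => ?_⟩
    · exact congr_fun (congr_arg Prod.fst ((h.eq t ht).trans (key t ht))) μ
    · exact congr_arg Prod.snd ((h.eq t ht).trans (key t ht))
  · rintro ⟨h1, h2⟩
    refine ⟨hX, fun t ht => ?_⟩
    rw [key t ht]
    exact Prod.ext (funext fun μ => h1 μ t ht) (h2 t ht)

theorem IsSiteFlow.integrable (hY : IsSiteFlow S φ γ₀ m Y) (hφ : IsActivation φ C) {W : Type*}
    [NormedAddCommGroup W] [SecondCountableTopology W]
    {G : (S.Sample → ℝ) × ℝ → W} {B : ℝ} (hG : IsObservable G B) {t : ℝ}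
    (ht : t ∈ Icc 0 S.horizon) :
    Integrable (fun x => G (Y x t)) (siteLaw S.inputKernel) := by
  obtain ⟨A, hF⟩ := hφ.exists_isControlledField γ₀ S.inputKernel
  obtain ⟨M, hM⟩ := exists_bound_trainingControl S γ₀ S.horizon hY.continuous_moment.continuousOn
  have hM0 : 0 ≤ M := (norm_nonneg _).trans (hM t ht)
  refine hG.integrable (pathRate_nonneg hF.nonneg hM0 (horizon_nonneg S))
    (hasExpMoments_of_isGaussian _)
    (hY.continuous_flow.comp (by fun_prop : Continuous fun x => (x, t))) fun x => ?_
  exact (hY.isPath x).one_add_norm_le_expBound hF hM le_rfl ht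

/-- The expected output evolves with the tangent kernel `Φ + G K`: the time derivative of `z φ(h_μ)`
along the flow is a combination of feature and gradient observables, and the expected output
vanishes initially. -/
theorem IsSiteFlow.integral_output (hY : IsSiteFlow S φ γ₀ m Y) (hφ : IsActivation φ C)
    (hγ₀ : γ₀ ≠ 0) (μ : S.Sample) {t : ℝ} (ht : t ∈ Icc 0 S.horizon) :
    γ₀⁻¹ * ∫ x, outputObs φ (Y x t) μ ∂(siteLaw S.inputKernel) =
      ∫ s in (0 : ℝ)..t, ∑ j, S.window j s * ∑ a : Fin (S.size j),
        ((∫ x, φ ((Y x s).1 μ) * φ ((Y x s).1 ⟨j, a⟩) ∂(siteLaw S.inputKernel)) +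
          (∫ x, deriv φ ((Y x s).1 μ) * (Y x s).2 *
            (deriv φ ((Y x s).1 ⟨j, a⟩) * (Y x s).2) ∂(siteLaw S.inputKernel)) *
            S.inputKernel μ ⟨j, a⟩) * (S.label ⟨j, a⟩ - γ₀⁻¹ * m s ⟨j, a⟩) := by
  obtain ⟨A, hF⟩ := hφ.exists_isControlledField γ₀ S.inputKernel
  obtain ⟨M, hM⟩ := exists_bound_trainingControl S γ₀ S.horizon hY.continuous_moment.continuousOn
  have h := integral_comp_flow_eq_sum hF
    (aestronglyMeasurable_trainingControl S γ₀ hY.continuous_moment) hM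
    (countable_range S.time)
    (fun s hs => continuousAt_trainingControl S γ₀ hY.continuous_moment.continuousAt hs)
    hY.continuous_flow hY.isPath (hasExpMoments_of_isGaussian (siteLaw S.inputKernel))
    ((isFactor_snd hφ.one_le).mul (hφ.isFactor_comp_fst μ))
    (w := fun α X => γ₀ * (φ (X.1 μ) * φ (X.1 α) + S.inputKernel μ α *
        (deriv φ (X.1 μ) * X.2 * (deriv φ (X.1 α) * X.2))))
    (fun α => ⟨_, ((hφ.isObservable_feature μ α).add
      ((hφ.isObservable_gradient μ α).const_mul (S.inputKernel μ α))).const_mul γ₀⟩)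
    (hasDerivAt_site_output hφ μ) ht
  have h0 := integral_outputObs_siteLaw S.inputKernel φ μ
  simp only [outputObs] at h0 ⊢
  rw [h, h0, zero_add, ← intervalIntegral.integral_const_mul]
  refine intervalIntegral.integral_congr fun s hs => ?_
  rw [uIcc_of_le ht.1] at hs
  have hs' : s ∈ Icc 0 S.horizon := ⟨hs.1, hs.2.trans ht.2⟩
  rw [sum_trainingControl_mul S γ₀ s (m s), Finset.mul_sum]
  refine Finset.sum_congr rfl fun j _ => ?_
  rw [mul_left_comm, Finset.mul_sum]
  congr 1
  refine Finset.sum_congr rfl fun a _ => ?_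
  rw [integral_const_mul, integral_add (hY.integrable S hφ (hφ.isObservable_feature μ _) hs')
    ((hY.integrable S hφ (hφ.isObservable_gradient μ _) hs').const_mul _), integral_const_mul]
  field_simp

/-- A flow whose driving outputs are its own expected outputs. -/
structure IsSelfConsistentFlow (φ : ℝ → ℝ) (γ₀ : ℝ) (m : ℝ → S.Sample → ℝ)
    (Y : (S.Sample → ℝ) × ℝ → ℝ → (S.Sample → ℝ) × ℝ) : Prop extends IsSiteFlow S φ γ₀ m Y where
  moment_eq : ∀ t ∈ Icc 0 S.horizon, m t = ∫ x, outputObs φ (Y x t) ∂(siteLaw S.inputKernel)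

theorem IsSiteFlow.integral_outputObs_apply (hY : IsSiteFlow S φ γ₀ m Y) (hφ : IsActivation φ C)
    {t : ℝ} (ht : t ∈ Icc 0 S.horizon) (μ : S.Sample) :
    (∫ x, outputObs φ (Y x t) ∂(siteLaw S.inputKernel)) μ =
      ∫ x, outputObs φ (Y x t) μ ∂(siteLaw S.inputKernel) :=
  eval_integral (f := fun x α => outputObs φ (Y x t) α) (fun α => hY.integrable S hφ
    ((isFactor_snd hφ.one_le).mul (hφ.isFactor_comp_fst α)) ht) μ

theorem exists_isSelfConsistentFlow (hφ : IsActivation φ C) (hγ₀ : 0 < γ₀) :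
    ∃ m Y, IsSelfConsistentFlow S φ γ₀ m Y := by
  obtain ⟨m, Y, hm, hYc, hY, hmY⟩ := exists_selfConsistent_site hφ hγ₀ S.inputKernel S.label
    (horizon_nonneg S) (hasExpMoments_of_isGaussian (siteLaw S.inputKernel))
    (U := fun α s => S.window α.1 s) (fun α s => window_nonneg S _ _)
    (fun α s => window_le_one S _ _) (fun α => measurable_window S _) (countable_range S.time)
    fun α s hs => continuousAt_window S _ hs
  exact ⟨m, Y, ⟨hm, hYc, hY⟩, hmY⟩

variable {Ω' : Type*} [MeasurableSpace Ω'] {P' : Measure Ω'} [IsProbabilityMeasure P']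
  {χ : Ω' → EuclideanSpace ℝ S.Sample} {ξ : Ω' → ℝ}

theorem IsInitialField.hasLaw (h : IsInitialField S P' χ ξ) :
    HasLaw (fun ω => ((χ ω).ofLp, ξ ω)) (siteLaw S.inputKernel) P' :=
  hasLaw_siteLaw S.inputKernel h.law_χ h.law_ξ h.indep

/-- Almost surely, the process `(h, z)` moves along the flow `Y` on `[0, S.horizon]`, from the
initial fields. -/
def FollowsFlow (P' : Measure Ω') (χ : Ω' → EuclideanSpace ℝ S.Sample) (ξ : Ω' → ℝ)
    (Y : (S.Sample → ℝ) × ℝ → ℝ → (S.Sample → ℝ) × ℝ) (h : S.Sample → ℝ → Ω' → ℝ)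
    (z : ℝ → Ω' → ℝ) : Prop :=
  ∀ᵐ ω ∂P', ∀ t ∈ Icc 0 S.horizon,
    ((fun μ => h μ t ω), z t ω) = Y ((χ ω).ofLp, ξ ω) t

variable {h : S.Sample → ℝ → Ω' → ℝ} {z : ℝ → Ω' → ℝ} {f : S.Sample → ℝ → ℝ}

theorem FollowsFlow.integral_eq (hh : FollowsFlow S P' χ ξ Y h z) (hχξ : IsInitialField S P' χ ξ)
    (hY : Continuous (Function.uncurry Y)) {G : (S.Sample → ℝ) × ℝ → ℝ} (hG : Continuous G)
    {t : ℝ} (ht : t ∈ Icc 0 S.horizon) :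
    ∫ ω, G ((fun μ => h μ t ω), z t ω) ∂P' = ∫ x, G (Y x t) ∂(siteLaw S.inputKernel) := by
  have hc : Continuous fun x => G (Y x t) :=
    hG.comp (hY.comp (by fun_prop : Continuous fun x => (x, t)))
  rw [← (hχξ.hasLaw S).integral_comp hc.aestronglyMeasurable]
  refine integral_congr_ae ?_
  filter_upwards [hh] with ω hω
  simp only [Function.comp_apply, hω t ht]

theorem FollowsFlow.integrable (hh : FollowsFlow S P' χ ξ Y h z)
    (hχξ : IsInitialField S P' χ ξ) (hY : IsSiteFlow S φ γ₀ m Y) (hφ : IsActivation φ C)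
    {G : (S.Sample → ℝ) × ℝ → ℝ} {B : ℝ} (hG : IsObservable G B)
    {t : ℝ} (ht : t ∈ Icc 0 S.horizon) :
    Integrable (fun ω => G ((fun μ => h μ t ω), z t ω)) P' := by
  have hi := hY.integrable S hφ hG ht
  rw [← (hχξ.hasLaw S).map_eq] at hi
  refine (hi.comp_aemeasurable (hχξ.hasLaw S).aemeasurable).congr ?_
  filter_upwards [hh] with ω hω
  simp only [Function.comp_apply, hω t ht]

/-- The right-hand side of the equation for the outputs, in terms of the flow. -/
theorem FollowsFlow.integral_kernels (hh : FollowsFlow S P' χ ξ Y h z)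
    (hχξ : IsInitialField S P' χ ξ) (hY : IsSiteFlow S φ γ₀ m Y) (hφ : IsActivation φ C)
    (hγ₀ : γ₀ ≠ 0) (hf : ∀ t ∈ Icc 0 S.horizon, ∀ α, γ₀⁻¹ * m t α = f α t) (μ : S.Sample)
    {t : ℝ} (ht : t ∈ Icc 0 S.horizon) :
    ∫ s in (0 : ℝ)..t, ∑ j, S.window j s * ∑ a : Fin (S.size j),
        (siteFeatureKernel P' φ h μ ⟨j, a⟩ s +
          siteGradientKernel P' φ h z μ ⟨j, a⟩ s * S.inputKernel μ ⟨j, a⟩) *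
        (S.label ⟨j, a⟩ - f ⟨j, a⟩ s) =
      γ₀⁻¹ * ∫ x, outputObs φ (Y x t) μ ∂(siteLaw S.inputKernel) := by
  rw [hY.integral_output S hφ hγ₀ μ ht]
  refine intervalIntegral.integral_congr fun s hs => ?_
  rw [uIcc_of_le ht.1] at hs
  have hs' : s ∈ Icc 0 S.horizon := ⟨hs.1, hs.2.trans ht.2⟩
  have h1 : ∀ ν, siteFeatureKernel P' φ h μ ν s = _ := fun ν =>
    hh.integral_eq S hχξ hY.continuous_flow (hφ.isObservable_feature μ ν).continuous hs'
  have h2 : ∀ ν, siteGradientKernel P' φ h z μ ν s = _ := fun ν =>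
    hh.integral_eq S hχξ hY.continuous_flow (hφ.isObservable_gradient μ ν).continuous hs'
  simp only [h1, h2, hf s hs']

/-- A self-consistent flow, started from the initial fields, solves the single-site system. -/
theorem IsSelfConsistentFlow.isSingleSiteSolution (hY : IsSelfConsistentFlow S φ γ₀ m Y)
    (hφ : IsActivation φ C) (hγ₀ : γ₀ ≠ 0) (hχξ : IsInitialField S P' χ ξ) :
    IsSingleSiteSolution S φ γ₀ P' χ ξ (fun μ t => γ₀⁻¹ * m t μ)
      (fun μ t ω => (Y ((χ ω).ofLp, ξ ω) t).1 μ) (fun t ω => (Y ((χ ω).ofLp, ξ ω) t).2) := by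
  have hYt : ∀ t, Continuous fun x => Y x t := fun t =>
    hY.continuous_flow.comp (by fun_prop : Continuous fun x => (x, t))
  have hYx : ∀ x, Continuous (Y x) := fun x =>
    hY.continuous_flow.comp (by fun_prop : Continuous fun t : ℝ => (x, t))
  have hm := hY.continuous_moment
  have hh : FollowsFlow S P' χ ξ Y (fun μ t ω => (Y ((χ ω).ofLp, ξ ω) t).1 μ)
      (fun t ω => (Y ((χ ω).ofLp, ξ ω) t).2) := ae_of_all _ fun ω t _ => rfl
  have hx := (hχξ.hasLaw S).aemeasurable
  have hiff := fun ω => (isPath_siteField_iff S (γ₀ := γ₀) hφ hm (f := fun μ t => γ₀⁻¹ * m t μ)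
    (fun _ _ _ => rfl) (hYx ((χ ω).ofLp, ξ ω)).continuousOn).1 (hY.isPath _)
  exact {
    continuousOn_f := fun μ => (((continuous_apply μ).comp hm).const_mul _).continuousOn
    aemeasurable_h := fun μ t _ =>
      ((continuous_apply μ).comp (continuous_fst.comp (hYt t))).measurable.comp_aemeasurable hx
    aemeasurable_z := fun t _ => (continuous_snd.comp (hYt t)).measurable.comp_aemeasurable hx
    continuousOn_h := ae_of_all _ fun ω μ =>
      ((continuous_apply μ).comp (continuous_fst.comp (hYx _))).continuousOn
    continuousOn_z := ae_of_all _ fun ω => (continuous_snd.comp (hYx _)).continuousOn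
    integrable_feature := fun μ ν t ht =>
      hh.integrable S hχξ hY.toIsSiteFlow hφ (hφ.isObservable_feature μ ν) ht
    integrable_gradient := fun μ ν t ht =>
      hh.integrable S hχξ hY.toIsSiteFlow hφ (hφ.isObservable_gradient μ ν) ht
    h_eq := ae_of_all _ fun ω => (hiff ω).1
    z_eq := ae_of_all _ fun ω => (hiff ω).2
    f_eq := fun μ t ht => by
      rw [hh.integral_kernels S hχξ hY.toIsSiteFlow hφ hγ₀ (fun _ _ _ => rfl) μ ht,
        hY.moment_eq t ht, hY.integral_outputObs_apply S hφ ht] }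

/-- Every solution of the single-site system moves along a self-consistent flow: the flow is
driven by the outputs of the solution, and it is self-consistent because the expected outputs
satisfy the equation that determines `f`. -/
theorem IsSingleSiteSolution.exists_flow (hs : IsSingleSiteSolution S φ γ₀ P' χ ξ f h z)
    (hφ : IsActivation φ C) (hγ₀ : γ₀ ≠ 0) (hχξ : IsInitialField S P' χ ξ) :
    ∃ m Y, IsSelfConsistentFlow S φ γ₀ m Y ∧
      (∀ t ∈ Icc 0 S.horizon, ∀ α, γ₀⁻¹ * m t α = f α t) ∧ FollowsFlow S P' χ ξ Y h z := by
  obtain ⟨A, hF⟩ := hφ.exists_isControlledField γ₀ S.inputKernel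
  have hb := horizon_nonneg S
  set m : ℝ → S.Sample → ℝ := fun t α =>
    γ₀ * IccExtend hb ((Icc 0 S.horizon).domRestrict (f α)) t with hm_def
  have hm : Continuous m := continuous_pi fun α => continuous_const.mul
    (continuousOn_iff_continuous_domRestrict.1 (hs.continuousOn_f α)).Icc_extend'
  have hf : ∀ t ∈ Icc 0 S.horizon, ∀ α, γ₀⁻¹ * m t α = f α t := fun t ht α => by
    rw [hm_def]
    simp only [IccExtend_of_mem _ _ ht, domRestrict_apply]
    field_simp
  obtain ⟨M, hM⟩ := exists_bound_trainingControl S γ₀ S.horizon hm.continuousOn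
  have hcm := aestronglyMeasurable_trainingControl S γ₀ hm
  obtain ⟨Y, hYc, hY⟩ := hF.exists_flow hcm hM hb
  have hYs : IsSiteFlow S φ γ₀ m Y := ⟨hm, hYc, hY⟩
  have hh : FollowsFlow S P' χ ξ Y h z := by
    filter_upwards [hs.continuousOn_h, hs.continuousOn_z, hs.h_eq, hs.z_eq] with ω h1 h2 h3 h4
    have hp := (isPath_siteField_iff S (x := ((χ ω).ofLp, ξ ω))
      (X := fun t => ((fun μ => h μ t ω), z t ω)) hφ hm hf
      ((continuousOn_pi.2 h1).prodMk h2)).2 ⟨h3, h4⟩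
    exact hp.eqOn hF hcm hM (hY _)
  refine ⟨m, Y, ⟨hYs, fun t ht => funext fun μ => ?_⟩, hf, hh⟩
  rw [hYs.integral_outputObs_apply S hφ ht, ← mul_right_inj' (inv_ne_zero hγ₀), hf t ht μ,
    hs.f_eq μ t ht, hh.integral_kernels S hχξ hYs hφ hγ₀ hf μ ht]

end site

/-! ### The infinite-width limit -/

section limit
variable {T D : ℕ} (S : TaskSequence T D) {φ : ℝ → ℝ} {γ₀ C : ℝ}

/-- The trajectory of neuron `i`, extended by its end values outside of `[0, S.horizon]`, and zero
if it is not continuous there. -/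
noncomputable def neuronPath {N : ℕ} (θ : ℝ → Param N D) (i : Fin N) (t : ℝ) :
    (S.Sample → ℝ) × ℝ :=
  pathOn S.horizon (fun t => neuronState S (θ t) i) (projIcc 0 S.horizon (horizon_nonneg S) t)

theorem continuous_neuronPath {N : ℕ} (θ : ℝ → Param N D) (i : Fin N) :
    Continuous (neuronPath S θ i) :=
  (pathOn S.horizon fun t => neuronState S (θ t) i).continuous.comp continuous_projIcc

theorem neuronPath_eq {N : ℕ} {θ : ℝ → Param N D} (hθ : ContinuousOn θ (Icc 0 S.horizon))
    (i : Fin N) {t : ℝ} (ht : t ∈ Icc 0 S.horizon) :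
    neuronPath S θ i t = neuronState S (θ t) i := by
  have h : ContinuousOn (fun t => neuronState S (θ t) i) (Icc 0 S.horizon) :=
    (continuous_neuronState S i).comp_continuousOn hθ
  rw [neuronPath, projIcc_of_mem _ ht, pathOn_apply h]

variable {Ω : ℕ → Type*} [∀ N, MeasurableSpace (Ω N)] {P : ∀ N, Measure (Ω N)}
  [∀ N, IsProbabilityMeasure (P N)] {θ : ∀ N, Ω N → ℝ → Param N D}
  {m : ℝ → S.Sample → ℝ} {Y : (S.Sample → ℝ) × ℝ → ℝ → (S.Sample → ℝ) × ℝ}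

/-- The neurons of the networks and the single-site flow form a mean-field system: the outputs that
drive the neurons are `γ₀⁻¹` times empirical means of `z φ(h_μ)` over the neurons. -/
theorem IsSelfConsistentFlow.exists_isMeanFieldSystem (hY : IsSelfConsistentFlow S φ γ₀ m Y)
    (hφ : IsActivation φ C) (hγ₀ : 0 < γ₀)
    (hθ_init : ∀ N, IsStandardInit (P N) (fun ω => θ N ω 0))
    (hθ_flow : ∀ N, ∀ᵐ ω ∂(P N), IsSequentialGradientFlow S φ γ₀ (θ N ω)) :
    ∃ M, IsMeanFieldSystem (siteField φ γ₀ S.inputKernel) (outputObs φ) (trainingControl S γ₀) M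
      γ₀⁻¹ S.horizon (siteLaw S.inputKernel) m Y P (fun N i ω => neuronState S (θ N ω 0) i)
      (fun N ω i => neuronPath S (θ N ω) i) := by
  obtain ⟨M, hM⟩ := exists_bound_trainingControl S γ₀ S.horizon hY.continuous_moment.continuousOn
  exact ⟨M, {
    horizon_nonneg := horizon_nonneg S
    lip_nonneg := inv_nonneg.2 hγ₀.le
    measurable_control := fun m hm => aestronglyMeasurable_trainingControl S γ₀ hm
    lip_control := trainingControl_lip S hγ₀.le
    expMoments := hasExpMoments_of_isGaussian _
    continuous_moment := hY.continuous_moment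
    bound_control := hM
    continuous_flow := hY.continuous_flow
    isPath_flow := hY.isPath
    moment_eq := hY.moment_eq
    isIIDArray := ⟨fun N i => (hθ_init N).hasLaw_neuronState S i,
      fun N => (hθ_init N).iIndepFun_neuronState S⟩
    continuous_particle := fun N ω i => continuous_neuronPath S (θ N ω) i
    isPath_particle := fun N => by
      filter_upwards [hθ_flow N] with ω hω i
      refine (hω.isPath_neuronState S hφ hγ₀.ne' i).congr (fun t ht => ?_) fun t ht =>
        (neuronPath_eq S hω.continuousOn i ht).symm
      simp only [neuronPath_eq S hω.continuousOn _ ht] }⟩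

/-- Empirical means of observables over the neurons concentrate on their single-site
expectations. -/
theorem IsSelfConsistentFlow.concentratesOn (hY : IsSelfConsistentFlow S φ γ₀ m Y)
    (hφ : IsActivation φ C) (hγ₀ : 0 < γ₀)
    (hθ_init : ∀ N, IsStandardInit (P N) (fun ω => θ N ω 0))
    (hθ_flow : ∀ N, ∀ᵐ ω ∂(P N), IsSequentialGradientFlow S φ γ₀ (θ N ω))
    {G : (S.Sample → ℝ) × ℝ → ℝ} {B : ℝ} (hG : IsObservable G B)
    {q : ∀ N, Param N D → ℝ} (hq : ∀ N θ, q N θ = average fun i => G (neuronState S θ i))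
    {q' : ℝ → ℝ} (hq' : ∀ t ∈ Icc 0 S.horizon, q' t = ∫ x, G (Y x t) ∂(siteLaw S.inputKernel)) :
    ConcentratesOn P S.horizon (fun N ω t => q N (θ N ω t)) q' := by
  intro ε hε
  obtain ⟨M, h⟩ := hY.exists_isMeanFieldSystem S hφ hγ₀ hθ_init hθ_flow
  obtain ⟨A, hF⟩ := hφ.exists_isControlledField γ₀ S.inputKernel
  refine (h.average_observable hF hφ.isObservable_output (fun α =>
    (isFactor_snd hφ.one_le).mul (hφ.isFactor_comp_fst α)) hG hε).mono_ae fun N => ?_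
  filter_upwards [hθ_flow N] with ω hω
  rintro ⟨t, ht, hεt⟩
  refine ⟨t, ht, ?_⟩
  simp only [neuronPath_eq S hω.continuousOn _ ht]
  rwa [← hq, ← hq' t ht]

variable {Ω' : Type*} [MeasurableSpace Ω'] {P' : Measure Ω'} [IsProbabilityMeasure P']
  {χ : Ω' → EuclideanSpace ℝ S.Sample} {ξ : Ω' → ℝ}
  {h : S.Sample → ℝ → Ω' → ℝ} {z : ℝ → Ω' → ℝ}

/-- The trajectories of `k` neurons converge in distribution to independent copies of the
single-site process. -/
theorem IsSelfConsistentFlow.tendstoInDistribution (hY : IsSelfConsistentFlow S φ γ₀ m Y)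
    (hφ : IsActivation φ C) (hγ₀ : 0 < γ₀)
    (hθ_meas : ∀ N, ∀ t ∈ Icc 0 S.horizon, AEMeasurable (fun ω => θ N ω t) (P N))
    (hθ_init : ∀ N, IsStandardInit (P N) (fun ω => θ N ω 0))
    (hθ_flow : ∀ N, ∀ᵐ ω ∂(P N), IsSequentialGradientFlow S φ γ₀ (θ N ω))
    (hχξ : IsInitialField S P' χ ξ) (hh : FollowsFlow S P' χ ξ Y h z)
    (k : ℕ) (e : ∀ n, Fin k ↪ Fin (k + n)) :
    TendstoInDistribution
      (fun n (ω : Ω (k + n)) => pathOn S.horizon (fun t (i : Fin k) =>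
        neuronState S (θ (k + n) ω t) (e n i))) atTop
      (fun ω : Fin k → Ω' => pathOn S.horizon (fun t (i : Fin k) =>
        ((fun μ : S.Sample => h μ t (ω i)), z t (ω i))))
      (fun n => P (k + n)) (Measure.pi (fun _ : Fin k => P')) := by
  obtain ⟨M, hsys⟩ := hY.exists_isMeanFieldSystem S hφ hγ₀ hθ_init hθ_flow
  obtain ⟨A, hF⟩ := hφ.exists_isControlledField γ₀ S.inputKernel
  refine (hsys.tendstoInDistribution hF hφ.isObservable_output (fun α =>
    (isFactor_snd hφ.one_le).mul (hφ.isFactor_comp_fst α)) (fun N i t ht => ?_)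
    (hχξ.hasLaw S) k e).congr (fun n => ?_) ?_
  · refine ((continuous_neuronState S i).measurable.comp_aemeasurable (hθ_meas N t ht)).congr ?_
    filter_upwards [hθ_flow N] with ω hω
    exact (neuronPath_eq S hω.continuousOn i ht).symm
  · filter_upwards [hθ_flow (k + n)] with ω hω
    exact pathOn_congr fun t ht => funext fun i => neuronPath_eq S hω.continuousOn (e n i) ht
  · have hi : ∀ i : Fin k, ∀ᵐ ω ∂(Measure.pi fun _ : Fin k => P'), ∀ t ∈ Icc 0 S.horizon,
        ((fun μ => h μ t (ω i)), z t (ω i)) = Y ((χ (ω i)).ofLp, ξ (ω i)) t := fun i =>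
      (measurePreserving_eval (fun _ : Fin k => P') i).quasiMeasurePreserving.ae hh
    filter_upwards [ae_all_iff.2 hi] with ω hω
    exact pathOn_congr fun t ht => funext fun i => (hω i t ht).symm

end limit

end ContinualMuP

theorem proposition1 {T D : ℕ} (S : TaskSequence T D) (γ₀ : ℝ) (hγ₀ : 0 < γ₀)
    (φ : ℝ → ℝ) (hφ : Differentiable ℝ φ)
    (hφ_bdd : ∃ C : ℝ, ∀ u, |deriv φ u| ≤ C)
    (hφ_lip : ∃ L : NNReal, LipschitzWith L (deriv φ))
    -- a probability space that carries the Gaussian initial fields of a single site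
    {Ω' : Type*} [MeasurableSpace Ω'] (P' : Measure Ω') [IsProbabilityMeasure P']
    (χ : Ω' → EuclideanSpace ℝ S.Sample) (ξ : Ω' → ℝ) (hχξ : IsInitialField S P' χ ξ)
    -- for every width `N`, a network with Gaussian initialization trained on the tasks in sequence
    {Ω : ℕ → Type*} [∀ N, MeasurableSpace (Ω N)] (P : ∀ N, Measure (Ω N))
    [∀ N, IsProbabilityMeasure (P N)]
    (θ : ∀ N, Ω N → ℝ → Param N D)
    (hθ_meas : ∀ N, ∀ t ∈ Icc 0 S.horizon, AEMeasurable (fun ω => θ N ω t) (P N))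
    (hθ_init : ∀ N, IsStandardInit (P N) (fun ω => θ N ω 0))
    (hθ_flow : ∀ N, ∀ᵐ ω ∂(P N), IsSequentialGradientFlow S φ γ₀ (θ N ω)) :
    -- the self-consistent system of the limit has a solution,
    (∃ f h z, IsSingleSiteSolution S φ γ₀ P' χ ξ f h z) ∧
    -- and every solution describes the limit:
    ∀ f h z, IsSingleSiteSolution S φ γ₀ P' χ ξ f h z →
      -- the trajectories of preactivations and pre-gradients of any `k` neurons converge jointly
      -- in law to `k` independent copies of the single-site process
      (∀ (k : ℕ) (e : ∀ n, Fin k ↪ Fin (k + n)),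
        TendstoInDistribution
          (fun n (ω : Ω (k + n)) => pathOn S.horizon (fun t (i : Fin k) =>
            ((fun μ : S.Sample => preact (θ (k + n) ω t) (S.input μ) (e n i)),
              preGrad (θ (k + n) ω t) (e n i))))
          atTop
          (fun ω : Fin k → Ω' => pathOn S.horizon (fun t (i : Fin k) =>
            ((fun μ : S.Sample => h μ t (ω i)), z t (ω i))))
          (fun n => P (k + n)) (Measure.pi (fun _ : Fin k => P'))) ∧
      -- the feature and gradient kernels concentrate on their expectations
      (∀ μ ν, ConcentratesOn P S.horizon
        (fun N ω t => featureKernel φ (θ N ω t) (S.input μ) (S.input ν))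
        (siteFeatureKernel P' φ h μ ν)) ∧
      (∀ μ ν, ConcentratesOn P S.horizon
        (fun N ω t => gradientKernel φ (θ N ω t) (S.input μ) (S.input ν))
        (siteGradientKernel P' φ h z μ ν)) ∧
      -- the output concentrates on `f`, which is its expectation under the single-site process
      (∀ μ, ConcentratesOn P S.horizon (fun N ω t => output φ γ₀ (θ N ω t) (S.input μ)) (f μ)) ∧
      (∀ μ, ∀ t ∈ Icc 0 S.horizon, Integrable (fun ω => z t ω * φ (h μ t ω)) P' ∧
        f μ t = γ₀⁻¹ * ∫ ω, z t ω * φ (h μ t ω) ∂P') := by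
  obtain ⟨C, hC⟩ := exists_isActivation hφ hφ_bdd hφ_lip
  refine ⟨?_, fun f h z hs => ?_⟩
  · obtain ⟨m, Y, hY⟩ := exists_isSelfConsistentFlow S hC hγ₀
    exact ⟨_, _, _, hY.isSingleSiteSolution S hC hγ₀.ne' hχξ⟩
  obtain ⟨m, Y, hY, hf, hh⟩ := hs.exists_flow S hC hγ₀.ne' hχξ
  have hout : ∀ μ, IsObservable (fun X : (S.Sample → ℝ) × ℝ => outputObs φ X μ) _ := fun μ =>
    (isFactor_snd hC.one_le).mul (hC.isFactor_comp_fst μ)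
  have hfm : ∀ μ, ∀ t ∈ Icc 0 S.horizon,
      f μ t = γ₀⁻¹ * ∫ x, outputObs φ (Y x t) μ ∂(siteLaw S.inputKernel) := fun μ t ht => by
    rw [← hf t ht, hY.moment_eq t ht, hY.integral_outputObs_apply S hC ht]
  refine ⟨fun k e => ?_, fun μ ν => ?_, fun μ ν => ?_, fun μ => ?_, fun μ t ht => ⟨?_, ?_⟩⟩
  · exact hY.tendstoInDistribution S hC hγ₀ hθ_meas hθ_init hθ_flow hχξ hh k e
  · exact hY.concentratesOn S hC hγ₀ hθ_init hθ_flow (hC.isObservable_feature μ ν)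
      (q := fun N θ => featureKernel φ θ (S.input μ) (S.input ν))
      (fun N θ => featureKernel_eq_average S θ μ ν) fun t ht =>
        hh.integral_eq S hχξ hY.continuous_flow (hC.isObservable_feature μ ν).continuous ht
  · exact hY.concentratesOn S hC hγ₀ hθ_init hθ_flow (hC.isObservable_gradient μ ν)
      (q := fun N θ => gradientKernel φ θ (S.input μ) (S.input ν))
      (fun N θ => gradientKernel_eq_average S hφ θ μ ν) fun t ht =>
        hh.integral_eq S hχξ hY.continuous_flow (hC.isObservable_gradient μ ν).continuous ht
  · exact hY.concentratesOn S hC hγ₀ hθ_init hθ_flow ((hout μ).const_mul γ₀⁻¹)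
      (q := fun N θ => output φ γ₀ θ (S.input μ))
      (fun N θ => by rw [output_eq_average, ← average_const_mul]) fun t ht => by
        rw [hfm μ t ht, integral_const_mul]
  · exact hh.integrable S hχξ hY.toIsSiteFlow hC (hout μ) ht
  · rw [hfm μ t ht, ← hh.integral_eq S hχξ hY.continuous_flow (hout μ).continuous ht]
    rfl
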